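/- **Notation.** A partition is identified with its diagram of cells $(i,j)$, $i,j\ge 0$ ($i$ the row, row $0$ the largest). For a partition $\nu$ let $n(\nu)=\sum_{(i,j)\in\nu} i$ and $T_\nu=\prod_{(i,j)\in\nu}t^iq^j$. Let $P_\nu(x;q,t)$ be the Macdonald polynomials (unitriangular with respect to dominance on the Schur functions, and orthogonal for $\langle p_\lambda,p_\lambda\rangle_{q,t}=z_\lambda\prod_i\frac{1-q^{\lambda_i}}{1-t^{\lambda_i}}$), $Q_\nu=P_\nu/\langle P_\nu,P_\nu\rangle_{q,t}$, $J_\nu=\prod_{c\in\nu}(1-q^{a(c)+1}t^{l(c)})\,Q_\nu$ with $a,l$ arm and leg, $H_\nu(x;q,t)=J_\nu[X/(1-t);q,t]$ and $\widetilde H_\nu(x;q,t)=t^{n(\nu)}H_\nu(x;q,1/t)$. Symmetric functions are regarded as polynomials in the power sums $p_1,p_2,\dots$. Let $\mathbb k$ be a field of characteristic $0$. For $\nu\vdash n$ with cells $(a_1,b_1),\dots,(a_n,b_n)$ in lexicographic order, put $\Delta_\nu=\det(x_i^{a_j}y_i^{b_j})_{i,j=1}^n$, and let $\mathbf M_\nu\subset\mathbb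 k[x_1,\dots,x_n;y_1,\dots,y_n]$ be the span of all partial derivatives of $\Delta_\nu$, with the diagonal action of $S_n$. For a bigraded $S_n$-submodule $W$ with component $W_{h,k}$ of degree $h$ in $x$ and $k$ in $y$, its Frobenius characteristic is $\mathcal F(W)=\frac1{n!}\sum_{\sigma\in S_n}\sum_{h,k}t^hq^k\,\mathrm{tr}(\sigma|W_{h,k})\,p_{\lambda(\sigma)}$, with $\lambda(\sigma)$ the cycle type of $\sigma$, and its Hilbert series is $\sum_{h,k}t^hq^k\dim W_{h,k}$. Let $\mu\vdash n+1$ have $m$ corners and let $\alpha^{(1)},\dots,\alpha^{(m)}\vdash n$ be the partitions obtained from $\mu$ by removing one corner. Write $T_i=T_{\alpha^{(i)}}$. Let $S=\{i_1<\dots<i_k\}\subseteq\{1,\dots,m\}$ with $k\ge1$, and put $$F_{\supseteq S}(q,t)=\sum_{s=1}^k\Bigl(\prod_{r\ne s}\frac1{1-T_{i_s}/T_{i_r}}\Bigr)\partial_{p_1}^n\widetilde H_{\alpha^{(i_s)}}(x;q,t)\in\mathbb Q(q,t).$$ We say that the *SF property* holds for $\mu$ if $\sum_i\mathbf M_{\alpha^{(i)}}$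 has a basis $\mathcal B$ of bihomogeneous polynomials with subsets $\mathcal B_1,\dots,\mathcal B_m$ such that: (i) $\mathbf M_{\alpha^{(i)}}$ is the span of $\mathcal B_i$; (ii) for every word $\epsilon\in\{0,1\}^m$ the span $\mathbf M^\epsilon$ of $\mathcal B^\epsilon=\{b\in\mathcal B: b\in\mathcal B_i\Leftrightarrow\epsilon_i=1\text{ for all }i\}$ is $S_n$-invariant; (iii) if $\epsilon_i=1$, then $\{P(\partial_x,\partial_y)\Delta_{\alpha^{(i)}}: P\in\mathbf M^\epsilon\}\cong\mathbf M^{\tau_i\epsilon}$ as bigraded $S_n$-modules, where $\tau_i$ complements all letters of $\epsilon$ except the $i$-th. **Proposition 3.5.** (a) If the SF property holds for $\mu$ and $\mathcal F(\mathbf M_{\alpha^{(i)}})=\widetilde H_{\alpha^{(i)}}$ for all $i\in S$, then $$\mathcal F\Bigl(\bigcap_{i\in S}\mathbf M_{\alpha^{(i)}}\Bigr)=\sum_{s=1}^k\Bigl(\prod_{r\ne s}\frac1{1-T_{i_s}/T_{i_r}}\Bigr)\widetilde H_{\alpha^{(i_s)}},$$ and the Hilbert series of $\bigcap_{i\in S}\mathbf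 M_{\alpha^{(i)}}$ is $F_{\supseteq S}(q,t)$. (b) Without either of these two hypotheses, $F_{\supseteq S}(q,t)$ is regular at $t=1$ and $$\lim_{q\to1}F_{\supseteq S}(q,1)=\frac{n!}{k}.$$ -/

import Mathlib

open MvPolynomial
open scoped Topology

noncomputable section

namespace SciFi

/-! ## Diagrams

A partition is a Young diagram; the cell `(i, j)` (counted from `0`) lies in row `i` and column `j`,
so that row `0` is the largest one. -/

/-- `n(μ)`, the sum of the (zero-based) row indices of the cells. -/
def nStat (μ : YoungDiagram) : ℕ := ∑ c ∈ μ.cells, c.1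

/-- The number of cells of the row of `c` strictly beyond `c`. -/
def arm (μ : YoungDiagram) (c : ℕ × ℕ) : ℕ := μ.rowLen c.1 - (c.2 + 1)

/-- The number of cells of the column of `c` strictly beyond `c`. -/
def leg (μ : YoungDiagram) (c : ℕ × ℕ) : ℕ := μ.colLen c.2 - (c.1 + 1)

/-- Strict dominance `μ < lam` between partitions of the same number. -/
def DomLT (μ lam : YoungDiagram) : Prop :=
  μ ≠ lam ∧ μ.card = lam.card ∧
    ∀ k, ∑ i ∈ Finset.range k, μ.rowLen i ≤ ∑ i ∈ Finset.range k, lam.rowLen i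

/-- The removable (corner) cells of `μ`. -/
def Corner (μ : YoungDiagram) : Type :=
  {c : ℕ × ℕ // c ∈ μ ∧ (c.1 + 1, c.2) ∉ μ ∧ (c.1, c.2 + 1) ∉ μ}

instance (μ : YoungDiagram) : DecidableEq (Corner μ) :=
  inferInstanceAs (DecidableEq {c : ℕ × ℕ // c ∈ μ ∧ (c.1 + 1, c.2) ∉ μ ∧ (c.1, c.2 + 1) ∉ μ})

/-- The predecessor of `μ` obtained by removing a corner cell. -/
def predecessor {μ : YoungDiagram} (c : Corner μ) : YoungDiagram where
  cells := μ.cells.erase c.1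
  isLowerSet := by
    obtain ⟨⟨i, j⟩, hc, h1, h2⟩ := c
    rintro ⟨a, b⟩ ⟨a', b'⟩ ⟨ha, hb⟩ hab
    simp only [Finset.coe_erase, Set.mem_sdiff, Finset.mem_coe, YoungDiagram.mem_cells,
      Set.mem_singleton_iff, Prod.mk.injEq] at hab ⊢
    simp only at ha hb
    refine ⟨μ.up_left_mem ha hb hab.1, ?_⟩
    rintro ⟨rfl, rfl⟩
    rcases Nat.lt_or_ge a' a with h | h
    · exact h1 (μ.up_left_mem h hb hab.1)
    · rcases Nat.lt_or_ge b' b with h' | h'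
      · exact h2 (μ.up_left_mem ha h' hab.1)
      · exact hab.2 ⟨le_antisymm h ha, le_antisymm h' hb⟩

/-! ## Symmetric functions

Over a field `K` of characteristic zero the ring of symmetric functions is the polynomial ring in
the power sums: the variable `X k` is `p_k`, for `k ≥ 1`. -/

/-- The ring of symmetric functions with coefficients in `K`. -/
abbrev Sym (K : Type*) [Field K] := MvPolynomial ℕ+ K

section Macdonald

variable {K : Type*} [Field K]

/-- The product of the power sums `p_k`, `k` running over a multiset of positive integers. -/
def powerSum (K : Type*) [Field K] (s : Multiset ℕ) : Sym K :=
  (s.map fun k => (X (Nat.toPNat' k) : Sym K)).prod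

/-- `z_ν = ∏ k ^ m_k * m_k !`, with `m_k` the multiplicity of `k`. -/
def zCoeff (s : Multiset ℕ) : ℕ :=
  ∏ k ∈ s.toFinset, k ^ s.count k * (s.count k).factorial

/-- The complete homogeneous symmetric function `h_n = ∑_{ν ⊢ n} p_ν / z_ν`. -/
def complete (K : Type*) [Field K] (n : ℕ) : Sym K :=
  ∑ ν : n.Partition, C ((zCoeff ν.parts : K)⁻¹) * powerSum K ν.parts

/-- `h_z` for an integer index, zero for negative `z`. -/
def completeInt (K : Type*) [Field K] (z : ℤ) : Sym K :=
  if 0 ≤ z then complete K z.toNat else 0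

/-- The Schur function `S_lam = det (h_{lam_i - i + j})`. -/
def schur (K : Type*) [Field K] (lam : YoungDiagram) : Sym K :=
  Matrix.det (Matrix.of fun i j : Fin (lam.colLen 0) =>
    completeInt K ((lam.rowLen i : ℤ) - i + j))

/-- The value `⟨p^a, p^a⟩_{q,t} = z_a ∏ ((1 - q ^ k) / (1 - t ^ k)) ^ a_k` on the power product
`p^a = ∏ p_k ^ a_k`. -/
def powerNorm (q t : K) (a : ℕ+ →₀ ℕ) : K :=
  a.prod fun k m => (k : K) ^ m * (m.factorial : K) * ((1 - q ^ (k : ℕ)) / (1 - t ^ (k : ℕ))) ^ m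

/-- The scalar product `⟨ , ⟩_{q,t}`: distinct power products are orthogonal. -/
def scalar (q t : K) (f g : Sym K) : K :=
  ∑ a ∈ f.support, coeff a f * coeff a g * powerNorm q t a

/-- `f ∈ S_lam + span {S_μ : μ < lam}`, and `f` is orthogonal to all `S_μ` with `μ < lam`. -/
def IsMacdonaldP (q t : K) (lam : YoungDiagram) (f : Sym K) : Prop :=
  f - schur K lam ∈ Submodule.span K {g | ∃ μ, DomLT μ lam ∧ g = schur K μ} ∧
    ∀ μ, DomLT μ lam → scalar q t f (schur K μ) = 0

open Classical in
/-- The Macdonald polynomial `P_lam(x; q, t)`, as the unique element of `S_lam + span {S_μ : μ < lam}`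
orthogonal to that span. See `macdonaldP_eq` for the usual characterization. -/
def macdonaldP (q t : K) (lam : YoungDiagram) : Sym K :=
  if h : ∃! f, IsMacdonaldP q t lam f then h.choose else 0

/-- `Q_lam = P_lam / ⟨P_lam, P_lam⟩`, the basis dual to the `P_lam`. -/
def macdonaldQ (q t : K) (lam : YoungDiagram) : Sym K :=
  C (scalar q t (macdonaldP q t lam) (macdonaldP q t lam))⁻¹ * macdonaldP q t lam

/-- `h'_lam(q, t) = ∏ (1 - q ^ (a + 1) t ^ l)` over the cells. -/
def hookPrime (q t : K) (lam : YoungDiagram) : K :=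
  ∏ c ∈ lam.cells, (1 - q ^ (arm lam c + 1) * t ^ leg lam c)

/-- The integral form `J_lam = h'_lam Q_lam`. -/
def macdonaldJ (q t : K) (lam : YoungDiagram) : Sym K :=
  C (hookPrime q t lam) * macdonaldQ q t lam

/-- `H_lam(x; q, t) = J_lam[X / (1 - t); q, t]`, by the substitution `p_k ↦ p_k / (1 - t ^ k)`. -/
def macdonaldH (q t : K) (lam : YoungDiagram) : Sym K :=
  aeval (fun k : ℕ+ => C (1 - t ^ (k : ℕ))⁻¹ * (X k : Sym K)) (macdonaldJ q t lam)

/-- `H̃_lam(x; q, t) = t ^ n(lam) H_lam(x; q, 1 / t)`. -/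
def modifiedH (q t : K) (lam : YoungDiagram) : Sym K :=
  C (t ^ nStat lam) * macdonaldH q t⁻¹ lam

/-- `T_lam(q, t) = ∏ t ^ i q ^ j` over the cells `(i, j)`. -/
def T (q t : K) (lam : YoungDiagram) : K := ∏ c ∈ lam.cells, t ^ c.1 * q ^ c.2

/-- The usual characterization of the Macdonald polynomials: a basis of the ring of symmetric
functions, unitriangular on the Schur functions for dominance, and orthogonal. -/
structure IsMacdonaldBasis (q t : K) (P : YoungDiagram → Sym K) : Prop where
  indep : LinearIndependent K P
  spans : Submodule.span K (Set.range P) = ⊤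
  triangular : ∀ lam, P lam - schur K lam ∈
    Submodule.span K {g | ∃ μ, DomLT μ lam ∧ g = schur K μ}
  orthogonal : ∀ lam μ, lam ≠ μ → scalar q t (P lam) (P μ) = 0

/-! The remaining facts of this section show that `macdonaldP` is the family with this
characterization. -/

lemma scalar_eq (q t : K) (f g : Sym K) {s : Finset (ℕ+ →₀ ℕ)} (hs : f.support ⊆ s) :
    scalar q t f g = ∑ a ∈ s, coeff a f * coeff a g * powerNorm q t a := by
  unfold scalar
  refine Finset.sum_subset hs fun a _ ha => ?_
  rw [notMem_support_iff.1 ha]; ring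

/-- The scalar product as a linear form in its second argument. -/
def scalarRight (q t : K) (f : Sym K) : Sym K →ₗ[K] K where
  toFun g := scalar q t f g
  map_add' g h := by
    simp only [scalar, coeff_add, ← Finset.sum_add_distrib]
    exact Finset.sum_congr rfl fun _ _ => by ring
  map_smul' c g := by
    simp only [scalar, coeff_smul, smul_eq_mul, RingHom.id_apply, Finset.mul_sum]
    exact Finset.sum_congr rfl fun _ _ => by ring

lemma scalar_comm (q t : K) (f g : Sym K) : scalar q t f g = scalar q t g f := by
  classical
  rw [scalar_eq q t f g (Finset.subset_union_left (s₂ := g.support)),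
    scalar_eq q t g f (Finset.subset_union_right (s₁ := f.support))]
  exact Finset.sum_congr rfl fun _ _ => by ring

lemma scalar_eq_zero_of_span (q t : K) (f : Sym K) (s : Set (Sym K))
    (h : ∀ g ∈ s, scalar q t f g = 0) {g : Sym K} (hg : g ∈ Submodule.span K s) :
    scalar q t f g = 0 := by
  have : Submodule.span K s ≤ LinearMap.ker (scalarRight q t f) :=
    Submodule.span_le.2 fun x hx => h x hx
  exact this hg

lemma DomLT.trans {a b c : YoungDiagram} (h : DomLT a b) (h' : DomLT b c) : DomLT a c := by
  refine ⟨?_, h.2.1.trans h'.2.1, fun k => (h.2.2 k).trans (h'.2.2 k)⟩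
  rintro rfl
  apply h.1
  have hsum : ∀ k, ∑ i ∈ Finset.range k, a.rowLen i = ∑ i ∈ Finset.range k, b.rowLen i :=
    fun k => le_antisymm (h.2.2 k) (h'.2.2 k)
  have hrow : ∀ k, a.rowLen k = b.rowLen k := fun k => by
    have h1 := hsum (k + 1)
    rw [Finset.sum_range_succ, Finset.sum_range_succ, hsum k] at h1
    omega
  ext ⟨i, j⟩
  simp only [YoungDiagram.mem_cells, YoungDiagram.mem_iff_lt_rowLen, hrow]

/-- Strict dominance is well-founded. -/
lemma domLT_wf : WellFounded DomLT := by
  have hfin : ∀ lam : YoungDiagram, {μ | DomLT μ lam}.Finite := by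
    intro lam
    have : {μ : YoungDiagram | DomLT μ lam} ⊆
        YoungDiagram.cells ⁻¹' ((Finset.range (lam.card + 1) ×ˢ
          Finset.range (lam.card + 1)).powerset : Set (Finset (ℕ × ℕ))) := by
      intro μ hμ
      simp only [Set.mem_preimage, Finset.mem_coe, Finset.mem_powerset]
      rintro ⟨i, j⟩ hij
      have hij' : (i, j) ∈ μ := hij
      have hc : μ.card = lam.card := hμ.2.1
      have h1 : μ.rowLen i ≤ μ.card := by
        rw [YoungDiagram.rowLen_eq_card]
        exact Finset.card_le_card (Finset.filter_subset _ _)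
      have h2 : μ.colLen j ≤ μ.card := by
        rw [YoungDiagram.colLen_eq_card]
        exact Finset.card_le_card (Finset.filter_subset _ _)
      have h3 := YoungDiagram.mem_iff_lt_rowLen.1 hij'
      have h4 := YoungDiagram.mem_iff_lt_colLen.1 hij'
      simp only [Finset.mem_product, Finset.mem_range]
      omega
    refine Set.Finite.subset (Set.Finite.preimage ?_ (Finset.finite_toSet _)) this
    intro a _ b _ hab
    exact YoungDiagram.ext hab
  have key : ∀ N : ℕ, ∀ lam : YoungDiagram, (hfin lam).toFinset.card ≤ N → Acc DomLT lam := by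
    intro N
    induction N with
    | zero =>
      intro lam h
      refine Acc.intro _ fun μ hμ => ?_
      have : μ ∈ (hfin lam).toFinset := by simpa using hμ
      rw [Nat.le_zero, Finset.card_eq_zero] at h
      simp [h] at this
    | succ N ih =>
      intro lam h
      refine Acc.intro _ fun μ hμ => ih μ ?_
      have : (hfin μ).toFinset ⊂ (hfin lam).toFinset := by
        refine Finset.ssubset_iff_of_subset (fun x hx => ?_) |>.2 ⟨μ, by simpa using hμ, ?_⟩
        · simp only [Set.Finite.mem_toFinset, Set.mem_ofPred_eq] at hx ⊢
          exact hx.trans hμ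
        · simp only [Set.Finite.mem_toFinset, Set.mem_ofPred_eq]
          exact fun h => h.1 rfl
      have := Finset.card_lt_card this
      omega
  exact ⟨fun lam => key _ lam le_rfl⟩

/-- If `q`, `t` are not roots of unity, then every family with the usual characterization of the
Macdonald polynomials is `macdonaldP`. -/
theorem macdonaldP_eq [CharZero K] {q t : K} (hq : ∀ k : ℕ, 0 < k → q ^ k ≠ 1)
    (ht : ∀ k : ℕ, 0 < k → t ^ k ≠ 1) {P : YoungDiagram → Sym K} (hP : IsMacdonaldBasis q t P) :
    macdonaldP q t = P := by
  have hnorm : ∀ a, powerNorm q t a ≠ 0 := by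
    intro a
    refine Finset.prod_ne_zero_iff.2 fun k _ => mul_ne_zero (mul_ne_zero ?_ ?_) ?_
    · exact pow_ne_zero _ (by exact_mod_cast k.ne_zero)
    · exact_mod_cast Nat.factorial_ne_zero _
    · exact pow_ne_zero _ (div_ne_zero (sub_ne_zero.2 (hq k k.pos).symm)
        (sub_ne_zero.2 (ht k k.pos).symm))
  have hself : ∀ lam, scalar q t (P lam) (P lam) ≠ 0 := by
    intro lam h0
    have hall : ∀ g, scalar q t (P lam) g = 0 := fun g => by
      refine scalar_eq_zero_of_span q t _ (Set.range P) ?_ (hP.spans ▸ Submodule.mem_top)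
      rintro _ ⟨μ, rfl⟩
      by_cases h : lam = μ
      · subst h; exact h0
      · exact hP.orthogonal _ _ h
    refine hP.indep.ne_zero lam (MvPolynomial.ext _ _ fun a => ?_)
    have := hall (monomial a 1)
    rw [scalar_comm, scalar_eq q t _ _ (support_monomial_subset), Finset.sum_singleton,
      coeff_monomial, if_pos rfl, one_mul] at this
    simpa [hnorm a] using this
  have hspan : ∀ lam, Submodule.span K {g | ∃ μ, DomLT μ lam ∧ g = schur K μ} =
      Submodule.span K {g | ∃ μ, DomLT μ lam ∧ g = P μ} := by
    have mem : ∀ lam, schur K lam - P lam ∈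
        Submodule.span K {g | ∃ μ, DomLT μ lam ∧ g = P μ} := by
      intro lam
      induction lam using domLT_wf.induction with
      | _ lam ih =>
        have h := hP.triangular lam
        rw [← neg_sub] at h
        refine (Submodule.span_le.2 ?_ : Submodule.span K _ ≤ _) (neg_mem_iff.1 h)
        rintro _ ⟨μ, hμ, rfl⟩
        have h1 := ih μ hμ
        have h2 : schur K μ = (schur K μ - P μ) + P μ := by ring
        rw [SetLike.mem_coe, h2]
        refine add_mem (Submodule.span_mono ?_ h1) (Submodule.subset_span ⟨μ, hμ, rfl⟩)
        rintro _ ⟨ν, hν, rfl⟩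
        exact ⟨ν, hν.trans hμ, rfl⟩
    intro lam
    apply le_antisymm
    · refine Submodule.span_le.2 ?_
      rintro _ ⟨μ, hμ, rfl⟩
      have h2 : schur K μ = (schur K μ - P μ) + P μ := by ring
      rw [SetLike.mem_coe, h2]
      refine add_mem (Submodule.span_mono ?_ (mem μ)) (Submodule.subset_span ⟨μ, hμ, rfl⟩)
      rintro _ ⟨ν, hν, rfl⟩
      exact ⟨ν, hν.trans hμ, rfl⟩
    · refine Submodule.span_le.2 ?_
      rintro _ ⟨μ, hμ, rfl⟩
      have h2 : P μ = (P μ - schur K μ) + schur K μ := by ring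
      rw [SetLike.mem_coe, h2]
      refine add_mem (Submodule.span_mono ?_ (hP.triangular μ))
        (Submodule.subset_span ⟨μ, hμ, rfl⟩)
      rintro _ ⟨ν, hν, rfl⟩
      exact ⟨ν, hν.trans hμ, rfl⟩
  have hIs : ∀ lam, IsMacdonaldP q t lam (P lam) := by
    intro lam
    refine ⟨hP.triangular lam, fun μ hμ => ?_⟩
    refine scalar_eq_zero_of_span q t _ {g | ∃ μ, DomLT μ lam ∧ g = P μ} ?_
      (hspan lam ▸ Submodule.subset_span ⟨μ, hμ, rfl⟩)
    rintro _ ⟨ν, hν, rfl⟩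
    exact hP.orthogonal _ _ hν.1.symm
  have huniq : ∀ lam f, IsMacdonaldP q t lam f → f = P lam := by
    intro lam f hf
    rw [← sub_eq_zero]
    have hd : f - P lam ∈ Submodule.span K {g | ∃ μ, DomLT μ lam ∧ g = P μ} := by
      rw [← hspan]
      have : f - P lam = (f - schur K lam) - (P lam - schur K lam) := by ring
      rw [this]
      exact sub_mem hf.1 (hP.triangular lam)
    have horth : ∀ μ, DomLT μ lam → scalar q t (P μ) (f - P lam) = 0 := by
      intro μ hμ
      have hmem : P μ ∈ Submodule.span K {g | ∃ μ, DomLT μ lam ∧ g = schur K μ} :=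
        hspan lam ▸ Submodule.subset_span ⟨μ, hμ, rfl⟩
      have h1 : scalar q t f (P μ) = 0 :=
        scalar_eq_zero_of_span q t _ _ (by rintro _ ⟨ν, hν, rfl⟩; exact hf.2 ν hν) hmem
      have h2 : scalar q t (P μ) (f - P lam) =
          scalar q t (P μ) f - scalar q t (P μ) (P lam) := (scalarRight q t (P μ)).map_sub _ _
      rw [h2, scalar_comm q t (P μ) f, h1, hP.orthogonal _ _ hμ.1, sub_zero]
    have himg : {g | ∃ μ, DomLT μ lam ∧ g = P μ} = P '' {μ | DomLT μ lam} := by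
      ext g; constructor
      · rintro ⟨μ, h, rfl⟩; exact ⟨μ, h, rfl⟩
      · rintro ⟨μ, h, rfl⟩; exact ⟨μ, h, rfl⟩
    rw [himg, Finsupp.mem_span_image_iff_linearCombination] at hd
    obtain ⟨l, hl, hlf⟩ := hd
    rw [← hlf]
    have : l = 0 := by
      ext μ
      by_cases hμ : μ ∈ l.support
      · have hm : DomLT μ lam := hl hμ
        have h0 := horth μ hm
        rw [← hlf, Finsupp.linearCombination_apply, Finsupp.sum] at h0
        have h1 : scalar q t (P μ) (∑ a ∈ l.support, l a • P a) =
            ∑ a ∈ l.support, l a * scalar q t (P μ) (P a) := by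
          have := map_sum (scalarRight q t (P μ)) (fun a => l a • P a) l.support
          simp only [map_smul, smul_eq_mul] at this
          exact this
        rw [h1, Finset.sum_eq_single μ] at h0
        · simpa [hself μ] using h0
        · intro b _ hb
          rw [hP.orthogonal _ _ hb.symm, mul_zero]
        · intro h; exact absurd hμ h
      · simpa using hμ
    rw [this, map_zero]
  funext lam
  have hex : ∃! f, IsMacdonaldP q t lam f := ⟨P lam, hIs lam, fun f hf => huniq lam f hf⟩
  unfold macdonaldP
  rw [dif_pos hex]
  exact huniq lam _ hex.choose_spec.1

end Macdonald

/-! ## The field of coefficients -/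

/-- The field `𝕜(q)(t) = 𝕜(q, t)`. -/
abbrev Coef (𝕜 : Type*) [Field 𝕜] := RatFunc (RatFunc 𝕜)

/-- The indeterminate `q`. -/
def qq (𝕜 : Type*) [Field 𝕜] : Coef 𝕜 := RatFunc.C RatFunc.X

/-- The indeterminate `t`. -/
def tt (𝕜 : Type*) [Field 𝕜] : Coef 𝕜 := RatFunc.X

/-! ## The Garsia–Haiman modules

`Sum.inl i` stands for the variable `x_i` and `Sum.inr i` for `y_i`. -/

/-- The polynomial ring `𝕜[x_1, …, x_n; y_1, …, y_n]`. -/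
abbrev Poly (𝕜 : Type*) [Field 𝕜] (n : ℕ) := MvPolynomial (Fin n ⊕ Fin n) 𝕜

section Modules

variable {𝕜 : Type*} [Field 𝕜] {n : ℕ}

/-- The diagonal action `(σ P)(x; y) = P(x_{σ 1}, …, x_{σ n}; y_{σ 1}, …, y_{σ n})`. -/
def act (σ : Equiv.Perm (Fin n)) : Poly 𝕜 n →ₗ[𝕜] Poly 𝕜 n :=
  (rename (Sum.map σ σ)).toLinearMap

/-- The bihomogeneous polynomials of degree `d.1` in `x` and `d.2` in `y`. -/
def bihom (𝕜 : Type*) [Field 𝕜] (n : ℕ) (d : ℕ × ℕ) : Submodule 𝕜 (Poly 𝕜 n) :=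
  weightedHomogeneousSubmodule 𝕜 (Sum.elim (fun _ => (1, 0)) (fun _ => (0, 1))) d

/-- The differential operator `∂^a`, `a` the exponents of a monomial in `x`, `y`. -/
def partialD (a : Fin n ⊕ Fin n →₀ ℕ) (f : Poly 𝕜 n) : Poly 𝕜 n :=
  (List.finRange n).foldr (fun i g =>
    (pderiv (Sum.inl i))^[a (Sum.inl i)] ((pderiv (Sum.inr i))^[a (Sum.inr i)] g)) f

/-- `P(∂) f`. -/
def applyD (P f : Poly 𝕜 n) : Poly 𝕜 n := ∑ a ∈ P.support, coeff a P • partialD a f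

/-- The cells `(i, j)` of `ν` in lexicographic order: the biexponents of `ν`. -/
def biexponents (ν : YoungDiagram) : List (ℕ × ℕ) :=
  (List.range (ν.colLen 0)).flatMap fun i => (List.range (ν.rowLen i)).map fun j => (i, j)

/-- The determinant `Δ_ν = det (x_i ^ p_j y_i ^ q_j)`, meant for `ν` with `n` cells. -/
def garsiaHaimanDelta (𝕜 : Type*) [Field 𝕜] (n : ℕ) (ν : YoungDiagram) : Poly 𝕜 n :=
  Matrix.det (Matrix.of fun i j : Fin n =>
    (X (Sum.inl i) : Poly 𝕜 n) ^ ((biexponents ν).getD j (0, 0)).1 *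
      X (Sum.inr i) ^ ((biexponents ν).getD j (0, 0)).2)

/-- The module `M_ν`, the span of all partial derivatives of `Δ_ν`. -/
def garsiaHaimanM (𝕜 : Type*) [Field 𝕜] (n : ℕ) (ν : YoungDiagram) : Submodule 𝕜 (Poly 𝕜 n) :=
  Submodule.span 𝕜 (Set.range fun a => partialD a (garsiaHaimanDelta 𝕜 n ν))

/-- `W` is stable under the diagonal action. -/
def IsInvariant (W : Submodule 𝕜 (Poly 𝕜 n)) : Prop :=
  ∀ σ : Equiv.Perm (Fin n), ∀ f ∈ W, act σ f ∈ W

open Classical in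
/-- The trace of `σ` on a subspace stable under `σ` (and `0` on other subspaces). -/
def character (W : Submodule 𝕜 (Poly 𝕜 n)) (σ : Equiv.Perm (Fin n)) : 𝕜 :=
  if h : ∀ f ∈ W, act σ f ∈ W then LinearMap.trace 𝕜 W ((act σ).restrict h) else 0

/-- The bigraded character `∑ t^h q^k char(H_{h,k}(W))` at `σ`; the sum is finite as soon as `W` is
finite-dimensional. -/
def bigradedCharacter (W : Submodule 𝕜 (Poly 𝕜 n)) (σ : Equiv.Perm (Fin n)) : Coef 𝕜 :=
  ∑ᶠ d : ℕ × ℕ, tt 𝕜 ^ d.1 * qq 𝕜 ^ d.2 *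
    RatFunc.C (RatFunc.C (character (W ⊓ bihom 𝕜 n d) σ))

/-- The bigraded Frobenius characteristic, with `σ.partition` the cycle type of `σ` (fixed points
included). -/
def frobenius (W : Submodule 𝕜 (Poly 𝕜 n)) : Sym (Coef 𝕜) :=
  C ((n.factorial : Coef 𝕜)⁻¹) *
    ∑ σ : Equiv.Perm (Fin n), C (bigradedCharacter W σ) * powerSum (Coef 𝕜) σ.partition.parts

/-- The bigraded Hilbert series `∑ t^h q^k dim H_{h,k}(W)`. -/
def hilbertSeries (W : Submodule 𝕜 (Poly 𝕜 n)) : Coef 𝕜 :=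
  ∑ᶠ d : ℕ × ℕ, tt 𝕜 ^ d.1 * qq 𝕜 ^ d.2 *
    (Module.finrank 𝕜 (W ⊓ bihom 𝕜 n d : Submodule 𝕜 (Poly 𝕜 n)) : Coef 𝕜)

/-- The image of `W` under the flip `P ↦ P(∂) Δ`. -/
def flip (D : Poly 𝕜 n) (W : Submodule 𝕜 (Poly 𝕜 n)) : Submodule 𝕜 (Poly 𝕜 n) :=
  Submodule.span 𝕜 {g | ∃ P ∈ W, g = applyD P D}

/-- Isomorphism of bigraded `S_n`-modules. -/
def BigradedIso (V W : Submodule 𝕜 (Poly 𝕜 n)) : Prop :=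
  ∃ e : V ≃ₗ[𝕜] W,
    (∀ (σ : Equiv.Perm (Fin n)) (f g : V), (g : Poly 𝕜 n) = act σ f →
      (e g : Poly 𝕜 n) = act σ (e f)) ∧
    ∀ (d : ℕ × ℕ) (f : V), (f : Poly 𝕜 n) ∈ bihom 𝕜 n d ↔ (e f : Poly 𝕜 n) ∈ bihom 𝕜 n d

/-- Complement all letters of a word in `0, 1` except the one at `i`. -/
def complementExcept {ι : Type*} [DecidableEq ι] (i : ι) (ε : ι → Bool) : ι → Bool :=
  fun j => if j = i then ε j else !(ε j)

/-- `B^ε`, the intersection of the sets `B_i` (where `ε_i = 1`) and `B ∖ B_i` (where `ε_i = 0`). -/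
def cellOf {ι : Type*} (B : Set (Poly 𝕜 n)) (Bi : ι → Set (Poly 𝕜 n)) (ε : ι → Bool) :
    Set (Poly 𝕜 n) :=
  {b ∈ B | ∀ i, b ∈ Bi i ↔ ε i = true}

/-- The Science Fiction property of `μ ⊢ n + 1`: the sum of the modules of the predecessors of `μ`
has a bihomogeneous basis `B`, with subsets `B_i`, such that `B_i` spans the module of the `i`-th
predecessor, the span `M^ε` of each `B^ε` is `S_n`-invariant, and if `ε_i = 1` then
`flip_i M^ε ≅ M^{τ_i ε}`, where `τ_i` complements all letters but the `i`-th. -/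
def ScienceFiction (𝕜 : Type*) [Field 𝕜] (n : ℕ) (μ : YoungDiagram) : Prop :=
  ∃ (B : Set (Poly 𝕜 n)) (Bi : Corner μ → Set (Poly 𝕜 n)),
    LinearIndependent 𝕜 (Subtype.val : B → Poly 𝕜 n) ∧
    Submodule.span 𝕜 B = (⨆ i : Corner μ, garsiaHaimanM 𝕜 n (predecessor i)) ∧
    (∀ b ∈ B, ∃ d, b ∈ bihom 𝕜 n d) ∧
    (∀ i, Bi i ⊆ B ∧ Submodule.span 𝕜 (Bi i) = garsiaHaimanM 𝕜 n (predecessor i)) ∧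
    (∀ ε, IsInvariant (Submodule.span 𝕜 (cellOf B Bi ε))) ∧
    ∀ (i : Corner μ) (ε : Corner μ → Bool), ε i = true →
      BigradedIso
        (flip (garsiaHaimanDelta 𝕜 n (predecessor i)) (Submodule.span 𝕜 (cellOf B Bi ε)))
        (Submodule.span 𝕜 (cellOf B Bi (complementExcept i ε)))

end Modules

section Combination

variable (𝕜 : Type*) [Field 𝕜] {μ : YoungDiagram}

/-- The coefficient `∏_{r ∈ S, r ≠ s} (1 - T_s / T_r)⁻¹`. -/
def weight (S : Finset (Corner μ)) (s : Corner μ) : Coef 𝕜 :=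
  ∏ r ∈ S.erase s,
    (1 - T (qq 𝕜) (tt 𝕜) (predecessor s) / T (qq 𝕜) (tt 𝕜) (predecessor r))⁻¹

/-- The rational function `F_{⊇S}(q, t) = ∑_s ∏_{r ≠ s} (1 - T_s / T_r)⁻¹ ∂_{p_1}^n H̃_s`, where the
`n`-th derivative is a constant, as `H̃_s` has degree `n`. -/
def hilbertF (n : ℕ) (S : Finset (Corner μ)) : Coef 𝕜 :=
  ∑ s ∈ S, weight 𝕜 S s *
    constantCoeff ((pderiv (1 : ℕ+))^[n] (modifiedH (qq 𝕜) (tt 𝕜) (predecessor s)))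

end Combination

end SciFi

end

noncomputable section

namespace SciFi

/-! ## Power products and complete homogeneous symmetric functions -/

/-! The two halves are independent. For the intersections, fix a permutation and let χ(A) be the
bigraded character of the span of those basis vectors that lie in `B_i` exactly for i in A. Since
all the modules are spanned by subsets of one basis, the character of an intersection over S is the
sum of χ(A) over A ⊇ S (`iInf_span_eq`, `iUnion_cellOf`). The flip P ↦ P(∂)Δ_i inverts q and t,
multiplies by T_i and twists by the sign (`bigradedCharacter_flip`); it is injective on each cell
because the isomorphisms of the SF property run in both directions (`applyHom_injOn_of_iso`).
Flipping one and the same cell by i and by j gives T_i χ(A) = T_j χ(A ∪ {i} ∖ {j}) whenever i ∉ A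
and j ∈ A. From this relation alone `sum_superset_eq` derives the partial fraction formula, by
induction on the size of S. The derivative ∂_{p_1}^n isolates the identity permutation and so yields
the Hilbert series (`hilbertSeries_eq`).

For the limit, one needs ∂_{p_1}^n H̃_λ at t = 1. By `macdonaldQ_eq`, Q_λ is the image under p_k ↦
(1 - t^k)/(1 - q^k) p_k of h_λ plus a combination of the h_ν with ν not dominated by λ, the
coefficients solving a linear system with a Gram matrix of products of complete functions, for the
pairing with q and t exchanged. This rests on the triangularity of Schur functions against those
products, read off from a flagged Jacobi–Trudi determinant (`evVars_schur`,
`domLE_of_hall_schur_ne_zero`, `hall_schur_self`). At t = 1 the exchanged norm of a power product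
vanishes to the order of its number of parts; after division of each row by the matching power of 1
- 1/t, the Gram matrix becomes triangular with nonzero diagonal, and the system has a solution that
vanishes at t = 1 (`gram_system`). Only h_λ survives, so the value is n! ∏ [λ_i]_q!/λ_i!
(`hasValueOne_modifiedH`, `prod_arm_eq`).

Let z_s be the column of the corner s, counted from 1. At t = 1 the ratio T_s/T_r becomes q^{z_r -
z_s}, and removing the corner multiplies the product over the rows of μ by z_s (1 - q)/(1 -
q^{z_s}). With v_s = 1 - q^{-z_s}, the sum is, up to factors tending to 1 and to the constant n!,
the divided difference of -log(1 - v)/v = ∑ v^i/(i + 1) at the k points v_s. These tend to 0, so the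
limit is the coefficient 1/k of v^{k-1} (`tendsto_divided`). -/

/-- The weight `∑ k a_k` of the exponents of a power product. -/
def partWeight : (ℕ+ →₀ ℕ) →+ ℕ := Finsupp.weight fun k : ℕ+ => (k : ℕ)

/-- The exponents of the power product attached to a multiset of positive integers. -/
def content (s : Multiset ℕ) : ℕ+ →₀ ℕ := Multiset.toFinsupp (s.map Nat.toPNat')

/-- The multiset of parts with given multiplicities. -/
def partsOf (a : ℕ+ →₀ ℕ) : Multiset ℕ := (Finsupp.toMultiset a).map fun k : ℕ+ => (k : ℕ)

/-- The integer `z_a = ∏ k ^ a_k a_k!`. -/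
def zFactor (a : ℕ+ →₀ ℕ) : ℕ := a.prod fun k m => (k : ℕ) ^ m * m.factorial

lemma partWeight_single (k : ℕ+) (m : ℕ) : partWeight (Finsupp.single k m) = m * k := by
  simp [partWeight, Finsupp.weight_apply]

lemma content_partsOf (a : ℕ+ →₀ ℕ) : content (partsOf a) = a := by
  simp only [content, partsOf, Multiset.map_map, Function.comp_def, PNat.coe_toPNat',
    Multiset.map_id', Finsupp.toMultiset_toFinsupp]

lemma partsOf_content {s : Multiset ℕ} (hs : ∀ k ∈ s, 0 < k) : partsOf (content s) = s := by
  simp only [content, partsOf, Multiset.toFinsupp_toMultiset, Multiset.map_map]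
  conv_rhs => rw [← Multiset.map_id' s]
  refine Multiset.map_congr rfl fun k hk => ?_
  simp [Nat.toPNat', Nat.sub_add_cancel (hs k hk)]

lemma pos_of_mem_partsOf {a : ℕ+ →₀ ℕ} {k : ℕ} (hk : k ∈ partsOf a) : 0 < k := by
  obtain ⟨j, -, rfl⟩ := Multiset.mem_map.1 hk
  exact j.pos

lemma sum_partsOf (a : ℕ+ →₀ ℕ) : (partsOf a).sum = partWeight a := by
  induction a using Finsupp.induction_linear with
  | zero => simp [partsOf]
  | add f g hf hg => rw [map_add, ← hf, ← hg, partsOf, map_add, Multiset.map_add, Multiset.sum_add]; rfl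
  | single k m => simp [partsOf, partWeight_single, Finsupp.toMultiset_single, Multiset.map_nsmul,
      Multiset.sum_nsmul]

lemma partWeight_content {s : Multiset ℕ} (hs : ∀ k ∈ s, 0 < k) :
    partWeight (content s) = s.sum := by
  rw [← sum_partsOf, partsOf_content hs]

lemma content_cons (k : ℕ) (s : Multiset ℕ) :
    content (k ::ₘ s) = Finsupp.single k.toPNat' 1 + content s := by
  rw [content, Multiset.map_cons, ← Multiset.singleton_add, map_add, Multiset.toFinsupp_singleton]
  rfl

lemma zFactor_ne_zero (a : ℕ+ →₀ ℕ) : zFactor a ≠ 0 :=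
  Finset.prod_ne_zero_iff.2 fun k _ =>
    mul_ne_zero (pow_ne_zero _ k.ne_zero) (Nat.factorial_ne_zero _)

/-- This ratio of norms makes multiplication by p_k adjoint to k ∂/∂p_k in `hall_X_mul`, and lowers
the index in `pderiv_complete`. -/
lemma zFactor_add_single (a : ℕ+ →₀ ℕ) (k : ℕ+) :
    zFactor (a + Finsupp.single k 1) = k * (a k + 1) * zFactor a := by
  classical
  have h1 : ∀ b : ℕ+ →₀ ℕ, ∀ s : Finset ℕ+, b.support ⊆ s →
      zFactor b = ∏ j ∈ s, ((j : ℕ) ^ b j * (b j).factorial) := fun b s hs =>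
    Finsupp.prod_of_support_subset _ hs _ (by simp)
  rw [h1 a (insert k a.support) (Finset.subset_insert _ _),
    h1 (a + Finsupp.single k 1) (insert k a.support) ?_,
    ← Finset.mul_prod_erase _ _ (Finset.mem_insert_self k _),
    ← Finset.mul_prod_erase _ _ (Finset.mem_insert_self k _)]
  · rw [Finset.prod_congr rfl (g := fun j : ℕ+ => ((j : ℕ) ^ a j * (a j).factorial))]
    · simp [pow_succ, Nat.factorial_succ]
      ring
    · intro j hj
      have : k ≠ j := (Finset.ne_of_mem_erase hj).symm
      simp [this]
  · intro j hj
    by_cases h : j = k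
    · simp [h]
    · simp [Ne.symm h] at hj ⊢
      simp [hj]

section

variable {K : Type*} [Field K]

lemma powerSum_eq (s : Multiset ℕ) : powerSum K s = monomial (content s) 1 := by
  induction s using Multiset.induction with
  | empty => simp [powerSum, content]
  | cons k s ih =>
    rw [content_cons, powerSum, Multiset.map_cons, Multiset.prod_cons, X, ← powerSum, ih,
      monomial_mul, one_mul]

lemma powerNorm_eq (q t : K) (a : ℕ+ →₀ ℕ) : powerNorm q t a =
    zFactor a * a.prod fun k m => ((1 - q ^ (k : ℕ)) / (1 - t ^ (k : ℕ))) ^ m := by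
  simp [powerNorm, zFactor, Finsupp.prod, Finset.prod_mul_distrib]

lemma powerNorm_zero (a : ℕ+ →₀ ℕ) : powerNorm (0 : K) 0 a = zFactor a := by
  simp [powerNorm_eq, Finsupp.prod]

lemma zCoeff_eq {s : Multiset ℕ} (hs : ∀ k ∈ s, 0 < k) : zCoeff s = zFactor (content s) := by
  classical
  obtain ⟨a, rfl⟩ : ∃ a, partsOf a = s := ⟨_, partsOf_content hs⟩
  have hinj : Function.Injective fun k : ℕ+ => (k : ℕ) := PNat.coe_injective
  rw [content_partsOf, zCoeff, zFactor, Finsupp.prod]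
  have : (partsOf a).toFinset = a.support.image fun k : ℕ+ => (k : ℕ) := by
    rw [partsOf, ← Finsupp.toFinset_toMultiset]
    ext k
    simp
  rw [this, Finset.prod_image fun _ _ _ _ h => hinj h]
  refine Finset.prod_congr rfl fun k _ => ?_
  rw [partsOf, Multiset.count_map_eq_count' _ _ hinj, Finsupp.count_toMultiset]

/-- Exponent vectors of weight n correspond bijectively to partitions of n, so at most one summand
contributes. -/
lemma coeff_complete (n : ℕ) (a : ℕ+ →₀ ℕ) :
    coeff a (complete K n) = if partWeight a = n then (zFactor a : K)⁻¹ else 0 := by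
  classical
  have hpos : ∀ ν : n.Partition, ∀ k ∈ ν.parts, 0 < k := fun ν k hk => ν.parts_pos hk
  have h : ∀ ν : n.Partition, coeff a (C ((zCoeff ν.parts : K)⁻¹) * powerSum K ν.parts) =
      if content ν.parts = a then (zFactor a : K)⁻¹ else 0 := by
    intro ν
    rw [powerSum_eq, C_mul_monomial, mul_one, coeff_monomial, zCoeff_eq (hpos ν)]
    split_ifs with h
    · rw [h]
    · rfl
  rw [complete, coeff_sum, Finset.sum_congr rfl fun ν _ => h ν]
  split_ifs with hw
  · let ν₀ : n.Partition := ⟨partsOf a, pos_of_mem_partsOf, by rw [sum_partsOf, hw]⟩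
    rw [Finset.sum_eq_single ν₀]
    · simp [ν₀, content_partsOf]
    · intro ν _ hν
      rw [if_neg]
      rintro rfl
      exact hν (Nat.Partition.ext (by simp [ν₀, partsOf_content (hpos ν)]))
    · simp
  · refine Finset.sum_eq_zero fun ν _ => if_neg ?_
    rintro rfl
    exact hw (by rw [partWeight_content (hpos ν), ν.parts_sum])

lemma complete_map {L : Type*} [Field L] (f : K →+* L) (n : ℕ) :
    map f (complete K n) = complete L n := by
  ext a
  rw [coeff_map, coeff_complete, coeff_complete]
  split_ifs <;> simp

lemma partWeight_eq_zero {a : ℕ+ →₀ ℕ} : partWeight a = 0 ↔ a = 0 := by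
  refine ⟨fun h => ?_, by rintro rfl; simp⟩
  rw [← sum_partsOf, Multiset.sum_eq_zero_iff] at h
  have : partsOf a = 0 := Multiset.eq_zero_of_forall_notMem fun k hk =>
    (pos_of_mem_partsOf hk).ne' (h k hk)
  rw [← content_partsOf a, this]
  simp [content]

lemma complete_zero : complete K 0 = 1 := by
  classical
  ext a
  rw [coeff_complete, coeff_one]
  by_cases h : a = 0
  · simp [h, zFactor]
  · simp [Ne.symm h, partWeight_eq_zero, h]

variable [CharZero K]

lemma zFactor_cast_ne_zero (a : ℕ+ →₀ ℕ) : (zFactor a : K) ≠ 0 :=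
  Nat.cast_ne_zero.2 (zFactor_ne_zero a)

/-- `k ∂/∂p_k h_n = h_{n - k}`. -/
lemma pderiv_complete (k : ℕ+) (n : ℕ) :
    (k : K) • pderiv k (complete K n) = if (k : ℕ) ≤ n then complete K (n - k) else 0 := by
  ext a
  rw [coeff_smul, coeff_pderiv, coeff_complete, map_add, partWeight_single, one_mul,
    zFactor_add_single]
  have h1 : (zFactor a : K) ≠ 0 := zFactor_cast_ne_zero a
  have h2 : (k : K) ≠ 0 := by exact_mod_cast k.ne_zero
  have h3 : ((a k : K) + 1) ≠ 0 := Nat.cast_add_one_ne_zero _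
  by_cases hk : (k : ℕ) ≤ n
  · rw [if_pos hk, coeff_complete]
    by_cases hw : partWeight a + k = n
    · rw [if_pos hw, if_pos (by omega)]
      push_cast
      rw [smul_eq_mul]
      field_simp
    · rw [if_neg hw, if_neg (by omega)]; simp
  · rw [if_neg hk, if_neg (by omega)]; simp

end

/-! ## The Hall pairing and evaluation in finitely many variables -/

section Hall

variable {K : Type*} [Field K]

lemma scalar_add_right (q t : K) (f g h : Sym K) :
    scalar q t f (g + h) = scalar q t f g + scalar q t f h := (scalarRight q t f).map_add g h

lemma scalar_smul_right (q t : K) (c : K) (f g : Sym K) :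
    scalar q t f (c • g) = c * scalar q t f g := (scalarRight q t f).map_smul c g

lemma scalar_sum_right {ι : Type*} (q t : K) (s : Finset ι) (f : Sym K) (g : ι → Sym K) :
    scalar q t f (∑ i ∈ s, g i) = ∑ i ∈ s, scalar q t f (g i) := map_sum (scalarRight q t f) g s

lemma scalar_zero_right (q t : K) (f : Sym K) : scalar q t f 0 = 0 := (scalarRight q t f).map_zero

lemma scalar_sub_right (q t : K) (f g h : Sym K) :
    scalar q t f (g - h) = scalar q t f g - scalar q t f h := (scalarRight q t f).map_sub g h

lemma scalar_add_left (q t : K) (f g h : Sym K) :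
    scalar q t (f + g) h = scalar q t f h + scalar q t g h := by
  rw [scalar_comm, scalar_add_right, scalar_comm q t h, scalar_comm q t h]

lemma scalar_smul_left (q t : K) (c : K) (f g : Sym K) :
    scalar q t (c • f) g = c * scalar q t f g := by
  rw [scalar_comm, scalar_smul_right, scalar_comm q t g]

lemma scalar_sub_left (q t : K) (f g h : Sym K) :
    scalar q t (f - g) h = scalar q t f h - scalar q t g h := by
  rw [scalar_comm, scalar_sub_right, scalar_comm q t h, scalar_comm q t h]

lemma scalar_sum_left {ι : Type*} (q t : K) (s : Finset ι) (f : ι → Sym K) (g : Sym K) :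
    scalar q t (∑ i ∈ s, f i) g = ∑ i ∈ s, scalar q t (f i) g := by
  rw [scalar_comm, scalar_sum_right]
  exact Finset.sum_congr rfl fun i _ => scalar_comm ..

lemma scalar_zero_left (q t : K) (f : Sym K) : scalar q t 0 f = 0 := by
  rw [scalar_comm, scalar_zero_right]

lemma scalar_monomial_left (q t : K) (a : ℕ+ →₀ ℕ) (r : K) (g : Sym K) :
    scalar q t (monomial a r) g = r * coeff a g * powerNorm q t a := by
  rw [scalar_eq q t _ _ support_monomial_subset, Finset.sum_singleton, coeff_monomial, if_pos rfl]

/-- The Hall pairing `⟨p_a, p_b⟩ = δ z_a`. -/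
def hall (f g : Sym K) : K := scalar 0 0 f g

lemma hall_monomial_left (a : ℕ+ →₀ ℕ) (r : K) (g : Sym K) :
    hall (monomial a r) g = r * coeff a g * zFactor a := by
  rw [hall, scalar_monomial_left, powerNorm_zero]

/-- Multiplication by `p_k` is adjoint to `k ∂/∂p_k`. -/
lemma hall_X_mul (k : ℕ+) (f g : Sym K) :
    hall (X k * f) g = hall f ((k : K) • pderiv k g) := by
  induction f using MvPolynomial.induction_on' with
  | monomial a r =>
    rw [X, monomial_mul, hall_monomial_left, hall_monomial_left, coeff_smul, coeff_pderiv,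
      add_comm, zFactor_add_single, smul_eq_mul]
    push_cast
    ring
  | add p q hp hq =>
    rw [mul_add]
    simp only [hall] at hp hq ⊢
    rw [scalar_add_left, hp, hq, scalar_add_left]

/-- The product `∏ h_{α_i}`. -/
def completeProd (K : Type*) [Field K] (α : ℕ →₀ ℕ) : Sym K := α.prod fun _ m => complete K m

lemma completeProd_eq {α : ℕ →₀ ℕ} {s : Finset ℕ} (hs : α.support ⊆ s) :
    completeProd K α = ∏ i ∈ s, complete K (α i) :=
  Finsupp.prod_of_support_subset _ hs _ fun _ _ => complete_zero

lemma completeProd_map {L : Type*} [Field L] (f : K →+* L) (α : ℕ →₀ ℕ) :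
    map f (completeProd K α) = completeProd L α := by
  simp only [completeProd, Finsupp.prod, map_prod, complete_map]

/-- The Leibniz rule, with `pderiv_complete` in each factor. The right-hand side has the shape of
the recursion `coeff_evVars_X_mul`, so that the two can be compared term by term. -/
lemma pderiv_prod_complete [CharZero K] (k : ℕ+) (α : ℕ →₀ ℕ) (s : Finset ℕ) :
    (k : K) • pderiv k (∏ i ∈ s, complete K (α i)) = ∑ i ∈ s, if (k : ℕ) ≤ α i then
      ∏ j ∈ s, complete K ((α - Finsupp.single i (k : ℕ)) j) else 0 := by
  induction s using Finset.induction with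
  | empty => simp
  | insert a s ha ih =>
    have hne : ∀ j ∈ s, a ≠ j := fun j hj h => ha (h ▸ hj)
    have leib : ∀ f g : Sym K, (k : K) • pderiv k (f * g) =
        ((k : K) • pderiv k f) * g + f * ((k : K) • pderiv k g) := by
      intro f g
      rw [Derivation.leibniz, smul_add, smul_eq_mul, smul_eq_mul, mul_smul_comm, smul_mul_assoc,
        add_comm, mul_comm g]
    rw [Finset.prod_insert ha, leib, ih, pderiv_complete, Finset.sum_insert ha]
    congr 1
    · have hs : ∏ j ∈ s, complete K ((α - Finsupp.single a (k : ℕ)) j) =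
          ∏ j ∈ s, complete K (α j) :=
        Finset.prod_congr rfl fun j hj => by simp [Finsupp.single_eq_of_ne (hne j hj).symm]
      rw [Finset.prod_insert ha, hs, ite_mul, zero_mul, Finsupp.tsub_apply,
        Finsupp.single_eq_same]
    · rw [Finset.mul_sum]
      refine Finset.sum_congr rfl fun i hi => ?_
      rw [Finset.prod_insert ha]
      simp [Finsupp.single_apply, (hne i hi).symm]

/-- The evaluation `f(x_0, …, x_{N - 1})` of a symmetric function. -/
def evVars (K : Type*) [Field K] (N : ℕ) : Sym K →ₐ[K] MvPolynomial ℕ K :=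
  aeval fun k : ℕ+ => ∑ i ∈ Finset.range N, X i ^ (k : ℕ)

lemma coeff_evVars_X_mul (N : ℕ) (k : ℕ+) (f : Sym K) (α : ℕ →₀ ℕ) :
    coeff α (evVars K N (X k * f)) = ∑ i ∈ Finset.range N,
      if (k : ℕ) ≤ α i then coeff (α - Finsupp.single i (k : ℕ)) (evVars K N f) else 0 := by
  rw [map_mul, evVars, aeval_X, Finset.sum_mul, coeff_sum]
  refine Finset.sum_congr rfl fun i _ => ?_
  simp only [X_pow_eq_monomial, coeff_monomial_mul', Finsupp.single_le_iff, one_mul]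

lemma coeff_evVars_eq_zero (N : ℕ) (f : Sym K) (α : ℕ →₀ ℕ) (hα : ¬ α.support ⊆ Finset.range N) :
    coeff α (evVars K N f) = 0 := by
  classical
  induction f using MvPolynomial.induction_on generalizing α with
  | C r =>
    rw [evVars, aeval_C, algebraMap_eq, coeff_C, if_neg]
    rintro rfl
    simp at hα
  | add p q hp hq => rw [map_add, coeff_add, hp α hα, hq α hα, add_zero]
  | mul_X p k hp =>
    rw [mul_comm, coeff_evVars_X_mul]
    refine Finset.sum_eq_zero fun i hi => ?_
    split_ifs
    · refine hp _ fun h => hα fun j hj => ?_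
      by_cases hij : j = i
      · exact hij ▸ hi
      · apply h
        simpa [Finsupp.single_apply, Ne.symm hij] using hj
    · rfl

/-- The coefficients of `f(x)` are the pairings with products of complete symmetric functions. -/
lemma coeff_evVars [CharZero K] (N : ℕ) (f : Sym K) (α : ℕ →₀ ℕ)
    (hα : α.support ⊆ Finset.range N) :
    coeff α (evVars K N f) = hall f (completeProd K α) := by
  classical
  induction f using MvPolynomial.induction_on generalizing α with
  | C r =>
    rw [evVars, aeval_C, algebraMap_eq, coeff_C, ← monomial_zero', hall_monomial_left,
      ← constantCoeff_eq, completeProd, map_finsuppProd]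
    have h0 : ∀ m, constantCoeff (complete K m) = if m = 0 then 1 else 0 := by
      intro m
      rw [constantCoeff_eq, coeff_complete]
      simp [zFactor, eq_comm]
    simp only [h0]
    by_cases h : α = 0
    · simp [h, zFactor]
    · obtain ⟨i, hi⟩ := Finsupp.support_nonempty_iff.2 h
      rw [if_neg (Ne.symm h), Finsupp.prod, Finset.prod_eq_zero hi]
      · simp
      · simpa using hi
  | add p q hp hq =>
    rw [map_add, coeff_add, hp α hα, hq α hα]
    simp only [hall, scalar_add_left]
  | mul_X p k hp =>
    -- The factor p_k lowers one exponent by k on either side: through the power sum of the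
    -- variables on the left, through the adjoint derivation on the right.
    rw [mul_comm, coeff_evVars_X_mul, hall_X_mul, completeProd_eq hα, pderiv_prod_complete, hall,
      scalar_sum_right]
    refine Finset.sum_congr rfl fun i _ => ?_
    have hs : (α - Finsupp.single i (k : ℕ)).support ⊆ Finset.range N :=
      (Finsupp.support_tsub (f2 := Finsupp.single i (k : ℕ))).trans hα
    split_ifs
    · rw [hp _ hs, completeProd_eq hs, hall]
    · rw [scalar_zero_right]

lemma coeff_X_mul_pderiv (k : ℕ+) (f : Sym K) (a : ℕ+ →₀ ℕ) :
    coeff a (X k * ((k : K) • pderiv k f)) = k * a k * coeff a f := by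
  classical
  rw [coeff_X_mul', coeff_smul, coeff_pderiv]
  split_ifs with h
  · have hk : 1 ≤ a k := Nat.one_le_iff_ne_zero.2 (Finsupp.mem_support_iff.1 h)
    rw [tsub_add_cancel_of_le (Finsupp.single_le_iff.2 hk)]
    simp [Nat.cast_sub hk]
    ring
  · simp [Finsupp.notMem_support_iff.1 h]

/-- The index i stands for the part i + 1; a part that occurs in weight n is at most n, so the range
loses nothing. -/
lemma sum_range_mul_eq_partWeight {a : ℕ+ →₀ ℕ} {n : ℕ} (h : partWeight a = n) :
    ∑ i ∈ Finset.range n, (i + 1) * a i.succPNat = n := by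
  conv_rhs => rw [← h, partWeight, Finsupp.weight_apply, Finsupp.sum]
  refine (Finset.sum_bij_ne_zero (fun k _ _ => k.natPred) ?_ ?_ ?_ ?_).symm
  · intro k hk _
    have h1 : 1 * (k : ℕ) ≤ partWeight a := by
      rw [partWeight, Finsupp.weight_apply, Finsupp.sum]
      refine le_trans ?_ (Finset.single_le_sum (f := fun k : ℕ+ => a k • (k : ℕ))
        (fun _ _ => Nat.zero_le _) hk)
      exact Nat.mul_le_mul_right _ (Nat.one_le_iff_ne_zero.2 (Finsupp.mem_support_iff.1 hk))
    have := k.natPred_add_one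
    simp only [Finset.mem_range]
    omega
  · intro k _ _ l _ _ hkl
    exact PNat.natPred_injective hkl
  · intro i _ hi
    refine ⟨i.succPNat, ?_, ?_, Nat.natPred_succPNat i⟩
    · simp only [Finsupp.mem_support_iff]
      rintro h
      simp [h] at hi
    · simpa [mul_comm] using hi
  · intro k _ _
    simp [mul_comm]

/-- `n h_n = ∑ p_k h_{n - k}`. -/
lemma complete_recursion [CharZero K] (n : ℕ) :
    (n : K) • complete K n = ∑ i ∈ Finset.range n, X i.succPNat * complete K (n - (i + 1)) := by
  have h1 : ∀ i ∈ Finset.range n, (X i.succPNat * complete K (n - (i + 1)) : Sym K) =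
      X i.succPNat * (((i.succPNat : ℕ) : K) • pderiv i.succPNat (complete K n)) := by
    intro i hi
    rw [pderiv_complete, Nat.succPNat_coe, if_pos (Nat.succ_le_of_lt (Finset.mem_range.1 hi))]
  rw [Finset.sum_congr rfl h1]
  ext a
  rw [coeff_sum, coeff_smul, Finset.sum_congr rfl fun i _ => coeff_X_mul_pderiv _ _ _,
    ← Finset.sum_mul, smul_eq_mul, coeff_complete]
  split_ifs with h
  · congr 1
    conv_lhs => rw [← sum_range_mul_eq_partWeight h]
    simp
  · simp

/-- Setting every p_k to 1 is evaluation at a single variable equal to 1. By induction, the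
recursion for n h_n has n summands equal to 1. -/
lemma aeval_one_complete [CharZero K] (n : ℕ) :
    aeval (fun _ : ℕ+ => (1 : K)) (complete K n) = 1 := by
  induction n using Nat.strong_induction_on with
  | _ n ih =>
    rcases Nat.eq_zero_or_pos n with rfl | hn
    · simp [complete_zero]
    have h := congrArg (aeval fun _ : ℕ+ => (1 : K)) (complete_recursion (K := K) n)
    rw [map_smul, map_sum, Finset.sum_congr rfl (g := fun _ => (1 : K))] at h
    · have hn' : (n : K) ≠ 0 := by exact_mod_cast hn.ne'
      simpa [hn'] using h
    · intro i hi
      rw [map_mul, aeval_X, one_mul, ih]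
      have := Finset.mem_range.1 hi
      omega

/-- The symmetric functions of degree `n`. -/
def degreePart (K : Type*) [Field K] (n : ℕ) : Submodule K (Sym K) :=
  weightedHomogeneousSubmodule K (fun k : ℕ+ => (k : ℕ)) n

lemma mem_degreePart {n : ℕ} {f : Sym K} :
    f ∈ degreePart K n ↔ ∀ a, coeff a f ≠ 0 → partWeight a = n := by
  rw [degreePart, mem_weightedHomogeneousSubmodule]
  exact ⟨fun h a ha => h ha, fun h a ha => h a ha⟩

lemma complete_mem (n : ℕ) : complete K n ∈ degreePart K n := by
  rw [mem_degreePart]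
  intro a ha
  rw [coeff_complete] at ha
  by_contra h
  exact ha (if_neg h)

lemma completeProd_mem (α : ℕ →₀ ℕ) : completeProd K α ∈ degreePart K α.degree := by
  rw [degreePart, mem_weightedHomogeneousSubmodule, completeProd, Finsupp.prod, Finsupp.degree_apply]
  exact IsWeightedHomogeneous.prod _ _ _ fun i _ => complete_mem (α i)

/-- The denominators z_a of h_n cancel the norms, so pairing with h_n adds up the coefficients of a
function of degree n, that is, sets every p_k to 1. -/
lemma hall_complete_completeProd [CharZero K] (n : ℕ) (α : ℕ →₀ ℕ) :
    hall (complete K n) (completeProd K α) = if α.degree = n then 1 else 0 := by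
  have hdeg := mem_degreePart.1 (completeProd_mem (K := K) α)
  have h1 : ∀ a ∈ (completeProd K α).support,
      coeff a (completeProd K α) * coeff a (complete K n) * zFactor a =
        if α.degree = n then coeff a (completeProd K α) else 0 := by
    intro a ha
    rw [coeff_complete, hdeg a (mem_support_iff.1 ha)]
    split_ifs
    · rw [inv_mul_cancel_right₀ (zFactor_cast_ne_zero a)]
    · simp
  rw [hall, scalar_comm, scalar]
  simp only [powerNorm_zero]
  rw [Finset.sum_congr rfl h1]
  split_ifs with h
  · have h2 : aeval (fun _ : ℕ+ => (1 : K)) (completeProd K α) = 1 := by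
      rw [completeProd, map_finsuppProd]
      simp [aeval_one_complete, Finsupp.prod]
    rw [← h2]
    conv_rhs => rw [aeval_def, eval₂_eq]
    simp
  · simp

end Hall

/-! ## Triangularity of the Schur functions

In the variables `x_0, …, x_{N - 1}`, column operations turn the Jacobi–Trudi determinant into
`det (h_{lam_i - i + j}(x_j, …, x_{N - 1}))`. -/

section Flagged

variable {K : Type*} [Field K]

/-- The complete homogeneous polynomial of degree `m` in `x_j, …, x_{N - 1}`. -/
def flagged (K : Type*) [Field K] (N j m : ℕ) : MvPolynomial ℕ K :=
  ∑ α ∈ (Finset.Ico j N).finsuppAntidiag m, monomial α 1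

lemma coeff_flagged (N j m : ℕ) (α : ℕ →₀ ℕ) : coeff α (flagged K N j m) =
    if α.degree = m ∧ α.support ⊆ Finset.Ico j N then 1 else 0 := by
  classical
  rw [flagged, coeff_sum]
  simp only [coeff_monomial, Finset.sum_ite_eq', Finset.mem_finsuppAntidiag]
  refine if_congr (and_congr_left fun h => ?_) rfl rfl
  rw [Finsupp.degree_apply, Finset.sum_subset h]
  intro i _ hi
  simpa using hi

lemma evVars_complete [CharZero K] (N m : ℕ) :
    evVars K N (complete K m) = flagged K N 0 m := by
  ext α
  rw [coeff_flagged]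
  by_cases hα : α.support ⊆ Finset.range N
  · rw [coeff_evVars _ _ _ hα, hall_complete_completeProd]
    simp [hα]
  · rw [coeff_evVars_eq_zero _ _ _ hα, if_neg fun h => hα (Finset.range_eq_Ico N ▸ h.2)]

lemma flagged_zero (N j : ℕ) : flagged K N j 0 = 1 := by
  classical
  ext α
  rw [coeff_flagged, coeff_one]
  refine if_congr ?_ rfl rfl
  rw [Finsupp.degree_eq_zero_iff]
  constructor
  · exact fun h => h.1.symm
  · rintro rfl
    simp

/-- A monomial either avoids x_j or is divisible by it. -/
lemma flagged_succ {N j : ℕ} (hj : j < N) (m : ℕ) :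
    flagged K N j (m + 1) = flagged K N (j + 1) (m + 1) + X j * flagged K N j m := by
  classical
  ext α
  rw [coeff_add, coeff_X_mul']
  simp only [coeff_flagged]
  by_cases h : j ∈ α.support
  · have h1 : 1 ≤ α j := Nat.one_le_iff_ne_zero.2 (Finsupp.mem_support_iff.1 h)
    have h2 : ¬ α.support ⊆ Finset.Ico (j + 1) N := fun hs => by simpa using hs h
    have h3 : (α - Finsupp.single j 1).degree + 1 = α.degree := by
      conv_rhs => rw [← tsub_add_cancel_of_le (Finsupp.single_le_iff.2 h1), map_add,
        Finsupp.degree_single]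
    have h4 : (α - Finsupp.single j 1).support ⊆ Finset.Ico j N ↔ α.support ⊆ Finset.Ico j N := by
      constructor
      · intro hs i hi
        by_cases hij : i = j
        · simp [hij, hj]
        · apply hs
          simpa [Finsupp.single_apply, Ne.symm hij] using hi
      · exact fun hs => (Finsupp.support_tsub (f2 := Finsupp.single j 1)).trans hs
    rw [if_pos h, if_neg (show ¬ (α.degree = m + 1 ∧ _) from fun hh => h2 hh.2), zero_add]
    refine if_congr ?_ rfl rfl
    rw [h4, ← h3, add_left_inj]
  · rw [if_neg h, add_zero]
    refine if_congr (and_congr_right fun _ => ⟨fun hs i hi => ?_, fun hs => hs.trans ?_⟩) rfl rfl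
    · have h1 := Finset.mem_Ico.1 (hs hi)
      have : i ≠ j := fun hij => h (hij ▸ hi)
      simp only [Finset.mem_Ico]
      omega
    · exact Finset.Ico_subset_Ico_left (Nat.le_succ j)

/-- `∏_{i < j} (1 - x_i z)`. -/
def columnFactor (K : Type*) [Field K] (j : ℕ) : Polynomial (MvPolynomial ℕ K) :=
  ∏ i ∈ Finset.range j, (1 - Polynomial.C (X i) * Polynomial.X)

lemma natDegree_columnFactor (j : ℕ) : (columnFactor K j).natDegree ≤ j := by
  refine (Polynomial.natDegree_prod_le _ _).trans
    ((Finset.sum_le_card_nsmul _ _ 1 fun i _ => ?_).trans (by simp))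
  refine (Polynomial.natDegree_sub_le _ _).trans ?_
  rw [Polynomial.natDegree_one]
  exact max_le (Nat.zero_le _) ((Polynomial.natDegree_C_mul_le _ _).trans Polynomial.natDegree_X_le)

lemma coeff_zero_columnFactor (j : ℕ) : (columnFactor K j).coeff 0 = 1 := by
  rw [Polynomial.coeff_zero_eq_eval_zero, columnFactor, Polynomial.eval_prod]
  simp

/-- The generating series of the complete polynomials in x_j, …, x_{N-1} is the product of the 1/(1
- x_i z); each factor 1 - x_i z removes one variable, by `flagged_succ`. -/
lemma columnFactor_mul {N j : ℕ} (hj : j ≤ N) :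
    (columnFactor K j : PowerSeries (MvPolynomial ℕ K)) * PowerSeries.mk (flagged K N 0) =
      PowerSeries.mk (flagged K N j) := by
  induction j with
  | zero => simp [columnFactor]
  | succ j ih =>
    have h : (columnFactor K (j + 1) : PowerSeries (MvPolynomial ℕ K)) =
        (1 - PowerSeries.C (X j) * PowerSeries.X) *
          (columnFactor K j : PowerSeries (MvPolynomial ℕ K)) := by
      rw [columnFactor, Finset.prod_range_succ, Polynomial.coe_mul, mul_comm]
      simp [columnFactor]
    rw [h, mul_assoc, ih (by omega)]
    ext m : 1
    rw [sub_mul, one_mul, map_sub, mul_assoc, PowerSeries.coeff_C_mul]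
    cases m with
    | zero => simp [flagged_zero]
    | succ m =>
      rw [PowerSeries.coeff_succ_X_mul]
      simp only [PowerSeries.coeff_mk]
      rw [flagged_succ (by omega), add_sub_cancel_right]

/-- `flagged` with an integer degree. -/
def flaggedInt (K : Type*) [Field K] (N j : ℕ) (z : ℤ) : MvPolynomial ℕ K :=
  if 0 ≤ z then flagged K N j z.toNat else 0

lemma evVars_completeInt [CharZero K] (N : ℕ) (z : ℤ) :
    evVars K N (completeInt K z) = flaggedInt K N 0 z := by
  rw [completeInt, flaggedInt]
  split_ifs
  · exact evVars_complete _ _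
  · exact map_zero _

/-- One coefficient of `columnFactor_mul`, read as a column operation: column j plus multiples of
the columns before it. -/
lemma flaggedInt_eq {N j : ℕ} (hj : j ≤ N) (z : ℤ) :
    flaggedInt K N j (z + j) =
      ∑ r ∈ Finset.range (j + 1), flaggedInt K N 0 (z + r) * (columnFactor K j).coeff (j - r) := by
  rw [← Finset.sum_range_reflect]
  have h0 : ∀ s ∈ Finset.range (j + 1),
      flaggedInt K N 0 (z + ((j + 1 - 1 - s : ℕ) : ℤ)) *
        (columnFactor K j).coeff (j - (j + 1 - 1 - s)) =
      (columnFactor K j).coeff s * flaggedInt K N 0 (z + j - s) := by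
    intro s hs
    have hs' := Finset.mem_range.1 hs
    rw [mul_comm]
    congr 2
    · omega
    · omega
  rw [Finset.sum_congr rfl h0]
  by_cases hz : 0 ≤ z + j
  · obtain ⟨w, hw⟩ := Int.eq_ofNat_of_zero_le hz
    rw [hw, flaggedInt, if_pos (by omega)]
    have h1 := congrArg (PowerSeries.coeff w) (columnFactor_mul (K := K) hj)
    rw [PowerSeries.coeff_mk, PowerSeries.coeff_mul,
      Finset.Nat.sum_antidiagonal_eq_sum_range_succ
        (f := fun a b => PowerSeries.coeff a (columnFactor K j : PowerSeries (MvPolynomial ℕ K)) *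
          PowerSeries.coeff b (PowerSeries.mk (flagged K N 0)))] at h1
    simp only [Polynomial.coeff_coe, PowerSeries.coeff_mk] at h1
    rw [Int.toNat_natCast, ← h1]
    have h2 : ∀ s ∈ Finset.range (w + 1), (columnFactor K j).coeff s * flagged K N 0 (w - s) =
        (columnFactor K j).coeff s * flaggedInt K N 0 ((w : ℤ) - s) := by
      intro s hs
      have := Finset.mem_range.1 hs
      rw [flaggedInt, if_pos (by omega)]
      congr 2
      omega
    rw [Finset.sum_congr rfl h2]
    -- The sum may be cut off at either bound: beyond w the complete polynomial has negative index,
    -- beyond j the column factor has no coefficients.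
    have h3 : ∀ M, M = w ∨ M = j → ∑ s ∈ Finset.range (M + 1), (columnFactor K j).coeff s *
        flaggedInt K N 0 ((w : ℤ) - s) = ∑ s ∈ Finset.range (w + j + 1),
          (columnFactor K j).coeff s * flaggedInt K N 0 ((w : ℤ) - s) := by
      intro M hM
      refine Finset.sum_subset (Finset.range_subset_range.2 (by omega)) fun s _ hs => ?_
      rw [Finset.mem_range] at hs
      rcases hM with rfl | rfl
      · rw [flaggedInt, if_neg (by omega), mul_zero]
      · rw [Polynomial.coeff_eq_zero_of_natDegree_lt
          ((natDegree_columnFactor _).trans_lt (by omega)), zero_mul]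
    rw [h3 w (Or.inl rfl), h3 j (Or.inr rfl)]
  · rw [flaggedInt, if_neg hz]
    refine (Finset.sum_eq_zero fun s _ => ?_).symm
    rw [flaggedInt, if_neg (by omega), mul_zero]

/-- The flagged form of the Jacobi–Trudi determinant. -/
lemma evVars_schur [CharZero K] (N : ℕ) (lam : YoungDiagram) (hN : lam.colLen 0 ≤ N) :
    evVars K N (schur K lam) = Matrix.det (Matrix.of fun i j : Fin (lam.colLen 0) =>
      flaggedInt K N j ((lam.rowLen i : ℤ) - i + j)) := by
  -- This matrix collects the column operations. It is upper unitriangular because every column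
  -- factor has constant term 1.
  let E : Matrix (Fin (lam.colLen 0)) (Fin (lam.colLen 0)) (MvPolynomial ℕ K) :=
    Matrix.of fun r j => if r ≤ j then (columnFactor K j).coeff ((j : ℕ) - r) else 0
  have hE : E.det = 1 := by
    rw [Matrix.det_of_isUpperTriangular]
    · refine Finset.prod_eq_one fun j _ => ?_
      simp [E, coeff_zero_columnFactor]
    · intro i j hij
      simp only [id] at hij
      simp [E, not_le.2 hij]
  rw [schur, AlgHom.map_det, ← mul_one (Matrix.det _), ← hE, ← Matrix.det_mul]
  congr 1
  ext1 i j
  rw [Matrix.mul_apply, Matrix.of_apply, flaggedInt_eq (j.2.le.trans hN)]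
  simp only [AlgHom.mapMatrix_apply, Matrix.map_apply, Matrix.of_apply, evVars_completeInt, E,
    mul_ite, mul_zero]
  simp only [← Fin.val_fin_le]
  rw [Fin.sum_univ_eq_sum_range (fun r => if r ≤ (j : ℕ) then
    flaggedInt K N 0 ((lam.rowLen i : ℤ) - i + r) * (columnFactor K j).coeff ((j : ℕ) - r) else 0),
    ← Finset.sum_filter]
  refine Finset.sum_congr ?_ fun _ _ => rfl
  have := j.2
  ext r
  simp only [Finset.mem_range, Finset.mem_filter]
  omega

/-! ### Dominance from the expansion of the flagged determinant. -/

lemma coeff_mvPolynomial_prod {ι σ R : Type*} [CommSemiring R] [DecidableEq ι] [DecidableEq σ]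
    (s : Finset ι) (f : ι → MvPolynomial σ R) (d : σ →₀ ℕ) :
    coeff d (∏ i ∈ s, f i) = ∑ l ∈ s.finsuppAntidiag d, ∏ i ∈ s, coeff (l i) (f i) := by
  have h := MvPowerSeries.coeff_prod (fun i => (f i : MvPowerSeries σ R)) d s
  simp only [MvPolynomial.coeff_coe] at h
  rw [← h, ← MvPolynomial.coeff_coe]
  congr 1
  exact map_prod coeToMvPowerSeries.ringHom f s

/-- The elements of `Fin l` below `k`. -/
def initialFin (l k : ℕ) : Finset (Fin l) := Finset.univ.filter fun j => (j : ℕ) < k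

/-- Sums of a strictly decreasing sequence over the image of an initial segment. -/
lemma sum_perm_le {l : ℕ} (a : ℕ → ℤ) (ha : StrictAnti a) (σ : Equiv.Perm (Fin l)) (k : ℕ) :
    ∑ j ∈ initialFin l k, a (σ j) ≤ ∑ j ∈ initialFin l k, a j := by
  have h1 : ∀ f : Fin l → ℤ, ∑ j ∈ initialFin l k, f j =
      ∑ j ∈ initialFin l k, (f j - a k) + ∑ j ∈ initialFin l k, a k := by
    intro f
    rw [← Finset.sum_add_distrib]
    simp
  rw [h1, h1 fun j => a j]
  refine add_le_add_left ?_ _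
  -- After subtraction of a_k the terms below k are positive and the others are not, so the initial
  -- sum equals the sum of all positive parts, which a permutation preserves.
  calc ∑ j ∈ initialFin l k, (a (σ j) - a k)
      ≤ ∑ j ∈ initialFin l k, max (a (σ j) - a k) 0 :=
        Finset.sum_le_sum fun _ _ => le_max_left _ _
    _ ≤ ∑ j : Fin l, max (a (σ j) - a k) 0 :=
        Finset.sum_le_sum_of_subset_of_nonneg (Finset.filter_subset _ _)
          fun _ _ _ => le_max_right _ _
    _ = ∑ j : Fin l, max (a j - a k) 0 := Equiv.sum_comp σ fun j : Fin l => max (a j - a k) 0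
    _ = ∑ j ∈ initialFin l k, (a j - a k) := by
        rw [initialFin, Finset.sum_filter]
        refine Finset.sum_congr rfl fun j _ => ?_
        split_ifs with h
        · exact max_eq_left (sub_nonneg.2 (ha h).le)
        · exact max_eq_right (sub_nonpos.2 (ha.antitone (not_lt.1 h)))

/-- The row lengths as exponents. -/
def rowFinsupp (lam : YoungDiagram) : ℕ →₀ ℕ :=
  Finsupp.onFinset (Finset.range (lam.colLen 0)) lam.rowLen fun i hi => by
    rw [Finset.mem_range, ← YoungDiagram.mem_iff_lt_colLen, YoungDiagram.mem_iff_lt_rowLen]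
    exact Nat.pos_of_ne_zero hi

lemma rowFinsupp_apply (lam : YoungDiagram) (i : ℕ) : rowFinsupp lam i = lam.rowLen i := rfl

lemma support_rowFinsupp (lam : YoungDiagram) :
    (rowFinsupp lam).support = Finset.range (lam.colLen 0) := by
  ext i
  rw [Finsupp.mem_support_iff, rowFinsupp_apply, Finset.mem_range,
    ← YoungDiagram.mem_iff_lt_colLen, YoungDiagram.mem_iff_lt_rowLen, Nat.pos_iff_ne_zero]

lemma sum_rowLen (lam : YoungDiagram) {N : ℕ} (hN : lam.colLen 0 ≤ N) :
    ∑ i ∈ Finset.range N, lam.rowLen i = lam.card := by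
  rw [YoungDiagram.card, Finset.card_eq_sum_card_fiberwise (f := Prod.fst) (t := Finset.range N)]
  · refine Finset.sum_congr rfl fun i _ => ?_
    rw [YoungDiagram.rowLen_eq_card]
    rfl
  · rintro ⟨i, j⟩ h
    have h1 : (i, 0) ∈ lam := lam.up_left_mem le_rfl (Nat.zero_le j) h
    rw [YoungDiagram.mem_iff_lt_colLen] at h1
    simp only [Finset.coe_range, Set.mem_Iio]
    omega

lemma degree_rowFinsupp (lam : YoungDiagram) : (rowFinsupp lam).degree = lam.card := by
  rw [Finsupp.degree_apply, support_rowFinsupp, ← sum_rowLen lam le_rfl]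
  rfl

/-- Weak dominance between partitions of the same number. -/
def DomLE (μ lam : YoungDiagram) : Prop :=
  μ.card = lam.card ∧
    ∀ k, ∑ i ∈ Finset.range k, μ.rowLen i ≤ ∑ i ∈ Finset.range k, lam.rowLen i

lemma DomLE.refl (μ : YoungDiagram) : DomLE μ μ := ⟨rfl, fun _ => le_rfl⟩

lemma DomLE.trans {a b c : YoungDiagram} (h : DomLE a b) (h' : DomLE b c) : DomLE a c :=
  ⟨h.1.trans h'.1, fun k => (h.2 k).trans (h'.2 k)⟩

lemma DomLT.le {a b : YoungDiagram} (h : DomLT a b) : DomLE a b := h.2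

lemma domLE_iff {a b : YoungDiagram} : DomLE a b ↔ a = b ∨ DomLT a b := by
  constructor
  · intro h
    by_cases hab : a = b
    · exact Or.inl hab
    · exact Or.inr ⟨hab, h⟩
  · rintro (rfl | h)
    · exact DomLE.refl _
    · exact h.2

lemma eq_of_rowLen_eq {a b : YoungDiagram} (h : ∀ i, a.rowLen i = b.rowLen i) : a = b := by
  ext ⟨i, j⟩
  simp only [YoungDiagram.mem_cells, YoungDiagram.mem_iff_lt_rowLen, h]

lemma strictAnti_rowLen_sub (lam : YoungDiagram) :
    StrictAnti fun i : ℕ => (lam.rowLen i : ℤ) - i := by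
  intro i j hij
  have := lam.rowLen_anti i j hij.le
  dsimp only
  omega

/-- A nonzero term of the expansion of a flagged Jacobi–Trudi determinant. -/
lemma flagged_term {N : ℕ} {μ lam : YoungDiagram} {σ : Equiv.Perm (Fin (lam.colLen 0))}
    {β : Fin (lam.colLen 0) → ℕ →₀ ℕ} (hβ : ∑ j, β j = rowFinsupp μ)
    (hne : ∀ j, coeff (β j) (flaggedInt K N j ((lam.rowLen (σ j) : ℤ) - (σ j : ℕ) + j)) ≠ 0) :
    (∀ j, ((β j).degree : ℤ) = (lam.rowLen (σ j) : ℤ) - (σ j : ℕ) + j) ∧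
    (∀ j, ∀ i, β j i ≠ 0 → (j : ℕ) ≤ i) ∧
    (∀ k, ((∑ i ∈ Finset.range k, μ.rowLen i : ℕ) : ℤ) ≤
      ∑ j ∈ initialFin (lam.colLen 0) k, ((β j).degree : ℤ)) ∧
    (∀ k, ∑ j ∈ initialFin (lam.colLen 0) k, ((β j).degree : ℤ) ≤
      ((∑ i ∈ Finset.range k, lam.rowLen i : ℕ) : ℤ)) := by
  have h1 : ∀ j, ((β j).degree : ℤ) = (lam.rowLen (σ j) : ℤ) - (σ j : ℕ) + j ∧
      (β j).support ⊆ Finset.Ico (j : ℕ) N := by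
    intro j
    have h := hne j
    rw [flaggedInt] at h
    split_ifs at h with hz
    · rw [coeff_flagged] at h
      have h' := of_not_not fun hh => h (if_neg hh)
      exact ⟨by rw [h'.1, Int.toNat_of_nonneg hz], h'.2⟩
    · simp at h
  have h2 : ∀ j, ∀ i, β j i ≠ 0 → (j : ℕ) ≤ i := fun j i hi =>
    (Finset.mem_Ico.1 ((h1 j).2 (Finsupp.mem_support_iff.2 hi))).1
  refine ⟨fun j => (h1 j).1, h2, fun k => ?_, fun k => ?_⟩
  -- A column j ≥ k involves no variable of index below k, so the first k rows of μ are filled by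
  -- the columns below k.
  · have h3 : ∀ i, μ.rowLen i = ∑ j, β j i := fun i => by
      rw [← rowFinsupp_apply, ← hβ, Finsupp.finsetSum_apply]
    simp only [h3]
    rw [Finset.sum_comm, ← Nat.cast_sum, Nat.cast_le, initialFin, Finset.sum_filter]
    refine Finset.sum_le_sum fun j _ => ?_
    split_ifs with hj
    · rw [Finsupp.degree_apply, Finset.sum_subset (s₂ := Finset.range k ∪ (β j).support)
        Finset.subset_union_right fun i _ hi => Finsupp.notMem_support_iff.1 hi]
      exact Finset.sum_le_sum_of_subset Finset.subset_union_left
    · refine (Finset.sum_eq_zero fun i hi => ?_).le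
      by_contra h
      have := h2 j i h
      have := Finset.mem_range.1 hi
      omega
  -- The sequence λ_i - i is strictly decreasing, so permuting it cannot raise its initial sums.
  · have h3 : ∑ j ∈ initialFin (lam.colLen 0) k, ((β j).degree : ℤ) ≤
        ∑ j ∈ initialFin (lam.colLen 0) k, (lam.rowLen j : ℤ) := by
      have h4 := sum_perm_le _ (strictAnti_rowLen_sub lam) σ k
      calc _ = ∑ j ∈ initialFin (lam.colLen 0) k, ((lam.rowLen (σ j) : ℤ) - (σ j : ℕ)) +
            ∑ j ∈ initialFin (lam.colLen 0) k, (j : ℤ) := by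
              rw [← Finset.sum_add_distrib]
              exact Finset.sum_congr rfl fun j _ => (h1 j).1
        _ ≤ _ := add_le_add_left h4 _
        _ = _ := by
              rw [← Finset.sum_add_distrib]
              exact Finset.sum_congr rfl fun j _ => by ring
    refine h3.trans (le_of_eq ?_)
    rw [initialFin, Finset.sum_filter, Fin.sum_univ_eq_sum_range
      (fun j => if j < k then (lam.rowLen j : ℤ) else 0), Nat.cast_sum, ← Finset.sum_filter]
    refine Finset.sum_subset ?_ ?_
    · intro j
      simp
    · intro j hj hj'
      have : j ∉ (rowFinsupp lam).support := by
        rw [support_rowFinsupp]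
        simp only [Finset.mem_filter, Finset.mem_range] at hj hj' ⊢
        omega
      rw [Finsupp.notMem_support_iff, rowFinsupp_apply] at this
      rw [this, Nat.cast_zero]

lemma hall_schur_eq [CharZero K] (lam μ : YoungDiagram) {N : ℕ} (hN : lam.colLen 0 ≤ N)
    (hN' : μ.colLen 0 ≤ N) : hall (schur K lam) (completeProd K (rowFinsupp μ)) =
      ∑ σ : Equiv.Perm (Fin (lam.colLen 0)), Equiv.Perm.sign σ •
        ∑ β ∈ Finset.univ.finsuppAntidiag (rowFinsupp μ), ∏ j : Fin (lam.colLen 0),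
          coeff (β j) (flaggedInt K N j ((lam.rowLen (σ j) : ℤ) - (σ j : ℕ) + j)) := by
  rw [← coeff_evVars N _ _ (by rw [support_rowFinsupp]; exact Finset.range_subset_range.2 hN'),
    evVars_schur _ _ hN, Matrix.det_apply, coeff_sum]
  refine Finset.sum_congr rfl fun σ _ => ?_
  have h : ∀ (u : ℤˣ) (f : MvPolynomial ℕ K) d, coeff d (u • f) = u • coeff d f := by
    intro u f d
    rw [Units.smul_def, Units.smul_def, coeff_smul]
  rw [h, coeff_mvPolynomial_prod]
  rfl

/-- Schur functions are triangular with respect to dominance. -/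
lemma domLE_of_hall_schur_ne_zero [CharZero K] {lam μ : YoungDiagram}
    (h : hall (schur K lam) (completeProd K (rowFinsupp μ)) ≠ 0) : DomLE μ lam := by
  rw [hall_schur_eq lam μ (le_max_left _ (μ.colLen 0)) (le_max_right _ _)] at h
  obtain ⟨σ, -, hσ⟩ := Finset.exists_ne_zero_of_sum_ne_zero h
  obtain ⟨β, hβ, hβ'⟩ := Finset.exists_ne_zero_of_sum_ne_zero (right_ne_zero_of_smul hσ)
  have hsum : ∑ j, β j = rowFinsupp μ := (Finset.mem_finsuppAntidiag.1 hβ).1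
  obtain ⟨h1, h2, h3, h4⟩ := flagged_term hsum
    fun j => Finset.prod_ne_zero_iff.1 hβ' j (Finset.mem_univ j)
  refine ⟨?_, fun k => by exact_mod_cast (h3 k).trans (h4 k)⟩
  have h5 : ((μ.card : ℕ) : ℤ) = ∑ j, ((β j).degree : ℤ) := by
    rw [← degree_rowFinsupp, ← hsum, map_sum, Nat.cast_sum]
  have h6 : ∑ j : Fin (lam.colLen 0), ((lam.rowLen (σ j) : ℤ) - (σ j : ℕ)) =
      ∑ j : Fin (lam.colLen 0), ((lam.rowLen j : ℤ) - (j : ℕ)) :=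
    Equiv.sum_comp σ fun j : Fin (lam.colLen 0) => (lam.rowLen j : ℤ) - (j : ℕ)
  rw [Finset.sum_congr rfl fun j _ => h1 j, Finset.sum_add_distrib, h6,
    ← Finset.sum_add_distrib] at h5
  simp only [sub_add_cancel] at h5
  rw [Fin.sum_univ_eq_sum_range (fun j => (lam.rowLen j : ℤ)), ← Nat.cast_sum,
    sum_rowLen lam le_rfl] at h5
  exact_mod_cast h5

/-- For μ = λ both inequalities of `flagged_term` are equalities. Hence column j has degree λ_j,
which forces the identity permutation, and a single term with coefficient 1 remains. -/
lemma hall_schur_self [CharZero K] (lam : YoungDiagram) :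
    hall (schur K lam) (completeProd K (rowFinsupp lam)) = 1 := by
  classical
  set l := lam.colLen 0 with hl
  let β₀ : Fin l →₀ ℕ →₀ ℕ :=
    Finsupp.equivFunOnFinite.symm fun j => Finsupp.single (j : ℕ) (lam.rowLen j)
  have hβ₀ : ∑ j, β₀ j = rowFinsupp lam := by
    ext i
    rw [Finsupp.finsetSum_apply]
    simp only [β₀, Finsupp.equivFunOnFinite_symm_apply_apply, Finsupp.single_apply]
    rw [Fin.sum_univ_eq_sum_range (fun j => if j = i then lam.rowLen j else 0),
      Finset.sum_ite_eq']
    split_ifs with h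
    · rfl
    · rw [hl, ← support_rowFinsupp, Finsupp.notMem_support_iff] at h
      exact h.symm
  have key : ∀ (σ : Equiv.Perm (Fin l)) (β : Fin l →₀ ℕ →₀ ℕ), ∑ j, β j = rowFinsupp lam →
      (∀ j, coeff (β j) (flaggedInt K l j ((lam.rowLen (σ j) : ℤ) - (σ j : ℕ) + j)) ≠ 0) →
      σ = 1 ∧ β = β₀ := by
    intro σ β hsum hne
    obtain ⟨h1, h2, h3, h4⟩ := flagged_term hsum hne
    have h5 : ∀ k, ∑ j ∈ initialFin l k, ((β j).degree : ℤ) =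
        ∑ i ∈ Finset.range k, (lam.rowLen i : ℤ) := fun k => by
      have h := le_antisymm (h4 k) (h3 k)
      rwa [Nat.cast_sum (Finset.range k)] at h
    have h6 : ∀ j : Fin l, ((β j).degree : ℤ) = lam.rowLen j := by
      intro j
      have h7 : initialFin l (j + 1) = insert j (initialFin l j) := by
        ext i
        simp only [initialFin, Finset.mem_filter, Finset.mem_univ, true_and, Finset.mem_insert,
          Fin.ext_iff]
        omega
      have h8 := h5 (j + 1)
      rw [h7, Finset.sum_insert (by simp [initialFin]), h5, Finset.sum_range_succ] at h8
      linarith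
    constructor
    · ext j
      have h9 := h1 j
      rw [h6] at h9
      have := (strictAnti_rowLen_sub lam).injective
        (show (lam.rowLen (σ j) : ℤ) - (σ j : ℕ) = (lam.rowLen j : ℤ) - (j : ℕ) by linarith)
      simpa using this
    -- Earlier columns sit on their own variables and later columns avoid x_j, so the exponent of
    -- x_j comes from column j alone and already exhausts its degree.
    · have h10 : ∀ m : ℕ, ∀ j : Fin l, (j : ℕ) = m → β j = β₀ j := by
        intro m
        induction m using Nat.strong_induction_on with
        | _ m ih =>
          intro j hj
          have h11 : β j j = lam.rowLen j := by
            have h12 := DFunLike.congr_fun hsum (j : ℕ)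
            rw [Finsupp.finsetSum_apply, rowFinsupp_apply, Finset.sum_eq_single j] at h12
            · exact h12
            · intro i _ hij
              rcases lt_trichotomy (i : ℕ) j with h | h | h
              · rw [ih i (hj ▸ h) i rfl]
                simp [β₀, h.ne]
              · exact absurd (Fin.ext h) hij
              · by_contra hne
                exact absurd (h2 i j hne) (not_le.2 h)
            · simp
          have h13 : (β j).degree = lam.rowLen j := by exact_mod_cast h6 j
          have h14 : Finsupp.single (j : ℕ) (lam.rowLen j) ≤ β j := by
            rw [Finsupp.single_le_iff, h11]
          have h15 := congrArg Finsupp.degree (tsub_add_cancel_of_le h14)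
          rw [map_add, h13, Finsupp.degree_single] at h15
          have h16 : β j - Finsupp.single (j : ℕ) (lam.rowLen j) = 0 := by
            rw [← Finsupp.degree_eq_zero_iff]
            omega
          rw [← tsub_add_cancel_of_le h14, h16, zero_add]
          simp [β₀]
      ext1 j
      exact h10 j j rfl
  rw [hall_schur_eq lam lam le_rfl le_rfl, Finset.sum_eq_single 1]
  · rw [Equiv.Perm.sign_one, one_smul, Finset.sum_eq_single β₀]
    · refine Finset.prod_eq_one fun j _ => ?_
      have h0 : (lam.rowLen ((1 : Equiv.Perm (Fin l)) j) : ℤ) -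
          ((1 : Equiv.Perm (Fin l)) j : ℕ) + j = lam.rowLen j := by simp
      rw [h0, flaggedInt, if_pos (Int.natCast_nonneg _), Int.toNat_natCast, coeff_flagged, if_pos]
      simp only [β₀, Finsupp.equivFunOnFinite_symm_apply_apply, Finsupp.degree_single, true_and]
      exact Finsupp.support_single_subset.trans
        (Finset.singleton_subset_iff.2 (Finset.mem_Ico.2 ⟨le_rfl, j.2⟩))
    · intro β hβ hne
      by_contra h
      exact hne (key 1 β (Finset.mem_finsuppAntidiag.1 hβ).1
        fun j => Finset.prod_ne_zero_iff.1 h j (Finset.mem_univ j)).2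
    · intro h
      exact absurd (Finset.mem_finsuppAntidiag.2 ⟨hβ₀, Finset.subset_univ _⟩) h
  · intro σ _ hσ
    rw [Finset.sum_eq_zero, smul_zero]
    intro β hβ
    by_contra h
    exact hσ (key σ β (Finset.mem_finsuppAntidiag.1 hβ).1
      fun j => Finset.prod_ne_zero_iff.1 h j (Finset.mem_univ j)).1
  · simp

/-- In each term of the determinant the shifts j - σ(j) cancel, so the indices add up to the number
of cells; terms with a negative index vanish. -/
lemma schur_mem (lam : YoungDiagram) : schur K lam ∈ degreePart K lam.card := by
  rw [schur, Matrix.det_apply]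
  refine sum_mem fun σ _ => ?_
  rw [Units.smul_def]
  refine zsmul_mem ?_ _
  simp only [Matrix.of_apply]
  by_cases hz : ∀ j : Fin (lam.colLen 0), 0 ≤ (lam.rowLen (σ j) : ℤ) - (σ j : ℕ) + j
  · have h1 : ∑ j : Fin (lam.colLen 0),
        ((lam.rowLen (σ j) : ℤ) - (σ j : ℕ) + j).toNat = lam.card := by
      zify
      simp only [Int.toNat_of_nonneg (hz _)]
      rw [Finset.sum_add_distrib,
        Equiv.sum_comp σ fun j : Fin (lam.colLen 0) => (lam.rowLen j : ℤ) - (j : ℕ),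
        ← Finset.sum_add_distrib]
      simp only [sub_add_cancel]
      rw [Fin.sum_univ_eq_sum_range (fun j => (lam.rowLen j : ℤ)), ← Nat.cast_sum,
        sum_rowLen lam le_rfl]
    rw [degreePart, mem_weightedHomogeneousSubmodule, ← h1]
    refine IsWeightedHomogeneous.prod _ _ _ fun j _ => ?_
    rw [completeInt, if_pos (hz j)]
    exact complete_mem _
  · push Not at hz
    obtain ⟨j, hj⟩ := hz
    rw [Finset.prod_eq_zero (Finset.mem_univ j)]
    · exact zero_mem _
    · rw [completeInt, if_neg (not_le.2 hj)]

end Flagged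

/-! ## Products of complete symmetric functions as a basis -/

/-- The statistic `∑ a_k (k - c)`, the sum of the excesses of the parts over `c`. -/
def excess (c : ℕ) : (ℕ+ →₀ ℕ) →+ ℕ := Finsupp.weight fun k : ℕ+ => (k : ℕ) - c

lemma excess_single (c : ℕ) (k : ℕ+) (m : ℕ) : excess c (Finsupp.single k m) = m * (k - c) := by
  simp [excess, Finsupp.weight_apply]

/-- Merging all parts into one can only increase the excess, as truncated subtraction shows. -/
lemma excess_le (c : ℕ) (a : ℕ+ →₀ ℕ) : excess c a ≤ partWeight a - c := by
  induction a using Finsupp.induction_linear with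
  | zero => simp
  | add f g hf hg => rw [map_add, map_add]; omega
  | single k m =>
    rw [excess_single, partWeight_single, Nat.mul_sub]
    rcases Nat.eq_zero_or_pos m with rfl | hm
    · simp
    · exact Nat.sub_le_sub_left (Nat.le_mul_of_pos_left c hm) _

/-- The exponents of `∏ p_{lam_i}`. -/
def rowContent (lam : YoungDiagram) : ℕ+ →₀ ℕ :=
  ∑ i ∈ Finset.range (lam.colLen 0), Finsupp.single (lam.rowLen i).toPNat' 1

lemma rowLen_pos {lam : YoungDiagram} {i : ℕ} (hi : i < lam.colLen 0) : 0 < lam.rowLen i := by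
  rwa [← YoungDiagram.mem_iff_lt_rowLen, YoungDiagram.mem_iff_lt_colLen]

lemma rowLen_eq_zero {lam : YoungDiagram} {i : ℕ} (hi : lam.colLen 0 ≤ i) : lam.rowLen i = 0 := by
  by_contra h
  have := Nat.pos_of_ne_zero h
  rw [← YoungDiagram.mem_iff_lt_rowLen, YoungDiagram.mem_iff_lt_colLen] at this
  omega

lemma degree_rowContent (lam : YoungDiagram) : (rowContent lam).degree = lam.colLen 0 := by
  simp [rowContent, map_sum]

lemma excess_rowContent (c : ℕ) (lam : YoungDiagram) :
    excess c (rowContent lam) = ∑ i ∈ Finset.range (lam.colLen 0), (lam.rowLen i - c) := by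
  rw [rowContent, map_sum]
  refine Finset.sum_congr rfl fun i hi => ?_
  rw [excess_single, one_mul, Nat.toPNat'_coe, if_pos (rowLen_pos (Finset.mem_range.1 hi))]

lemma partWeight_rowContent (lam : YoungDiagram) : partWeight (rowContent lam) = lam.card :=
  (excess_rowContent 0 lam).trans (sum_rowLen lam le_rfl)

lemma rowContent_surjective (a : ℕ+ →₀ ℕ) : ∃ lam, rowContent lam = a := by
  set w := (partsOf a).sort (· ≥ ·) with hw
  have hs : w.SortedGE := (Multiset.pairwise_sort _ _).sortedGE
  have hpos : ∀ x ∈ w, 0 < x := fun x hx => pos_of_mem_partsOf ((Multiset.mem_sort _).1 hx)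
  refine ⟨YoungDiagram.ofRowLens w hs, ?_⟩
  have h1 := YoungDiagram.rowLens_ofRowLens_eq_self (hw := hs) hpos
  have h2 : content (w : Multiset ℕ) = a := by
    rw [hw, Multiset.sort_eq, content_partsOf]
  have h3 : ∀ l : List ℕ, content (l : Multiset ℕ) =
      (l.map fun k => Finsupp.single k.toPNat' 1).sum := by
    intro l
    induction l with
    | nil => simp [content]
    | cons k l ih =>
      rw [List.map_cons, List.sum_cons, ← ih, ← content_cons]
      rfl
  rw [← h2, h3, rowContent]
  conv_rhs => rw [← h1, YoungDiagram.rowLens, List.map_map]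
  simp only [Finset.sum, Finset.range_val, Multiset.range, Multiset.map_coe, Multiset.sum_coe]
  rfl

/-- The product `∏ h_{lam_i}`. -/
def completeRow (K : Type*) [Field K] (lam : YoungDiagram) : Sym K :=
  completeProd K (rowFinsupp lam)

lemma completeRow_eq (K : Type*) [Field K] (lam : YoungDiagram) :
    completeRow K lam = ∏ i ∈ Finset.range (lam.colLen 0), complete K (lam.rowLen i) :=
  completeProd_eq (support_rowFinsupp lam).le

lemma completeRow_map {K L : Type*} [Field K] [Field L] (f : K →+* L) (lam : YoungDiagram) :
    map f (completeRow K lam) = completeRow L lam := completeProd_map f _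

lemma completeRow_mem (K : Type*) [Field K] (lam : YoungDiagram) :
    completeRow K lam ∈ degreePart K lam.card :=
  degree_rowFinsupp lam ▸ completeProd_mem (rowFinsupp lam)

/-- The power products in ∏ h_{α_i} arise by splitting each α_i into parts. Splitting does not lower
the number of parts, keeps it only if nothing is split, and raises no excess. Rational coefficients
are used because they are nonnegative, so nothing cancels. -/
lemma coeff_prod_complete (α : ℕ → ℕ) (s : Finset ℕ) (hα : ∀ i ∈ s, 0 < α i) :
    (∀ a, 0 ≤ coeff a (∏ i ∈ s, complete ℚ (α i))) ∧
    (∀ a, coeff a (∏ i ∈ s, complete ℚ (α i)) ≠ 0 → s.card ≤ a.degree ∧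
      (a.degree = s.card → a = ∑ i ∈ s, Finsupp.single (α i).toPNat' 1) ∧
      ∀ c, excess c a ≤ ∑ i ∈ s, (α i - c)) ∧
    0 < coeff (∑ i ∈ s, Finsupp.single (α i).toPNat' 1) (∏ i ∈ s, complete ℚ (α i)) := by
  classical
  induction s using Finset.induction with
  | empty =>
    refine ⟨fun a => ?_, fun a ha => ?_, by simp⟩
    · rw [Finset.prod_empty, coeff_one]
      split_ifs <;> simp
    · have : a = 0 := by
        rw [Finset.prod_empty, coeff_one] at ha
        by_contra h
        exact ha (if_neg (Ne.symm h))
      subst this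
      simp
  | insert j s hj ih =>
    obtain ⟨ih1, ih2, ih3⟩ := ih fun i hi => hα i (Finset.mem_insert_of_mem hi)
    have hc : ∀ b, 0 ≤ coeff b (complete ℚ (α j)) := fun b => by
      rw [coeff_complete]
      split_ifs
      · positivity
      · exact le_rfl
    have hαj := hα j (Finset.mem_insert_self _ _)
    rw [Finset.prod_insert hj, Finset.sum_insert hj, Finset.card_insert_of_notMem hj]
    refine ⟨fun a => ?_, fun a ha => ?_, ?_⟩
    · rw [coeff_mul]
      exact Finset.sum_nonneg fun x _ => mul_nonneg (hc _) (ih1 _)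
    · rw [coeff_mul] at ha
      obtain ⟨⟨b, c⟩, hbc, hne⟩ := Finset.exists_ne_zero_of_sum_ne_zero ha
      obtain rfl : b + c = a := Finset.HasAntidiagonal.mem_antidiagonal.1 hbc
      obtain ⟨h1, h2, h3⟩ := ih2 c (right_ne_zero_of_mul hne)
      have hb : partWeight b = α j := mem_degreePart.1 (complete_mem (α j)) b
        (left_ne_zero_of_mul hne)
      have hb0 : b ≠ 0 := by
        rintro rfl
        rw [map_zero] at hb
        omega
      have hb1 : 1 ≤ b.degree := Nat.one_le_iff_ne_zero.2 fun h =>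
        hb0 ((Finsupp.degree_eq_zero_iff b).1 h)
      rw [map_add]
      refine ⟨by omega, fun h => ?_, fun k => ?_⟩
      · rw [h2 (by omega)]
        congr 1
        obtain ⟨k, hk⟩ : ∃ k, b = Finsupp.single k 1 := by
          obtain ⟨k, hk⟩ := Finsupp.support_nonempty_iff.2 hb0
          have hk' : Finsupp.single k 1 ≤ b :=
            Finsupp.single_le_iff.2 (Nat.one_le_iff_ne_zero.2 (Finsupp.mem_support_iff.1 hk))
          have hd := congrArg Finsupp.degree (tsub_add_cancel_of_le hk')
          rw [map_add, Finsupp.degree_single] at hd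
          have hd0 : b - Finsupp.single k 1 = 0 := (Finsupp.degree_eq_zero_iff _).1 (by omega)
          exact ⟨k, by rw [← tsub_add_cancel_of_le hk', hd0, zero_add]⟩
        rw [hk, partWeight_single, one_mul] at hb
        rw [hk, ← hb, PNat.coe_toPNat']
      · rw [map_add, Finset.sum_insert hj]
        exact add_le_add (hb ▸ excess_le k b) (h3 k)
    · rw [coeff_mul]
      refine Finset.sum_pos' (fun x _ => mul_nonneg (hc _) (ih1 _))
        ⟨(Finsupp.single (α j).toPNat' 1, ∑ i ∈ s, Finsupp.single (α i).toPNat' 1),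
          Finset.HasAntidiagonal.mem_antidiagonal.2 rfl, mul_pos ?_ ih3⟩
      rw [coeff_complete, partWeight_single, one_mul, Nat.toPNat'_coe, if_pos hαj, if_pos rfl]
      exact inv_pos.2 (Nat.cast_pos.2 (Nat.pos_of_ne_zero (zFactor_ne_zero _)))

section

variable {K : Type*} [Field K] [CharZero K]

lemma coeff_completeRow_eq (lam : YoungDiagram) (a : ℕ+ →₀ ℕ) :
    coeff a (completeRow K lam) = ((coeff a (completeRow ℚ lam) : ℚ) : K) := by
  rw [← completeRow_map (Rat.castHom K), coeff_map]
  rfl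

lemma coeff_completeRow_ne_zero_iff (lam : YoungDiagram) (a : ℕ+ →₀ ℕ) :
    coeff a (completeRow K lam) ≠ 0 ↔ coeff a (completeRow ℚ lam) ≠ 0 := by
  rw [coeff_completeRow_eq, Ne, Rat.cast_eq_zero]

lemma colLen_le_degree {lam : YoungDiagram} {a : ℕ+ →₀ ℕ} (h : coeff a (completeRow K lam) ≠ 0) :
    lam.colLen 0 ≤ a.degree := by
  rw [coeff_completeRow_ne_zero_iff, completeRow_eq] at h
  simpa using ((coeff_prod_complete lam.rowLen (Finset.range (lam.colLen 0))
    fun i hi => rowLen_pos (Finset.mem_range.1 hi)).2.1 a h).1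

lemma eq_rowContent {lam : YoungDiagram} {a : ℕ+ →₀ ℕ} (h : coeff a (completeRow K lam) ≠ 0)
    (ha : a.degree = lam.colLen 0) : a = rowContent lam := by
  rw [coeff_completeRow_ne_zero_iff, completeRow_eq] at h
  exact ((coeff_prod_complete lam.rowLen (Finset.range (lam.colLen 0))
    fun i hi => rowLen_pos (Finset.mem_range.1 hi)).2.1 a h).2.1 (by simpa using ha)

lemma coeff_rowContent_ne_zero (lam : YoungDiagram) :
    coeff (rowContent lam) (completeRow K lam) ≠ 0 := by
  rw [coeff_completeRow_ne_zero_iff, completeRow_eq]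
  exact (coeff_prod_complete lam.rowLen (Finset.range (lam.colLen 0))
    fun i hi => rowLen_pos (Finset.mem_range.1 hi)).2.2.ne'

/-- This bound holds at every level c, and `sum_rowLen_eq_excess` shows that it is attained at c =
`lam.rowLen k`. Comparing excesses at all levels therefore compares partial sums of rows. -/
lemma sum_rowLen_le_excess (c k : ℕ) (lam : YoungDiagram) :
    ∑ i ∈ Finset.range k, lam.rowLen i ≤ k * c + excess c (rowContent lam) := by
  have h1 : ∑ i ∈ Finset.range k, (lam.rowLen i - c) ≤ excess c (rowContent lam) := by
    rw [excess_rowContent]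
    refine Finset.sum_le_sum_of_ne_zero fun i _ hi => ?_
    rw [Finset.mem_range]
    by_contra h
    exact hi (by rw [rowLen_eq_zero (not_lt.1 h), Nat.zero_sub])
  calc ∑ i ∈ Finset.range k, lam.rowLen i ≤ ∑ i ∈ Finset.range k, (c + (lam.rowLen i - c)) :=
        Finset.sum_le_sum fun i _ => by omega
    _ = k * c + ∑ i ∈ Finset.range k, (lam.rowLen i - c) := by
        rw [Finset.sum_add_distrib, Finset.sum_const, Finset.card_range, smul_eq_mul]
    _ ≤ _ := by omega

lemma sum_rowLen_eq_excess (k : ℕ) (lam : YoungDiagram) :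
    ∑ i ∈ Finset.range k, lam.rowLen i =
      k * lam.rowLen k + excess (lam.rowLen k) (rowContent lam) := by
  have h1 : ∑ i ∈ Finset.range k, (lam.rowLen i - lam.rowLen k) =
      excess (lam.rowLen k) (rowContent lam) := by
    rw [excess_rowContent]
    have h2 : ∀ M, k ≤ M → lam.colLen 0 ≤ M → ∑ i ∈ Finset.range (lam.colLen 0),
        (lam.rowLen i - lam.rowLen k) = ∑ i ∈ Finset.range M, (lam.rowLen i - lam.rowLen k) := by
      intro M _ hM
      refine Finset.sum_subset (Finset.range_subset_range.2 hM) fun i _ hi => ?_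
      rw [rowLen_eq_zero (by simpa using hi), Nat.zero_sub]
    rw [h2 (max k (lam.colLen 0)) (le_max_left _ _) (le_max_right _ _)]
    refine Finset.sum_subset (Finset.range_subset_range.2 (le_max_left _ _)) fun i _ hi => ?_
    have := lam.rowLen_anti k i (by simpa using hi)
    omega
  rw [← h1]
  calc ∑ i ∈ Finset.range k, lam.rowLen i =
        ∑ i ∈ Finset.range k, (lam.rowLen k + (lam.rowLen i - lam.rowLen k)) :=
        Finset.sum_congr rfl fun i hi => by
          have := lam.rowLen_anti i k (Finset.mem_range.1 hi).le
          omega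
    _ = _ := by rw [Finset.sum_add_distrib, Finset.sum_const, Finset.card_range, smul_eq_mul]

/-- If p_λ occurs in h_μ, then λ arises by splitting rows of μ, so its excess at each level
`μ.rowLen k` is at most that of μ. -/
lemma domLE_of_coeff_rowContent {lam μ : YoungDiagram}
    (h : coeff (rowContent lam) (completeRow K μ) ≠ 0) : DomLE lam μ := by
  have hw := mem_degreePart.1 (completeRow_mem K μ) _ h
  rw [partWeight_rowContent] at hw
  refine ⟨hw, fun k => ?_⟩
  rw [coeff_completeRow_ne_zero_iff, completeRow_eq] at h
  have h1 := ((coeff_prod_complete μ.rowLen (Finset.range (μ.colLen 0))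
    fun i hi => rowLen_pos (Finset.mem_range.1 hi)).2.1 _ h).2.2 (μ.rowLen k)
  rw [← excess_rowContent] at h1
  rw [sum_rowLen_eq_excess k μ]
  exact (sum_rowLen_le_excess (μ.rowLen k) k lam).trans (by omega)

/-! ### Spanning by products of complete functions, in a fixed degree. -/

/-- The partitions of `n`. -/
lemma finite_card_eq (n : ℕ) : {lam : YoungDiagram | lam.card = n}.Finite := by
  have : {lam : YoungDiagram | lam.card = n} ⊆ YoungDiagram.cells ⁻¹'
      ((Finset.range n ×ˢ Finset.range n).powerset : Set (Finset (ℕ × ℕ))) := by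
    intro lam hlam
    simp only [Set.mem_preimage, Finset.mem_coe, Finset.mem_powerset]
    rintro ⟨i, j⟩ hij
    have hij' : (i, j) ∈ lam := hij
    have h1 : lam.rowLen i ≤ lam.card := by
      rw [YoungDiagram.rowLen_eq_card]
      exact Finset.card_le_card (Finset.filter_subset _ _)
    have h2 : lam.colLen j ≤ lam.card := by
      rw [YoungDiagram.colLen_eq_card]
      exact Finset.card_le_card (Finset.filter_subset _ _)
    have h3 := YoungDiagram.mem_iff_lt_rowLen.1 hij'
    have h4 := YoungDiagram.mem_iff_lt_colLen.1 hij'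
    have h5 : lam.card = n := hlam
    simp only [Finset.mem_product, Finset.mem_range]
    omega
  refine Set.Finite.subset (Set.Finite.preimage ?_ (Finset.finite_toSet _)) this
  intro a _ b _ hab
  exact YoungDiagram.ext hab

/-- The finite set of partitions of `n`. -/
def diagrams (n : ℕ) : Finset YoungDiagram := (finite_card_eq n).toFinset

lemma mem_diagrams {n : ℕ} {lam : YoungDiagram} : lam ∈ diagrams n ↔ lam.card = n := by
  simp [diagrams]

lemma degree_le_partWeight (a : ℕ+ →₀ ℕ) : a.degree ≤ partWeight a := by
  rw [Finsupp.degree_apply, partWeight, Finsupp.weight_apply, Finsupp.sum]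
  exact Finset.sum_le_sum fun k _ => Nat.le_mul_of_pos_right _ k.pos

/-- The products `∏ h_{lam_i}` span the symmetric functions of degree `n`. -/
lemma degreePart_le_span (n : ℕ) :
    degreePart K n ≤ Submodule.span K (completeRow K '' (diagrams n : Set YoungDiagram)) := by
  classical
  -- Induction on n minus the number of parts: besides p_λ, the product h_λ involves only power
  -- products with more parts.
  have key : ∀ d : ℕ, ∀ a : ℕ+ →₀ ℕ, partWeight a = n → n - a.degree ≤ d → monomial a (1 : K) ∈
      Submodule.span K (completeRow K '' (diagrams n : Set YoungDiagram)) := by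
    intro d
    induction d using Nat.strong_induction_on with
    | _ d ih =>
      intro a ha hd
      obtain ⟨lam, rfl⟩ := rowContent_surjective a
      have hcard : lam.card = n := by rw [← partWeight_rowContent, ha]
      have h0 := coeff_rowContent_ne_zero (K := K) lam
      have hdec : completeRow K lam = monomial (rowContent lam) (coeff (rowContent lam)
          (completeRow K lam)) + ∑ b ∈ (completeRow K lam).support.erase (rowContent lam),
            monomial b (coeff b (completeRow K lam)) := by
        rw [Finset.add_sum_erase _ (fun b => monomial b (coeff b (completeRow K lam)))
          (mem_support_iff.2 h0)]
        exact (completeRow K lam).as_sum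
      have hmem : monomial (rowContent lam) (coeff (rowContent lam) (completeRow K lam)) ∈
          Submodule.span K (completeRow K '' (diagrams n : Set YoungDiagram)) := by
        rw [eq_sub_of_add_eq hdec.symm]
        refine sub_mem (Submodule.subset_span ⟨lam, mem_diagrams.2 hcard, rfl⟩)
          (sum_mem fun b hb => ?_)
        obtain ⟨hb1, hb2⟩ := Finset.mem_erase.1 hb
        have hb3 := mem_support_iff.1 hb2
        have hb4 := mem_degreePart.1 (completeRow_mem K lam) b hb3
        rw [hcard] at hb4
        have hb5 := colLen_le_degree hb3
        have hb6 : b.degree ≠ lam.colLen 0 := fun h => hb1 (eq_rowContent hb3 h)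
        have hb7 := degree_le_partWeight b
        rw [degree_rowContent] at hd
        have := ih (d - 1) (by omega) b hb4 (by omega)
        simpa [smul_monomial] using Submodule.smul_mem _ (coeff b (completeRow K lam)) this
      simpa [smul_monomial, h0] using
        Submodule.smul_mem _ (coeff (rowContent lam) (completeRow K lam))⁻¹ hmem
  intro f hf
  rw [f.as_sum]
  refine sum_mem fun a ha => ?_
  have := key _ a (mem_degreePart.1 hf a (mem_support_iff.1 ha)) le_rfl
  simpa [smul_monomial] using Submodule.smul_mem _ (coeff a f) this

/-! ### Triangular duality between Schur functions and products of complete functions. -/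

lemma hall_schur_completeRow_self (lam : YoungDiagram) :
    hall (schur K lam) (completeRow K lam) = 1 := hall_schur_self lam

lemma domLE_of_hall_ne_zero {lam μ : YoungDiagram}
    (h : hall (schur K lam) (completeRow K μ) ≠ 0) : DomLE μ lam := domLE_of_hall_schur_ne_zero h

lemma hall_eq_zero_of_forall {n : ℕ} {f : Sym K}
    (hf : ∀ μ, μ.card = n → hall f (completeRow K μ) = 0) {g : Sym K} (hg : g ∈ degreePart K n) :
    hall f g = 0 := by
  refine scalar_eq_zero_of_span 0 0 f _ ?_ (degreePart_le_span n hg)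
  rintro _ ⟨μ, hμ, rfl⟩
  exact hf μ (mem_diagrams.1 hμ)

lemma eq_zero_of_hall_eq_zero {n : ℕ} {f : Sym K} (hf : f ∈ degreePart K n)
    (h : ∀ μ, μ.card = n → hall f (completeRow K μ) = 0) : f = 0 := by
  ext a
  rw [coeff_zero]
  by_contra ha
  have h1 : (monomial a (1 : K)) ∈ degreePart K n := by
    rw [degreePart, mem_weightedHomogeneousSubmodule]
    exact isWeightedHomogeneous_monomial _ _ _ (mem_degreePart.1 hf a ha)
  have h2 := hall_eq_zero_of_forall h h1
  rw [hall, scalar_comm, ← hall, hall_monomial_left, one_mul] at h2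
  exact mul_ne_zero ha (zFactor_cast_ne_zero a) h2

/-- Let m be maximal in L for dominance. Subtracting ⟨f, h_m⟩ S_m kills the pairing with h_m and, L
being a lower set, leaves the vanishing pairings outside L intact; then L loses m. -/
lemma mem_span_schur {n : ℕ} (L : Finset YoungDiagram) (hL : ∀ μ ∈ L, μ.card = n)
    (hlow : ∀ μ ∈ L, ∀ ν, DomLE ν μ → ν ∈ L) {f : Sym K} (hf : f ∈ degreePart K n)
    (h : ∀ μ, μ.card = n → μ ∉ L → hall f (completeRow K μ) = 0) :
    f ∈ Submodule.span K (schur K '' (L : Set YoungDiagram)) := by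
  classical
  induction hN : L.card using Nat.strong_induction_on generalizing L f with
  | _ N ih =>
    rcases L.eq_empty_or_nonempty with rfl | hne
    · rw [eq_zero_of_hall_eq_zero hf fun μ hμ => h μ hμ (Finset.notMem_empty _)]
      exact zero_mem _
    · obtain ⟨m, hm, hmax⟩ : ∃ m ∈ L, ∀ x ∈ L, ¬ DomLT m x := by
        let r : L → L → Prop := fun x y => DomLT y x
        have : IsTrans L r := ⟨fun a b c hab hbc => DomLT.trans hbc hab⟩
        have : Std.Irrefl r := ⟨fun a h => h.1 rfl⟩
        obtain ⟨m, -, hm⟩ := (Finite.wellFounded_of_trans_of_irrefl r).has_min Set.univ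
          (hne.to_subtype.elim fun x => ⟨x, trivial⟩)
        exact ⟨m, m.2, fun x hx => hm ⟨x, hx⟩ trivial⟩
      set c := hall f (completeRow K m) with hc
      have hg : f - c • schur K m ∈
          Submodule.span K (schur K '' (L.erase m : Set YoungDiagram)) := by
        refine ih _ (hN ▸ Finset.card_erase_lt_of_mem hm) (L.erase m)
          (fun μ hμ => hL μ (Finset.mem_of_mem_erase hμ)) ?_ ?_ ?_ rfl
        · intro μ hμ ν hν
          refine Finset.mem_erase.2 ⟨?_, hlow μ (Finset.mem_of_mem_erase hμ) ν hν⟩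
          rintro rfl
          rcases domLE_iff.1 hν with rfl | h'
          · exact Finset.notMem_erase _ _ hμ
          · exact hmax μ (Finset.mem_of_mem_erase hμ) h'
        · exact sub_mem hf (Submodule.smul_mem _ _ (hL m hm ▸ schur_mem m))
        · intro μ hμ hμL
          rw [hall, scalar_sub_left, scalar_smul_left, ← hall, ← hall]
          by_cases hμm : μ = m
          · rw [hμm, hall_schur_completeRow_self, mul_one, ← hc, sub_self]
          · have hμL' : μ ∉ L := fun h' => hμL (Finset.mem_erase.2 ⟨hμm, h'⟩)
            rw [h μ hμ hμL', zero_sub, neg_eq_zero]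
            refine mul_eq_zero_of_right _ ?_
            by_contra hne'
            exact hμL' (hlow m hm μ (domLE_of_hall_ne_zero hne'))
      have h1 : f = (f - c • schur K m) + c • schur K m := by ring
      rw [h1]
      refine add_mem (Submodule.span_mono (Set.image_mono ?_) hg)
        (Submodule.smul_mem _ _ (Submodule.subset_span ⟨m, hm, rfl⟩))
      exact_mod_cast Finset.erase_subset m L

/-- Pairing an expansion with S_μ sees only the h_ν with ν dominated by μ, and h_μ with coefficient
1. Going up along dominance within L, each coefficient must vanish. -/
lemma exists_eq_sum_completeRow {n : ℕ} (L : Finset YoungDiagram)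
    (hlow : ∀ μ ∈ L, ∀ ν, DomLE ν μ → ν ∈ L) {f : Sym K} (hf : f ∈ degreePart K n)
    (h : ∀ μ ∈ L, hall f (schur K μ) = 0) :
    ∃ y : YoungDiagram → K, (∀ μ ∈ L, y μ = 0) ∧
      f = ∑ μ ∈ diagrams n, y μ • completeRow K μ := by
  classical
  obtain ⟨y, hy⟩ := (Submodule.mem_span_image_finset_iff_exists_fun' K).1 (degreePart_le_span n hf)
  have h0 : ∀ μ, μ ∈ L → μ ∈ diagrams n → y μ = 0 := by
    intro μ
    induction μ using domLT_wf.induction with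
    | _ μ ih =>
      intro hμ hμn
      have h1 := h μ hμ
      rw [← hy, hall, scalar_sum_left, Finset.sum_eq_single μ] at h1
      · rw [scalar_smul_left, scalar_comm, ← hall, hall_schur_completeRow_self, mul_one] at h1
        exact h1
      · intro ν hν hne
        rw [scalar_smul_left, scalar_comm, ← hall]
        by_contra h2
        rcases domLE_iff.1 (domLE_of_hall_ne_zero (right_ne_zero_of_mul h2)) with h3 | h3
        · exact hne h3
        · exact left_ne_zero_of_mul h2 (ih ν h3 (hlow μ hμ ν h3.le) hν)
      · exact fun h2 => absurd hμn h2
  refine ⟨fun μ => if μ ∈ L then 0 else y μ, fun μ hμ => if_pos hμ, ?_⟩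
  rw [← hy]
  refine Finset.sum_congr rfl fun μ hμ => ?_
  dsimp only
  split_ifs with hμL
  · rw [h0 μ hμL hμ]
  · rfl

end

/-! ## Macdonald polynomials from the Gram matrix of the products `∏ h_{μ_i}` -/

lemma DomLE.antisymm {a b : YoungDiagram} (h : DomLE a b) (h' : DomLE b a) : a = b := by
  have hsum : ∀ k, ∑ i ∈ Finset.range k, a.rowLen i = ∑ i ∈ Finset.range k, b.rowLen i :=
    fun k => le_antisymm (h.2 k) (h'.2 k)
  refine eq_of_rowLen_eq fun k => ?_
  have h1 := hsum (k + 1)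
  rw [Finset.sum_range_succ, Finset.sum_range_succ, hsum k] at h1
  omega

section

variable {K : Type*} [Field K]

/-- The substitution `p_k ↦ c_k p_k`. -/
def rescale (c : ℕ+ → K) : Sym K →ₐ[K] Sym K := aeval fun k => C (c k) * X k

lemma rescale_monomial (c : ℕ+ → K) (a : ℕ+ →₀ ℕ) (r : K) :
    rescale c (monomial a r) = monomial a ((a.prod fun k m => c k ^ m) * r) := by
  rw [rescale, aeval_monomial, algebraMap_eq, mul_comm (a.prod _) r, ← C_mul_monomial]
  congr 1
  rw [monomial_eq]
  simp only [mul_pow, Finsupp.prod_mul, ← C_pow]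
  congr 1
  simp only [Finsupp.prod, map_prod]

lemma coeff_rescale (c : ℕ+ → K) (f : Sym K) (a : ℕ+ →₀ ℕ) :
    coeff a (rescale c f) = (a.prod fun k m => c k ^ m) * coeff a f := by
  classical
  induction f using MvPolynomial.induction_on' with
  | monomial b r =>
    rw [rescale_monomial, coeff_monomial, coeff_monomial]
    split_ifs with h
    · rw [h]
    · rw [mul_zero]
  | add p q hp hq => rw [map_add, coeff_add, coeff_add, hp, hq, mul_add]

lemma rescale_mem {n : ℕ} (c : ℕ+ → K) {f : Sym K} (hf : f ∈ degreePart K n) :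
    rescale c f ∈ degreePart K n := by
  rw [mem_degreePart] at hf ⊢
  intro a ha
  rw [coeff_rescale] at ha
  exact hf a (right_ne_zero_of_mul ha)

/-- The substitution `p_k ↦ (1 - t ^ k) / (1 - q ^ k) p_k`. -/
def dualize (q t : K) : Sym K →ₐ[K] Sym K :=
  rescale fun k => (1 - t ^ (k : ℕ)) / (1 - q ^ (k : ℕ))

/-- The rescaling factors are inverse to the ratios in the (q, t)-norm, so only the Hall norm is
left. -/
lemma scalar_dualize_left {q t : K} (hq : ∀ k : ℕ, 0 < k → q ^ k ≠ 1)
    (ht : ∀ k : ℕ, 0 < k → t ^ k ≠ 1) (f g : Sym K) :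
    scalar q t (dualize q t f) g = hall f g := by
  induction f using MvPolynomial.induction_on' with
  | monomial a r =>
    rw [dualize, rescale_monomial, scalar_monomial_left, hall_monomial_left, powerNorm_eq]
    have : (a.prod fun k m => ((1 - t ^ (k : ℕ)) / (1 - q ^ (k : ℕ))) ^ m) *
        (a.prod fun k m => ((1 - q ^ (k : ℕ)) / (1 - t ^ (k : ℕ))) ^ m) = 1 := by
      rw [← Finsupp.prod_mul]
      refine Finset.prod_eq_one fun k _ => ?_
      dsimp only
      rw [← mul_pow, div_mul_div_comm, mul_comm, div_self, one_pow]
      exact mul_ne_zero (sub_ne_zero.2 (hq k k.pos).symm) (sub_ne_zero.2 (ht k k.pos).symm)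
    linear_combination (r * coeff a g * zFactor a) * this
  | add p q hp hq =>
    rw [map_add, scalar_add_left, hp, hq, hall, hall, hall, scalar_add_left]

/-- Here the same factors are not cancelled; they multiply the Hall norm and produce the norm with
the two parameters exchanged. This is why the Gram matrices below use the exchanged pairing. -/
lemma hall_dualize_left (q t : K) (f g : Sym K) : hall (dualize q t f) g = scalar t q f g := by
  induction f using MvPolynomial.induction_on' with
  | monomial a r =>
    rw [dualize, rescale_monomial, scalar_monomial_left, hall_monomial_left, powerNorm_eq]
    ring
  | add p q hp hq =>
    rw [map_add, scalar_add_left, ← hp, ← hq, hall, hall, hall, scalar_add_left]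

lemma dualize_dualize {q t : K} (hq : ∀ k : ℕ, 0 < k → q ^ k ≠ 1)
    (ht : ∀ k : ℕ, 0 < k → t ^ k ≠ 1) (f : Sym K) : dualize q t (dualize t q f) = f := by
  ext a
  rw [dualize, dualize, coeff_rescale, coeff_rescale, ← mul_assoc, ← Finsupp.prod_mul]
  convert! one_mul _
  refine Finset.prod_eq_one fun k _ => ?_
  dsimp only
  rw [← mul_pow, div_mul_div_comm, mul_comm, div_self, one_pow]
  exact mul_ne_zero (sub_ne_zero.2 (hq k k.pos).symm) (sub_ne_zero.2 (ht k k.pos).symm)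

variable [CharZero K]

/-- All principal Gram matrices of the products `∏ h_{μ_i}`, `μ ⊢ n`, for the pairing with `q` and
`t` exchanged, are nondegenerate. -/
def GramNondegenerate (q t : K) (n : ℕ) : Prop :=
  ∀ U ⊆ diagrams n, ∀ y : YoungDiagram → K,
    (∀ μ ∈ U, ∑ ν ∈ U, y ν * scalar t q (completeRow K ν) (completeRow K μ) = 0) →
      ∀ μ ∈ U, y μ = 0

open Classical in
/-- The partitions of `n` not dominated by `lam`. -/
def notBelow (n : ℕ) (lam : YoungDiagram) : Finset YoungDiagram :=
  (diagrams n).filter fun μ => ¬ DomLE μ lam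

lemma mem_notBelow {n : ℕ} {lam μ : YoungDiagram} :
    μ ∈ notBelow n lam ↔ μ.card = n ∧ ¬ DomLE μ lam := by
  classical
  rw [notBelow, Finset.mem_filter, mem_diagrams]

lemma hall_eq_zero_of_mem_span_schur {L : Finset YoungDiagram}
    (hlow : ∀ μ ∈ L, ∀ ν, DomLE ν μ → ν ∈ L) {f : Sym K}
    (hf : f ∈ Submodule.span K (schur K '' (L : Set YoungDiagram))) {ν : YoungDiagram}
    (hν : ν ∉ L) : hall f (completeRow K ν) = 0 := by
  rw [hall, scalar_comm]
  refine scalar_eq_zero_of_span 0 0 _ _ ?_ hf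
  rintro _ ⟨μ, hμ, rfl⟩
  rw [scalar_comm]
  by_contra h
  exact hν (hlow μ hμ ν (domLE_of_hall_ne_zero h))

/-- Rescaled, f is a combination of the h_μ with μ outside L, by orthogonality to the Schur
functions of L. As f lies in their span, it is Hall-orthogonal to those same h_μ, so the
coefficients lie in the kernel of a Gram matrix. -/
lemma eq_zero_of_orthogonal {q t : K} (hq : ∀ k : ℕ, 0 < k → q ^ k ≠ 1)
    (ht : ∀ k : ℕ, 0 < k → t ^ k ≠ 1) {n : ℕ} (hG : GramNondegenerate q t n)
    (L : Finset YoungDiagram) (hL : ∀ μ ∈ L, μ.card = n)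
    (hlow : ∀ μ ∈ L, ∀ ν, DomLE ν μ → ν ∈ L) {f : Sym K}
    (hf : f ∈ Submodule.span K (schur K '' (L : Set YoungDiagram)))
    (h : ∀ μ ∈ L, scalar q t f (schur K μ) = 0) : f = 0 := by
  classical
  have hfn : f ∈ degreePart K n := by
    refine (Submodule.span_le.2 ?_ : Submodule.span K _ ≤ _) hf
    rintro _ ⟨μ, hμ, rfl⟩
    exact hL μ hμ ▸ schur_mem μ
  have hmem : dualize t q f ∈ degreePart K n := rescale_mem _ hfn
  obtain ⟨y, hy0, hy⟩ := exists_eq_sum_completeRow L hlow hmem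
    fun μ hμ => by rw [← scalar_dualize_left hq ht, dualize_dualize hq ht, h μ hμ]
  have hy' : dualize t q f = ∑ μ ∈ diagrams n \ L, y μ • completeRow K μ := by
    rw [hy]
    refine (Finset.sum_subset Finset.sdiff_subset fun μ hμ hμ' => ?_).symm
    rw [Finset.mem_sdiff, not_and, not_not] at hμ'
    rw [hy0 μ (hμ' hμ), zero_smul]
  have h0 := hG (diagrams n \ L) Finset.sdiff_subset y fun μ hμ => by
    have h1 := hall_eq_zero_of_mem_span_schur hlow hf (Finset.mem_sdiff.1 hμ).2
    rw [← dualize_dualize hq ht f, hall_dualize_left, hy', scalar_sum_left] at h1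
    simpa only [scalar_smul_left] using h1
  rw [← dualize_dualize hq ht f, hy', Finset.sum_eq_zero, map_zero]
  intro μ hμ
  rw [h0 μ hμ, zero_smul]

/-- The dual Macdonald polynomial in terms of a solution of the Gram system. -/
theorem macdonaldQ_eq {q t : K} (hq : ∀ k : ℕ, 0 < k → q ^ k ≠ 1)
    (ht : ∀ k : ℕ, 0 < k → t ^ k ≠ 1) {n : ℕ} (hG : GramNondegenerate q t n) (lam : YoungDiagram)
    (hlam : lam.card = n) (y : YoungDiagram → K)
    (hy : ∀ μ ∈ notBelow n lam, scalar t q (completeRow K lam +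
      ∑ ν ∈ notBelow n lam, y ν • completeRow K ν) (completeRow K μ) = 0) :
    macdonaldQ q t lam = dualize q t (completeRow K lam +
      ∑ ν ∈ notBelow n lam, y ν • completeRow K ν) := by
  classical
  set N := completeRow K lam + ∑ ν ∈ notBelow n lam, y ν • completeRow K ν with hN
  set Q := dualize q t N with hQ
  have hNn : N ∈ degreePart K n := by
    refine add_mem (hlam ▸ completeRow_mem K lam) (sum_mem fun ν hν => Submodule.smul_mem _ _ ?_)
    exact (mem_notBelow.1 hν).1 ▸ completeRow_mem K ν
  -- pairings with Schur functions
  have hpair : ∀ μ, DomLE μ lam → scalar q t Q (schur K μ) = if μ = lam then 1 else 0 := by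
    intro μ hμ
    rw [hQ, scalar_dualize_left hq ht, hN, hall, scalar_add_left, scalar_sum_left,
      Finset.sum_eq_zero, add_zero, scalar_comm, ← hall]
    · split_ifs with h
      · rw [h, hall_schur_completeRow_self]
      · by_contra h'
        exact h (hμ.antisymm (domLE_of_hall_ne_zero h'))
    · intro ν hν
      rw [scalar_smul_left, scalar_comm, ← hall]
      refine mul_eq_zero_of_right _ ?_
      by_contra h'
      exact (mem_notBelow.1 hν).2 ((domLE_of_hall_ne_zero h').trans hμ)
  let L : Finset YoungDiagram := (diagrams n).filter fun μ => DomLE μ lam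
  let L' : Finset YoungDiagram := (diagrams n).filter fun μ => DomLT μ lam
  have hLmem : ∀ μ, μ ∈ L ↔ DomLE μ lam := fun μ => by
    simp only [L, Finset.mem_filter, mem_diagrams, and_iff_right_iff_imp]
    exact fun h => h.1.trans hlam
  have hLmem' : ∀ μ, μ ∈ L' ↔ DomLT μ lam := fun μ => by
    simp only [L', Finset.mem_filter, mem_diagrams, and_iff_right_iff_imp]
    exact fun h => h.2.1.trans hlam
  have hspan' : Submodule.span K {g | ∃ μ, DomLT μ lam ∧ g = schur K μ} =
      Submodule.span K (schur K '' (L' : Set YoungDiagram)) := by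
    congr 1
    ext g
    simp only [Set.mem_image, Finset.mem_coe, hLmem']
    exact ⟨fun ⟨μ, h, e⟩ => ⟨μ, h, e.symm⟩, fun ⟨μ, h, e⟩ => ⟨μ, h, e.symm⟩⟩
  have hzero : ∀ f ∈ Submodule.span K {g | ∃ μ, DomLT μ lam ∧ g = schur K μ},
      (∀ μ, DomLT μ lam → scalar q t f (schur K μ) = 0) → f = 0 := by
    intro f hf h
    refine eq_zero_of_orthogonal hq ht hG L' (fun μ hμ => ((hLmem' μ).1 hμ).2.1.trans hlam)
      (fun μ hμ ν hν => ?_) (hspan' ▸ hf) fun μ hμ => h μ ((hLmem' μ).1 hμ)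
    rw [hLmem'] at hμ ⊢
    rcases domLE_iff.1 hν with rfl | h'
    · exact hμ
    · exact h'.trans hμ
  -- The Hall pairing of Q with h_μ is the exchanged pairing of N with h_μ, which the linear system
  -- makes zero for μ not dominated by λ.
  have hQspan : Q ∈ Submodule.span K (schur K '' (L : Set YoungDiagram)) := by
    refine mem_span_schur L (fun μ hμ => ((hLmem μ).1 hμ).1.trans hlam)
      (fun μ hμ ν hν => (hLmem ν).2 (hν.trans ((hLmem μ).1 hμ))) (rescale_mem _ hNn)
      fun μ hμ hμL => ?_
    rw [hQ, hall_dualize_left]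
    exact hy μ (mem_notBelow.2 ⟨hμ, fun h => hμL ((hLmem μ).2 h)⟩)
  obtain ⟨κ, r, hr, hκ⟩ : ∃ κ : K, ∃ r ∈ Submodule.span K
      {g | ∃ μ, DomLT μ lam ∧ g = schur K μ}, Q = κ • schur K lam + r := by
    have hins : schur K '' (L : Set YoungDiagram) =
        insert (schur K lam) {g | ∃ μ, DomLT μ lam ∧ g = schur K μ} := by
      ext g
      simp only [Set.mem_image, Finset.mem_coe, hLmem, Set.mem_insert_iff, Set.mem_ofPred_eq,
        domLE_iff]
      constructor
      · rintro ⟨μ, rfl | h, rfl⟩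
        · exact Or.inl rfl
        · exact Or.inr ⟨μ, h, rfl⟩
      · rintro (rfl | ⟨μ, h, rfl⟩)
        · exact ⟨lam, Or.inl rfl, rfl⟩
        · exact ⟨μ, Or.inr h, rfl⟩
    rw [hins, Submodule.mem_span_insert] at hQspan
    exact hQspan
  have hlow : ∀ μ, DomLT μ lam → scalar q t Q (schur K μ) = 0 := fun μ hμ => by
    rw [hpair μ hμ.le, if_neg hμ.1]
  have hself : scalar q t Q (schur K lam) = 1 := by rw [hpair lam (DomLE.refl _), if_pos rfl]
  -- Without leading term, Q would lie in a span to which it is orthogonal, hence vanish, although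
  -- it pairs to 1 with S_λ.
  have hκ0 : κ ≠ 0 := by
    rintro rfl
    rw [zero_smul, zero_add] at hκ
    have h0 := hzero Q (hκ ▸ hr) hlow
    rw [h0, scalar_zero_left] at hself
    exact zero_ne_one hself
  have hP : IsMacdonaldP q t lam (κ⁻¹ • Q) := by
    refine ⟨?_, fun μ hμ => by rw [scalar_smul_left, hlow μ hμ, mul_zero]⟩
    rw [hκ, smul_add, smul_smul, inv_mul_cancel₀ hκ0, one_smul, add_sub_cancel_left]
    exact Submodule.smul_mem _ _ hr
  have hPeq : macdonaldP q t lam = κ⁻¹ • Q := by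
    have huniq : ∃! f, IsMacdonaldP q t lam f := by
      refine ⟨_, hP, fun f hf => ?_⟩
      rw [← sub_eq_zero]
      refine hzero _ ?_ fun μ hμ => by rw [scalar_sub_left, hf.2 μ hμ, hP.2 μ hμ, sub_zero]
      have := sub_mem hf.1 hP.1
      rwa [sub_sub_sub_cancel_right] at this
    rw [macdonaldP, dif_pos huniq]
    exact huniq.unique huniq.choose_spec.1 hP
  -- As P = κ⁻¹ Q, this gives ⟨P, P⟩ = κ⁻¹, and the normalization P / ⟨P, P⟩ returns Q.
  have hQQ : scalar q t Q Q = κ := by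
    conv_lhs => rw [show scalar q t Q Q = scalar q t Q (κ • schur K lam + r) by rw [← hκ]]
    rw [scalar_add_right, scalar_smul_right, hself, mul_one]
    have : scalar q t Q r = 0 := scalar_eq_zero_of_span q t Q _
      (by rintro _ ⟨μ, hμ, rfl⟩; exact hlow μ hμ) hr
    rw [this, add_zero]
  rw [macdonaldQ, hPeq, scalar_smul_left, scalar_smul_right, hQQ, ← smul_eq_C_mul, smul_smul,
    inv_mul_cancel₀ hκ0, mul_one, inv_inv, mul_inv_cancel₀ hκ0, one_smul]

end

/-! ## Rational functions regular at a point -/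

section Regular

universe u

variable {F L : Type u} [Field F] [Field L] (f : F →+* L) (a : L)

/-- The ring of rational functions without pole at `a`. -/
def regularAt : Subring (RatFunc F) where
  carrier := {x | Polynomial.eval₂ f a x.denom ≠ 0}
  mul_mem' {x y} hx hy h := by
    have := Polynomial.eval₂_eq_zero_of_dvd_of_eval₂_eq_zero f a (RatFunc.denom_mul_dvd x y) h
    rw [Polynomial.eval₂_mul] at this
    exact (mul_ne_zero hx hy) this
  one_mem' := by simp
  add_mem' {x y} hx hy h := by
    have := Polynomial.eval₂_eq_zero_of_dvd_of_eval₂_eq_zero f a (RatFunc.denom_add_dvd x y) h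
    rw [Polynomial.eval₂_mul] at this
    exact (mul_ne_zero hx hy) this
  zero_mem' := by simp
  neg_mem' {x} hx h := by
    have h1 : RatFunc.denom (-x) ∣ RatFunc.denom x := by
      have h2 := RatFunc.denom_mul_dvd (RatFunc.C (-1)) x
      rwa [RatFunc.denom_C, one_mul, map_neg, map_one, neg_one_mul] at h2
    exact hx (Polynomial.eval₂_eq_zero_of_dvd_of_eval₂_eq_zero f a h1 h)

variable {f a}

lemma mem_regularAt {x : RatFunc F} : x ∈ regularAt f a ↔ Polynomial.eval₂ f a x.denom ≠ 0 :=
  Iff.rfl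

variable (f a) in
/-- Evaluation at a point. -/
def evalAt : regularAt f a →+* L where
  toFun x := RatFunc.eval f a x
  map_one' := RatFunc.eval_one f a
  map_mul' x y := RatFunc.eval_mul f a x.2 y.2
  map_zero' := RatFunc.eval_zero f a
  map_add' x y := RatFunc.eval_add f a x.2 y.2

lemma inv_mem_regularAt {x : RatFunc F} (hx : RatFunc.eval f a x ≠ 0) : x⁻¹ ∈ regularAt f a := by
  have hx0 : x ≠ 0 := by
    rintro rfl
    exact hx (RatFunc.eval_zero f a)
  intro h
  have := Polynomial.eval₂_eq_zero_of_dvd_of_eval₂_eq_zero f a (RatFunc.denom_inv_dvd hx0) h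
  exact hx (by rw [RatFunc.eval, this, zero_div])

/-- A nonzero value already implies regularity, because `RatFunc.eval` divides by zero at a pole and
returns 0. -/
lemma eval_inv {x : RatFunc F} (hx : RatFunc.eval f a x ≠ 0) :
    RatFunc.eval f a x⁻¹ = (RatFunc.eval f a x)⁻¹ := by
  have hx0 : x ≠ 0 := by
    rintro rfl
    exact hx (RatFunc.eval_zero f a)
  have h1 := RatFunc.eval_mul f a (RatFunc.eval₂_denom_ne_zero hx) (inv_mem_regularAt hx)
  rw [mul_inv_cancel₀ hx0, RatFunc.eval_one] at h1
  exact eq_inv_of_mul_eq_one_right h1.symm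

lemma C_mem_regularAt (c : F) : RatFunc.C c ∈ regularAt f a := by
  rw [mem_regularAt, RatFunc.denom_C, Polynomial.eval₂_one]
  exact one_ne_zero

lemma X_mem_regularAt : (RatFunc.X : RatFunc F) ∈ regularAt f a := by
  rw [mem_regularAt, RatFunc.denom_X, Polynomial.eval₂_one]
  exact one_ne_zero

/-- `x` is regular at `a`, with value `b`. -/
def HasValue (f : F →+* L) (a : L) (x : RatFunc F) (b : L) : Prop :=
  x ∈ regularAt f a ∧ RatFunc.eval f a x = b

namespace HasValue

variable {x y : RatFunc F} {b c : L}

lemma add (hx : HasValue f a x b) (hy : HasValue f a y c) : HasValue f a (x + y) (b + c) :=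
  ⟨add_mem hx.1 hy.1, by rw [RatFunc.eval_add f a hx.1 hy.1, hx.2, hy.2]⟩

lemma mul (hx : HasValue f a x b) (hy : HasValue f a y c) : HasValue f a (x * y) (b * c) :=
  ⟨mul_mem hx.1 hy.1, by rw [RatFunc.eval_mul f a hx.1 hy.1, hx.2, hy.2]⟩

lemma neg (hx : HasValue f a x b) : HasValue f a (-x) (-b) :=
  ⟨neg_mem hx.1, by rw [← hx.2]; exact map_neg (evalAt f a) ⟨x, hx.1⟩⟩

lemma sub (hx : HasValue f a x b) (hy : HasValue f a y c) : HasValue f a (x - y) (b - c) := by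
  rw [sub_eq_add_neg, sub_eq_add_neg]
  exact hx.add hy.neg

lemma inv (hx : HasValue f a x b) (hb : b ≠ 0) : HasValue f a x⁻¹ b⁻¹ := by
  rw [← hx.2] at hb ⊢
  exact ⟨inv_mem_regularAt hb, eval_inv hb⟩

lemma div (hx : HasValue f a x b) (hy : HasValue f a y c) (hc : c ≠ 0) :
    HasValue f a (x / y) (b / c) := by
  rw [div_eq_mul_inv, div_eq_mul_inv]
  exact hx.mul (hy.inv hc)

lemma one : HasValue f a 1 1 := ⟨one_mem _, RatFunc.eval_one f a⟩

lemma zero : HasValue f a 0 0 := ⟨zero_mem _, RatFunc.eval_zero f a⟩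

lemma pow (hx : HasValue f a x b) (n : ℕ) : HasValue f a (x ^ n) (b ^ n) := by
  induction n with
  | zero => simpa using one
  | succ n ih => simpa only [pow_succ] using ih.mul hx

lemma sum {ι : Type*} {s : Finset ι} {x : ι → RatFunc F} {b : ι → L}
    (h : ∀ i ∈ s, HasValue f a (x i) (b i)) : HasValue f a (∑ i ∈ s, x i) (∑ i ∈ s, b i) := by
  classical
  induction s using Finset.induction with
  | empty => simpa using zero
  | insert j s hj ih =>
    rw [Finset.sum_insert hj, Finset.sum_insert hj]
    exact (h j (Finset.mem_insert_self _ _)).add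
      (ih fun i hi => h i (Finset.mem_insert_of_mem hi))

lemma prod {ι : Type*} {s : Finset ι} {x : ι → RatFunc F} {b : ι → L}
    (h : ∀ i ∈ s, HasValue f a (x i) (b i)) : HasValue f a (∏ i ∈ s, x i) (∏ i ∈ s, b i) := by
  classical
  induction s using Finset.induction with
  | empty => simpa using one
  | insert j s hj ih =>
    rw [Finset.prod_insert hj, Finset.prod_insert hj]
    exact (h j (Finset.mem_insert_self _ _)).mul
      (ih fun i hi => h i (Finset.mem_insert_of_mem hi))

lemma const (c : F) : HasValue f a (RatFunc.C c) (f c) :=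
  ⟨C_mem_regularAt c, RatFunc.eval_C ..⟩

lemma var : HasValue f a RatFunc.X a := ⟨X_mem_regularAt, RatFunc.eval_X ..⟩

lemma natCast (n : ℕ) : HasValue f a (n : RatFunc F) (n : L) := by
  simpa using const (f := f) (a := a) (n : F)

end HasValue

end Regular

/-! ## The Gram system near `t = 1` -/

section Gram

variable {F : Type*} [Field F] [CharZero F]

instance : CharZero (RatFunc F) := charZero_of_injective_algebraMap (algebraMap F (RatFunc F)).injective

/-- `x(1) = b` for a rational function `x` regular at `1`. -/
abbrev HasValueOne (x : RatFunc F) (b : F) : Prop := HasValue (RingHom.id F) 1 x b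

lemma hasValueOne_X_inv : HasValueOne (RatFunc.X⁻¹ : RatFunc F) 1 := by
  simpa using (HasValue.var (f := RingHom.id F) (a := 1)).inv one_ne_zero

omit [CharZero F] in
lemma hasValueOne_ratCast (r : ℚ) : HasValueOne ((r : ℚ) : RatFunc F) (r : F) := by
  simpa using HasValue.const (f := RingHom.id F) (a := 1) (r : F)

lemma one_sub_X_inv_ne_zero : (1 - RatFunc.X⁻¹ : RatFunc F) ≠ 0 := by
  rw [sub_ne_zero]
  intro h
  have h1 : (RatFunc.X : RatFunc F) = 1 := inv_injective (by rw [inv_one, ← h])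
  have h2 := congrArg (RatFunc.eval (RingHom.id F) 0) h1
  rw [RatFunc.eval_X, RatFunc.eval_one] at h2
  exact zero_ne_one h2

lemma X_inv_pow_ne_one (k : ℕ) (hk : 0 < k) : (RatFunc.X⁻¹ : RatFunc F) ^ k ≠ 1 := by
  intro h
  rw [inv_pow, inv_eq_one] at h
  have h2 := (HasValue.var (f := RingHom.id F) (a := 0)).pow k
  rw [h, zero_pow hk.ne'] at h2
  exact one_ne_zero ((RatFunc.eval_one (RingHom.id F) 0).symm.trans h2.2)

omit [CharZero F] in
lemma C_pow_ne_one {q : F} (hq : ∀ k : ℕ, 0 < k → q ^ k ≠ 1) (k : ℕ) (hk : 0 < k) :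
    (RatFunc.C q : RatFunc F) ^ k ≠ 1 := by
  intro h
  rw [← map_pow, ← map_one RatFunc.C] at h
  exact hq k hk (RatFunc.C_injective h)

/-- The order of vanishing at `t = 1` of `⟨p_a, p_a⟩_{1 / t, q}` is the number of parts of `a`. -/
lemma exists_powerNorm_eq {q : F} (hq : ∀ k : ℕ, 0 < k → q ^ k ≠ 1) (a : ℕ+ →₀ ℕ) :
    ∃ w : RatFunc F, ∃ b : F, b ≠ 0 ∧ HasValueOne w b ∧
      powerNorm (RatFunc.X⁻¹ : RatFunc F) (RatFunc.C q) a =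
        (1 - RatFunc.X⁻¹) ^ a.degree * w := by
  have hval : ∀ k : ℕ+, HasValueOne
      ((∑ i ∈ Finset.range k, (RatFunc.X⁻¹ : RatFunc F) ^ i) / (1 - RatFunc.C q ^ (k : ℕ)))
      ((∑ i ∈ Finset.range k, 1 ^ i) / (1 - q ^ (k : ℕ))) := fun k =>
    (HasValue.sum fun i _ => hasValueOne_X_inv.pow i).div
      (HasValue.one.sub ((HasValue.const q).pow k)) (sub_ne_zero.2 (hq k k.pos).symm)
  refine ⟨_, _, ?_, (HasValue.natCast (zFactor a)).mul
    (HasValue.prod (s := a.support) fun k _ => (hval k).pow (a k)), ?_⟩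
  · refine mul_ne_zero (zFactor_cast_ne_zero a) (Finset.prod_ne_zero_iff.2 fun k _ => ?_)
    refine pow_ne_zero _ (div_ne_zero ?_ (sub_ne_zero.2 (hq k k.pos).symm))
    simp
  · rw [powerNorm_eq, Finsupp.prod, Finsupp.degree_apply, ← Finset.prod_pow_eq_pow_sum,
      mul_left_comm, ← Finset.prod_mul_distrib]
    congr 1
    refine Finset.prod_congr rfl fun k _ => ?_
    -- Each part k contributes exactly one factor 1 - 1/t, from 1 - t^{-k} = (1 - 1/t)(1 + … +
    -- t^{-(k-1)}).
    rw [← mul_pow, ← mul_div_assoc, mul_neg_geom_sum]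

/-- Every power product in h_μ has at least as many parts as μ, with equality only for p_μ. After
division by (1 - 1/t) to that power, only p_μ contributes at t = 1, and a nonzero value requires p_μ
to occur in h_ν as well. -/
lemma exists_gram_eq {q : F} (hq : ∀ k : ℕ, 0 < k → q ^ k ≠ 1) (μ ν : YoungDiagram) :
    ∃ x : RatFunc F, ∃ b : F, HasValueOne x b ∧ (b ≠ 0 → DomLE μ ν) ∧ (μ = ν → b ≠ 0) ∧
      scalar (RatFunc.X⁻¹ : RatFunc F) (RatFunc.C q) (completeRow _ μ) (completeRow _ ν) =
        (1 - RatFunc.X⁻¹) ^ μ.colLen 0 * x := by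
  classical
  choose w b hb hw hn using exists_powerNorm_eq hq
  have hz : HasValueOne (1 - RatFunc.X⁻¹ : RatFunc F) 0 := by
    simpa using HasValue.one.sub hasValueOne_X_inv
  have hc : ∀ (lam : YoungDiagram) a, HasValueOne (coeff a (completeRow (RatFunc F) lam))
      (coeff a (completeRow F lam)) := fun lam a => by
    rw [coeff_completeRow_eq, coeff_completeRow_eq (K := F)]
    exact hasValueOne_ratCast _
  have hsum := HasValue.sum (s := (completeRow (RatFunc F) μ).support) fun a _ =>
    (((hc μ a).mul (hc ν a)).mul (hz.pow (a.degree - μ.colLen 0))).mul (hw a)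
  have hval : ∑ a ∈ (completeRow (RatFunc F) μ).support, coeff a (completeRow F μ) *
      coeff a (completeRow F ν) * 0 ^ (a.degree - μ.colLen 0) * b a =
      coeff (rowContent μ) (completeRow F μ) * coeff (rowContent μ) (completeRow F ν) *
        b (rowContent μ) := by
    rw [Finset.sum_eq_single (rowContent μ)]
    · rw [degree_rowContent, Nat.sub_self, pow_zero, mul_one]
    · intro a ha hne
      have h1 := colLen_le_degree (mem_support_iff.1 ha)
      have h2 : a.degree ≠ μ.colLen 0 := fun h => hne (eq_rowContent (mem_support_iff.1 ha) h)
      rw [zero_pow (by omega), mul_zero, zero_mul]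
    · exact fun h => absurd (mem_support_iff.2 (coeff_rowContent_ne_zero μ)) h
  refine ⟨_, _, hval ▸ hsum, fun h => ?_, ?_, ?_⟩
  · exact domLE_of_coeff_rowContent (right_ne_zero_of_mul (left_ne_zero_of_mul h))
  · rintro rfl
    exact mul_ne_zero (mul_ne_zero (coeff_rowContent_ne_zero μ) (coeff_rowContent_ne_zero μ)) (hb _)
  · rw [scalar, Finset.mul_sum]
    refine Finset.sum_congr rfl fun a ha => ?_
    rw [hn, ← Nat.add_sub_cancel' (colLen_le_degree (mem_support_iff.1 ha)), pow_add,
      Nat.add_sub_cancel_left]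
    ring

omit [CharZero F] in
/-- A matrix triangular for dominance, with nonzero diagonal, is nonsingular. -/
lemma det_ne_zero_of_domLE {U : Finset YoungDiagram} [DecidableEq U] (M : Matrix U U F)
    (h : ∀ μ ν, M μ ν ≠ 0 → DomLE μ ν) (hd : ∀ μ, M μ μ ≠ 0) : M.det ≠ 0 := by
  intro h0
  obtain ⟨v, hv, hvM⟩ := Matrix.exists_vecMul_eq_zero_iff.2 h0
  refine hv (funext fun ν => ?_)
  obtain ⟨ν, hν⟩ := ν
  induction ν using domLT_wf.induction with
  | _ ν ih =>
    have h1 := congrFun hvM ⟨ν, hν⟩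
    rw [Matrix.vecMul, dotProduct, Finset.sum_eq_single ⟨ν, hν⟩] at h1
    · exact (mul_eq_zero.1 h1).resolve_right (hd _)
    · intro μ _ hne
      by_contra h2
      rcases domLE_iff.1 (h _ _ (right_ne_zero_of_mul h2)) with h3 | h3
      · exact hne (Subtype.ext h3)
      · exact left_ne_zero_of_mul h2 (ih μ h3 μ.2)
    · simp

/-- The Gram matrices are nondegenerate, and the system for `macdonaldQ` has a solution vanishing
at `t = 1`. -/
lemma gram_system {q : F} (hq : ∀ k : ℕ, 0 < k → q ^ k ≠ 1) (n : ℕ) :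
    GramNondegenerate (RatFunc.C q) (RatFunc.X⁻¹ : RatFunc F) n ∧
    ∀ lam, ∃ y : YoungDiagram → RatFunc F, (∀ μ, HasValueOne (y μ) 0) ∧
      ∀ μ ∈ notBelow n lam, scalar (RatFunc.X⁻¹ : RatFunc F) (RatFunc.C q) (completeRow _ lam +
        ∑ ν ∈ notBelow n lam, y ν • completeRow _ ν) (completeRow _ μ) = 0 := by
  classical
  choose x b hx hb hd hs using exists_gram_eq hq
  let R := regularAt (RingHom.id F) (1 : F)
  let M : ∀ U : Finset YoungDiagram, Matrix U U R := fun U μ ν => ⟨x μ ν, (hx μ ν).1⟩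
  -- Reduction to t = 1 makes the scaled Gram matrix triangular for dominance with nonzero diagonal.
  have hdet : ∀ U, evalAt (RingHom.id F) (1 : F) (M U).det ≠ 0 := by
    intro U
    rw [RingHom.map_det]
    have hM : ∀ μ ν, (evalAt (RingHom.id F) (1 : F)).mapMatrix (M U) μ ν = b μ ν := fun μ ν =>
      (hx μ ν).2
    refine det_ne_zero_of_domLE ((evalAt (RingHom.id F) (1 : F)).mapMatrix (M U)) (fun μ ν h => ?_)
      fun μ => ?_
    · rw [hM] at h
      exact hb μ ν h
    · rw [hM]
      exact hd _ _ rfl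
  have hdet' : ∀ U, (M U).det ≠ 0 := fun U h => hdet U (by rw [h, map_zero])
  have hcomm : ∀ μ ν, scalar (RatFunc.X⁻¹ : RatFunc F) (RatFunc.C q) (completeRow _ ν)
      (completeRow _ μ) = (1 - RatFunc.X⁻¹) ^ μ.colLen 0 * x μ ν := fun μ ν => by
    rw [scalar_comm, hs]
  have hε : ∀ k, (1 - RatFunc.X⁻¹ : RatFunc F) ^ k ≠ 0 := fun k =>
    pow_ne_zero k one_sub_X_inv_ne_zero
  constructor
  · intro U _ y hy
    have h1 : (R.subtype.mapMatrix (M U)).mulVec (fun ν : U => y ν) = 0 := by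
      ext μ
      have h2 := hy μ μ.2
      simp only [hcomm] at h2
      rw [← Finset.sum_coe_sort] at h2
      rw [Matrix.mulVec, dotProduct, Pi.zero_apply, ← mul_right_inj' (hε (μ.1.colLen 0)), mul_zero,
        Finset.mul_sum, ← h2]
      refine Finset.sum_congr rfl fun ν _ => ?_
      rw [mul_left_comm (y ν), mul_comm (y ν)]
      rfl
    have h3 : (R.subtype.mapMatrix (M U)).det ≠ 0 := by
      rw [← RingHom.map_det]
      exact fun h => hdet' U (Subtype.ext h)
    exact fun μ hμ => congrFun (Matrix.eq_zero_of_mulVec_eq_zero h3 h1) ⟨μ, hμ⟩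
  · intro lam
    set U := notBelow n lam with hU
    let r : U → R := fun μ => ⟨x μ lam, (hx μ lam).1⟩
    -- A nonzero value of this entry at t = 1 would mean that μ is dominated by λ, which `notBelow`
    -- excludes.
    have hr : ∀ μ, evalAt (RingHom.id F) (1 : F) (r μ) = 0 := fun μ => by
      by_contra h
      refine (mem_notBelow.1 μ.2).2 (hb μ lam ?_)
      rw [← (hx μ lam).2]
      exact h
    -- The determinant is a unit in the ring of functions regular at t = 1. Cramer's rule stays in
    -- this ring, and the solution inherits the zero of the right-hand side.
    let u : R := ⟨((M U).det : RatFunc F)⁻¹, inv_mem_regularAt (hdet U)⟩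
    have hu : u * (M U).det = 1 := Subtype.ext (inv_mul_cancel₀ fun h => hdet' U (Subtype.ext h))
    let z : U → R := -(u • (M U).adjugate.mulVec r)
    have hMz : ∀ μ, ∑ ν, M U μ ν * z ν = -r μ := by
      have h1 : (M U).mulVec z = -r := by
        rw [Matrix.mulVec_neg, Matrix.mulVec_smul, Matrix.mulVec_mulVec, Matrix.mul_adjugate,
          Matrix.smul_mulVec, Matrix.one_mulVec, smul_smul, hu, one_smul]
      exact fun μ => congrFun h1 μ
    have hz : ∀ ν, evalAt (RingHom.id F) (1 : F) (z ν) = 0 := by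
      intro ν
      have h1 : z ν = -(u * ∑ κ, (M U).adjugate ν κ * r κ) := rfl
      rw [h1, map_neg, map_mul, map_sum, Finset.sum_eq_zero, mul_zero, neg_zero]
      intro κ _
      rw [map_mul, hr, mul_zero]
    refine ⟨fun ν => if h : ν ∈ U then z ⟨ν, h⟩ else 0, fun ν => ?_, fun μ hμ => ?_⟩
    · dsimp only
      split_ifs with h
      · exact ⟨(z ⟨ν, h⟩).2, hz _⟩
      · exact HasValue.zero
    · rw [scalar_add_left, scalar_sum_left, hcomm, ← Finset.sum_coe_sort]
      have h4 : ∀ ν : U, (if h : (ν : YoungDiagram) ∈ U then (z ⟨ν, h⟩ : RatFunc F) else 0) = z ν :=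
        fun ν => dif_pos ν.2
      simp only [scalar_smul_left, hcomm, h4]
      have h1 := congrArg (Subtype.val) (hMz ⟨μ, hμ⟩)
      rw [AddSubmonoidClass.coe_finsetSum] at h1
      simp only [Subring.coe_mul, Subring.coe_neg] at h1
      have h2 : ∑ ν : U, (z ν : RatFunc F) * ((1 - RatFunc.X⁻¹) ^ μ.colLen 0 * x μ ν) =
          (1 - RatFunc.X⁻¹) ^ μ.colLen 0 * ∑ ν : U, x μ ν * (z ν : RatFunc F) := by
        rw [Finset.mul_sum]
        exact Finset.sum_congr rfl fun ν _ => by ring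
      have h3 : ∑ ν : U, x μ ν * (z ν : RatFunc F) = - x μ lam := h1
      rw [h2, h3]
      ring

end Gram

/-! ## The coefficient of `p_1^n` in `H̃` near `t = 1` -/

section

variable {K : Type*} [Field K]

lemma prod_single_pow {M : Type*} [CommMonoid M] (c : ℕ+ → M) (k : ℕ+) (n : ℕ) :
    ((Finsupp.single k n).prod fun j m => c j ^ m) = c k ^ n :=
  Finsupp.prod_single_index (pow_zero _)

lemma coeff_iterate_pderiv {σ : Type*} (k : σ) (n : ℕ) (f : MvPolynomial σ K) (a : σ →₀ ℕ) :
    ((a k).factorial : K) * coeff a ((pderiv k)^[n] f) =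
      ((a k + n).factorial : K) * coeff (a + Finsupp.single k n) f := by
  induction n generalizing a with
  | zero => simp
  | succ n ih =>
    rw [Function.iterate_succ_apply', coeff_pderiv, mul_comm (coeff _ _), ← mul_assoc]
    have h1 := ih (a + Finsupp.single k 1)
    have h2 : (a + (Finsupp.single k 1 : σ →₀ ℕ)) k = a k + 1 := by simp
    rw [h2, Nat.factorial_succ, add_assoc a, ← Finsupp.single_add, add_comm 1 n,
      add_right_comm, add_assoc (a k)] at h1
    rw [← h1]
    push_cast
    ring

lemma constantCoeff_iterate_pderiv (n : ℕ) (f : Sym K) :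
    constantCoeff ((pderiv (1 : ℕ+))^[n] f) =
      (n.factorial : K) * coeff (Finsupp.single 1 n) f := by
  have h := coeff_iterate_pderiv 1 n f 0
  simpa [constantCoeff_eq] using h

/-- The substitution `p_1 ↦ X`, `p_k ↦ 0` for `k > 1`. -/
def restrictOne (K : Type*) [Field K] : Sym K →ₐ[K] Polynomial K :=
  aeval fun k => if k = 1 then Polynomial.X else 0

lemma coeff_restrictOne (f : Sym K) (n : ℕ) :
    (restrictOne K f).coeff n = coeff (Finsupp.single 1 n) f := by
  classical
  induction f using MvPolynomial.induction_on' with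
  | monomial a r =>
    rw [restrictOne, aeval_monomial, coeff_monomial, Polynomial.algebraMap_eq,
      Polynomial.coeff_C_mul]
    by_cases h : a = Finsupp.single 1 (a 1)
    · rw [h, prod_single_pow, if_pos rfl, Polynomial.coeff_X_pow]
      simp only [mul_ite, mul_one, mul_zero]
      refine if_congr ?_ rfl rfl
      rw [eq_comm]
      exact (Finsupp.single_injective (1 : ℕ+)).eq_iff.symm
    · have h1 : a ≠ Finsupp.single 1 n := by
        rintro rfl
        simp at h
      obtain ⟨k, hk, hk1⟩ : ∃ k, a k ≠ 0 ∧ k ≠ 1 := by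
        by_contra! hall
        refine h (Finsupp.ext fun k => ?_)
        by_cases hk : k = 1
        · simp [hk]
        · rw [Finsupp.single_eq_of_ne hk]
          by_contra h0
          exact hk (hall k h0)
      rw [if_neg h1, Finsupp.prod, Finset.prod_eq_zero (Finsupp.mem_support_iff.2 hk)]
      · simp
      · rw [if_neg hk1, zero_pow hk]
  | add p q hp hq => rw [map_add, Polynomial.coeff_add, coeff_add, hp, hq]

/-- Among the power products of weight m only p_1^m survives, and its z is m!. -/
lemma restrictOne_complete (m : ℕ) :
    restrictOne K (complete K m) = Polynomial.C (m.factorial : K)⁻¹ * Polynomial.X ^ m := by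
  ext j
  rw [coeff_restrictOne, coeff_complete, partWeight_single, Polynomial.coeff_C_mul,
    Polynomial.coeff_X_pow]
  by_cases h : j = m
  · simp [h, zFactor]
  · simp [h]

lemma coeff_single_completeRow (lam : YoungDiagram) :
    coeff (Finsupp.single 1 lam.card) (completeRow K lam) =
      ∏ i ∈ Finset.range (lam.colLen 0), ((lam.rowLen i).factorial : K)⁻¹ := by
  rw [← coeff_restrictOne, completeRow_eq, map_prod]
  simp only [restrictOne_complete]
  rw [Finset.prod_mul_distrib, Finset.prod_pow_eq_pow_sum, sum_rowLen lam le_rfl, ← map_prod,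
    Polynomial.coeff_C_mul, Polynomial.coeff_X_pow, if_pos rfl, mul_one]

lemma coeff_macdonaldH (q t : K) (lam : YoungDiagram) (n : ℕ) :
    coeff (Finsupp.single 1 n) (macdonaldH q t lam) =
      hookPrime q t lam * ((1 - t)⁻¹) ^ n * coeff (Finsupp.single 1 n) (macdonaldQ q t lam) := by
  have h : macdonaldH q t lam = rescale (fun k : ℕ+ => (1 - t ^ (k : ℕ))⁻¹) (macdonaldJ q t lam) :=
    rfl
  rw [h, coeff_rescale, macdonaldJ, coeff_C_mul, prod_single_pow]
  simp only [PNat.one_coe, pow_one]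
  ring

end

section

variable {F : Type*} [Field F] [CharZero F]

/-- `∂_{p_1}^n H̃_lam` is regular at `t = 1`. -/
theorem hasValueOne_modifiedH {q : F} (hq : ∀ k : ℕ, 0 < k → q ^ k ≠ 1) {n : ℕ}
    (lam : YoungDiagram) (hlam : lam.card = n) :
    HasValueOne (constantCoeff ((pderiv (1 : ℕ+))^[n]
        (modifiedH (RatFunc.C q) (RatFunc.X : RatFunc F) lam)))
      (n.factorial * ((∏ c ∈ lam.cells, (1 - q ^ (arm lam c + 1)) / (1 - q)) *
        ∏ i ∈ Finset.range (lam.colLen 0), ((lam.rowLen i).factorial : F)⁻¹)) := by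
  obtain ⟨hG, hsys⟩ := gram_system hq n
  obtain ⟨y, hy0, hy⟩ := hsys lam
  have hq1 : 1 - q ≠ 0 := sub_ne_zero.2 (by simpa using (hq 1 one_pos).symm)
  rw [constantCoeff_iterate_pderiv, modifiedH, coeff_C_mul, coeff_macdonaldH,
    macdonaldQ_eq (C_pow_ne_one hq) X_inv_pow_ne_one hG lam hlam y hy, dualize, coeff_rescale,
    prod_single_pow]
  simp only [PNat.one_coe, pow_one]
  have hN : HasValueOne (coeff (Finsupp.single 1 n) (completeRow (RatFunc F) lam +
      ∑ ν ∈ notBelow n lam, y ν • completeRow (RatFunc F) ν))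
      (∏ i ∈ Finset.range (lam.colLen 0), ((lam.rowLen i).factorial : F)⁻¹) := by
    rw [coeff_add, coeff_sum, ← hlam, coeff_single_completeRow]
    have h1 : HasValueOne (∏ i ∈ Finset.range (lam.colLen 0),
        ((lam.rowLen i).factorial : RatFunc F)⁻¹)
        (∏ i ∈ Finset.range (lam.colLen 0), ((lam.rowLen i).factorial : F)⁻¹) :=
      HasValue.prod fun i _ => (HasValue.natCast _).inv
        (Nat.cast_ne_zero.2 (Nat.factorial_ne_zero _))
    have h2 := h1.add (HasValue.sum (s := notBelow lam.card lam) fun ν _ =>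
      (hy0 ν).mul (hasValueOne_ratCast (coeff (Finsupp.single 1 lam.card) (completeRow ℚ ν))))
    simpa only [zero_mul, Finset.sum_const_zero, add_zero, coeff_smul, smul_eq_mul,
      coeff_completeRow_eq (K := RatFunc F)] using h2
  have hhook : HasValueOne (hookPrime (RatFunc.C q) (RatFunc.X⁻¹ : RatFunc F) lam)
      (∏ c ∈ lam.cells, (1 - q ^ (arm lam c + 1) * 1 ^ leg lam c)) :=
    HasValue.prod fun c _ => HasValue.one.sub
      (((HasValue.const q).pow _).mul (hasValueOne_X_inv.pow _))
  have hX : HasValueOne (RatFunc.X ^ nStat lam : RatFunc F) (1 ^ nStat lam) := HasValue.var.pow _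
  have hq' : HasValueOne (((1 - RatFunc.C q : RatFunc F)⁻¹) ^ n) (((1 - q)⁻¹) ^ n) :=
    ((HasValue.one.sub (HasValue.const q)).inv hq1).pow n
  have := (HasValue.natCast n.factorial).mul (((hX.mul hhook).mul hq').mul hN)
  convert! this using 1
  -- The factor (1 - 1/t)^n from the rescaling of Q cancels the (1 - 1/t)^{-n} of the plethysm.
  · have h0 := one_sub_X_inv_ne_zero (F := F)
    rw [div_eq_mul_inv, mul_pow]
    have h3 : ((1 - RatFunc.X⁻¹ : RatFunc F)⁻¹) ^ n * (1 - RatFunc.X⁻¹) ^ n = 1 := by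
      rw [← mul_pow, inv_mul_cancel₀ h0, one_pow]
    linear_combination (n.factorial * RatFunc.X ^ nStat lam * hookPrime (RatFunc.C q)
      RatFunc.X⁻¹ lam * ((1 - RatFunc.C q)⁻¹) ^ n * coeff (Finsupp.single 1 n)
        (completeRow (RatFunc F) lam + ∑ ν ∈ notBelow n lam, y ν • completeRow (RatFunc F) ν)) * h3
  · rw [Finset.prod_div_distrib, Finset.prod_const]
    have : lam.cells.card = n := hlam
    rw [this]
    simp only [one_pow, mul_one, one_mul, div_eq_mul_inv, inv_pow]

end

/-! ## A divided difference of the logarithm -/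

section Limit

open Filter

/-- `1 - x^{-z}`, the argument of the logarithmic series of `z log x`. -/
def oneSubInvPow (z : ℕ) (x : ℝ) : ℝ := 1 - (x ^ z)⁻¹

lemma tendsto_slope_oneSubInvPow (z : ℕ) :
    Tendsto (fun x => oneSubInvPow z x / (x - 1)) (𝓝[≠] 1) (𝓝 (z : ℝ)) := by
  have h : HasDerivAt (oneSubInvPow z) (z : ℝ) 1 := by
    have h1 := ((hasDerivAt_pow z (1 : ℝ)).fun_inv (by simp)).const_sub 1
    have h2 : HasDerivAt (fun x : ℝ => 1 - (x ^ z)⁻¹) (z : ℝ) 1 := by simpa using h1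
    exact h2
  refine h.tendsto_slope.congr fun x => ?_
  rw [slope_def_field]
  simp [oneSubInvPow]

lemma tendsto_oneSubInvPow (z : ℕ) : Tendsto (oneSubInvPow z) (𝓝[≠] 1) (𝓝 0) := by
  have h : ContinuousAt (oneSubInvPow z) 1 := by
    refine continuousAt_const.sub (ContinuousAt.inv₀ (by fun_prop) (by simp))
  have h1 := h.tendsto.mono_left (nhdsWithin_le_nhds (s := {1}ᶜ))
  simpa [oneSubInvPow] using h1

lemma tendsto_log_div : Tendsto (fun x : ℝ => (1 - x) / (-Real.log x)) (𝓝[≠] 1) (𝓝 1) := by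
  have h := (Real.hasDerivAt_log (one_ne_zero)).tendsto_slope.inv₀ (by simp)
  rw [inv_one, inv_one] at h
  refine h.congr fun x => ?_
  rw [slope_def_field, Real.log_one, sub_zero, inv_div, ← neg_sub x 1, neg_div_neg_eq]

lemma pow_eq_one_iff_of_pos {x : ℝ} (hx : 0 < x) (hx1 : x ≠ 1) {z : ℕ} : x ^ z = 1 ↔ z = 0 := by
  refine ⟨fun h => ?_, fun h => by simp [h]⟩
  by_contra h0
  exact hx1 ((pow_eq_one_iff_of_nonneg hx.le h0).1 h)

lemma pow_inj_of_pos {x : ℝ} (hx : 0 < x) (hx1 : x ≠ 1) {z z' : ℕ} (h : x ^ z = x ^ z') :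
    z = z' :=
  pow_right_injective₀ hx hx1 h

/-- The remainder estimate for the logarithmic series, divided by v. -/
lemma abs_log_div_sub_le {v : ℝ} (hv : |v| < 1) (hv0 : v ≠ 0) (k : ℕ) :
    |-Real.log (1 - v) / v - ∑ i ∈ Finset.range k, v ^ i / (i + 1)| ≤ |v| ^ k / (1 - |v|) := by
  have h := Real.abs_log_sub_add_sum_range_le hv k
  have h0 : 0 < |v| := abs_pos.2 hv0
  have h1 : -Real.log (1 - v) / v - ∑ i ∈ Finset.range k, v ^ i / ((i : ℝ) + 1) =
      -(((∑ i ∈ Finset.range k, v ^ (i + 1) / ((i : ℝ) + 1)) + Real.log (1 - v)) / v) := by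
    have h2 : ∑ i ∈ Finset.range k, v ^ (i + 1) / ((i : ℝ) + 1) =
        v * ∑ i ∈ Finset.range k, v ^ i / ((i : ℝ) + 1) := by
      rw [Finset.mul_sum]
      exact Finset.sum_congr rfl fun i _ => by ring
    rw [h2]
    field_simp
    ring
  rw [h1, abs_neg, abs_div, div_le_iff₀ h0]
  refine h.trans_eq ?_
  ring

variable {ι : Type*} [DecidableEq ι]

/-- By Lagrange interpolation, the divided difference at k points of a polynomial of degree less
than k is its coefficient of degree k - 1. -/
lemma sum_geometric_divided {S : Finset ι} (hS : S.Nonempty) {v : ι → ℝ} (hv : Set.InjOn v S) :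
    ∑ s ∈ S, (∑ i ∈ Finset.range S.card, v s ^ i / ((i : ℝ) + 1)) /
      ∏ r ∈ S.erase s, (v s - v r) = 1 / S.card := by
  let P : Polynomial ℝ := ∑ i ∈ Finset.range S.card,
    Polynomial.C ((i : ℝ) + 1)⁻¹ * Polynomial.X ^ i
  have hP : P.degree < S.card := by
    refine (Polynomial.degree_sum_le _ _).trans_lt ?_
    refine (Finset.sup_lt_iff (WithBot.bot_lt_coe _)).2 fun i hi => ?_
    exact (Polynomial.degree_C_mul_X_pow_le _ _).trans_lt
      (WithBot.coe_lt_coe.2 (Finset.mem_range.1 hi))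
  have hpos : 0 < S.card := hS.card_pos
  have h := Lagrange.coeff_eq_sum hv hP
  have h1 : P.coeff (S.card - 1) = 1 / S.card := by
    simp only [P, Polynomial.finsetSum_coeff, Polynomial.coeff_C_mul, Polynomial.coeff_X_pow]
    rw [Finset.sum_eq_single (S.card - 1)]
    · rw [if_pos rfl, mul_one, Nat.cast_sub hpos]
      simp
    · intro i _ hi
      rw [if_neg hi.symm, mul_zero]
    · intro hi
      exact absurd (Finset.mem_range.2 (by omega)) hi
  rw [← h1, h]
  refine Finset.sum_congr rfl fun s _ => ?_
  congr 1
  simp only [P, Polynomial.eval_finsetSum, Polynomial.eval_mul, Polynomial.eval_C,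
    Polynomial.eval_pow, Polynomial.eval_X]
  exact Finset.sum_congr rfl fun i _ => by ring

variable {S : Finset ι} {z : ι → ℕ}

omit [DecidableEq ι] in
lemma injOn_oneSubInvPow (hz : Set.InjOn z S) {x : ℝ} (hx : 0 < x) (hx1 : x ≠ 1) :
    Set.InjOn (fun s => oneSubInvPow (z s) x) S := by
  intro s hs r hr h
  have h1 : oneSubInvPow (z s) x = oneSubInvPow (z r) x := h
  simp only [oneSubInvPow, sub_right_inj, inv_inj] at h1
  exact hz hs hr (pow_inj_of_pos hx hx1 h1)

/-- The Taylor remainder is of order v^k, whereas the denominator has only k - 1 differences, each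
of the same order x - 1 as v. -/
lemma tendsto_divided_error (hz : Set.InjOn z S) (hpos : ∀ s ∈ S, 0 < z s) {s : ι} (hs : s ∈ S) :
    Tendsto (fun x : ℝ => (-Real.log (1 - oneSubInvPow (z s) x) / oneSubInvPow (z s) x -
        ∑ i ∈ Finset.range S.card, oneSubInvPow (z s) x ^ i / ((i : ℝ) + 1)) /
        ∏ r ∈ S.erase s, (oneSubInvPow (z s) x - oneSubInvPow (z r) x))
      (𝓝[≠] 1) (𝓝 0) := by
  have hbound : Tendsto (fun x : ℝ => |oneSubInvPow (z s) x| / (1 - |oneSubInvPow (z s) x|) *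
      ∏ r ∈ S.erase s,
        |oneSubInvPow (z s) x / (oneSubInvPow (z s) x - oneSubInvPow (z r) x)|)
      (𝓝[≠] 1) (𝓝 0) := by
    have h0 := (tendsto_oneSubInvPow (z s)).abs
    have h1 := h0.div (tendsto_const_nhds.sub h0) (by simp : (1 : ℝ) - |0| ≠ 0)
    -- Numerator and denominator are both divided by x - 1; the slopes at 1 are z_s and z_s - z_r.
    have h2 : ∀ r ∈ S.erase s, Tendsto (fun x : ℝ =>
        |oneSubInvPow (z s) x / (oneSubInvPow (z s) x - oneSubInvPow (z r) x)|) (𝓝[≠] 1)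
        (𝓝 |(z s : ℝ) / (z s - z r)|) := by
      intro r hr
      have hne : (z s : ℝ) - z r ≠ 0 := by
        rw [sub_ne_zero, Ne, Nat.cast_inj]
        exact fun h => (Finset.mem_erase.1 hr).1
          (hz hs (Finset.mem_of_mem_erase hr) h).symm
      have hd := tendsto_slope_oneSubInvPow (z s)
      refine ((hd.div (hd.sub (tendsto_slope_oneSubInvPow (z r))) hne).abs).congr' ?_
      filter_upwards [self_mem_nhdsWithin] with x hx
      have : x - 1 ≠ 0 := sub_ne_zero.2 hx
      rw [Pi.div_apply, ← sub_div, div_div_div_cancel_right₀ this]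
    have h3 := h1.mul (tendsto_finsetProd _ h2)
    simpa using h3
  refine squeeze_zero_norm' ?_ hbound
  have hsmall : ∀ᶠ x in 𝓝[≠] (1 : ℝ), |oneSubInvPow (z s) x| < 1 := by
    have h0 := (tendsto_oneSubInvPow (z s)).abs
    rw [abs_zero] at h0
    exact h0.eventually_lt_const one_pos
  have hxpos : ∀ᶠ x in 𝓝[≠] (1 : ℝ), 0 < x :=
    nhdsWithin_le_nhds (lt_mem_nhds one_pos)
  filter_upwards [hsmall, hxpos, self_mem_nhdsWithin] with x hx hx0 hx1
  have hx1 : x ≠ 1 := hx1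
  have hv : oneSubInvPow (z s) x ≠ 0 := by
    intro h
    rw [oneSubInvPow, sub_eq_zero, eq_comm, inv_eq_one, pow_eq_one_iff_of_pos hx0 hx1] at h
    exact (hpos s hs).ne' h
  rw [Real.norm_eq_abs, abs_div, Finset.abs_prod]
  have hP : 0 < ∏ r ∈ S.erase s, |oneSubInvPow (z s) x - oneSubInvPow (z r) x| := by
    refine Finset.prod_pos fun r hr => abs_pos.2 (sub_ne_zero.2 fun h => ?_)
    exact (Finset.mem_erase.1 hr).1 (injOn_oneSubInvPow hz hx0 hx1 hs
      (Finset.mem_of_mem_erase hr) h).symm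
  rw [div_le_iff₀ hP]
  refine (abs_log_div_sub_le hx hv _).trans_eq ?_
  rw [mul_assoc, ← Finset.prod_mul_distrib]
  have : ∀ r ∈ S.erase s, |oneSubInvPow (z s) x / (oneSubInvPow (z s) x - oneSubInvPow (z r) x)| *
      |oneSubInvPow (z s) x - oneSubInvPow (z r) x| = |oneSubInvPow (z s) x| := by
    intro r hr
    rw [← abs_mul, div_mul_cancel₀]
    exact abs_ne_zero.1 ((Finset.prod_ne_zero_iff.1 hP.ne') r hr)
  rw [Finset.prod_congr rfl this, Finset.prod_const, Finset.card_erase_of_mem hs]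
  -- Of the k factors |v_s|, k - 1 are matched with the differences; the remaining one tends to 0.
  conv_lhs => rw [← Nat.sub_add_cancel (Finset.card_pos.2 ⟨s, hs⟩), pow_succ]
  ring

/-- The limit of the alternating sum attached to distinct positive integers `z_s`. -/
theorem tendsto_divided (hS : S.Nonempty) (hz : Set.InjOn z S) (hpos : ∀ s ∈ S, 0 < z s) :
    Tendsto (fun x : ℝ => ∑ s ∈ S, (∏ r ∈ S.erase s, (1 - x ^ z r / x ^ z s)⁻¹) *
      (z s * ((1 - x) / (1 - x ^ z s)))) (𝓝[≠] 1) (𝓝 (1 / S.card)) := by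
  have h1 : Tendsto (fun x : ℝ => ∏ s ∈ S, (1 - oneSubInvPow (z s) x)) (𝓝[≠] 1) (𝓝 1) := by
    have := tendsto_finsetProd S fun s _ =>
      (tendsto_const_nhds (x := (1 : ℝ))).sub (tendsto_oneSubInvPow (z s))
    simpa using this
  have h2 := tendsto_finsetSum S fun s hs => tendsto_divided_error hz hpos hs
  have h3 := (tendsto_log_div.mul h1).mul ((tendsto_const_nhds (x := (1 : ℝ) / S.card)).add h2)
  rw [Finset.sum_const_zero, add_zero, one_mul, one_mul] at h3
  refine h3.congr' ?_
  have hxpos : ∀ᶠ x in 𝓝[≠] (1 : ℝ), 0 < x :=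
    nhdsWithin_le_nhds (lt_mem_nhds one_pos)
  filter_upwards [hxpos, self_mem_nhdsWithin] with x hx0 hx1
  have hx1 : x ≠ 1 := hx1
  rw [← sum_geometric_divided hS (injOn_oneSubInvPow hz hx0 hx1), ← Finset.sum_add_distrib,
    Finset.mul_sum]
  refine Finset.sum_congr rfl fun s hs => ?_
  rw [← add_div, add_sub_cancel, ← Finset.mul_prod_erase S _ hs]
  have hlog : Real.log x ≠ 0 := Real.log_ne_zero_of_pos_of_ne_one hx0 hx1
  have hpow : ∀ m : ℕ, x ^ m ≠ 0 := fun m => (pow_pos hx0 m).ne'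
  have hne : 1 - x ^ z s ≠ 0 := by
    rw [sub_ne_zero, ne_comm, Ne, pow_eq_one_iff_of_pos hx0 hx1]
    exact (hpos s hs).ne'
  -- Since 1 - v_s = x^{-z_s}, the logarithm is linear in z_s.
  have h4 : -Real.log (1 - oneSubInvPow (z s) x) = z s * Real.log x := by
    rw [oneSubInvPow, sub_sub_cancel, Real.log_inv, Real.log_pow, neg_neg]
  have h5 : ∀ r ∈ S.erase s, (1 - x ^ z r / x ^ z s)⁻¹ =
      (1 - oneSubInvPow (z r) x) / (oneSubInvPow (z s) x - oneSubInvPow (z r) x) := by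
    intro r hr
    have hsr : x ^ z s - x ^ z r ≠ 0 := by
      rw [sub_ne_zero]
      exact fun h => (Finset.mem_erase.1 hr).1
        (hz hs (Finset.mem_of_mem_erase hr) (pow_inj_of_pos hx0 hx1 h)).symm
    have h6 : 1 - x ^ z r / x ^ z s = (x ^ z s - x ^ z r) / x ^ z s := by
      rw [sub_div, div_self (hpow _)]
    have h7 : oneSubInvPow (z s) x - oneSubInvPow (z r) x =
        (x ^ z s - x ^ z r) / (x ^ z r * x ^ z s) := by
      have := hpow (z r)
      have := hpow (z s)
      rw [oneSubInvPow, oneSubInvPow]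
      field_simp
      ring
    rw [h6, h7, oneSubInvPow, sub_sub_cancel, inv_div]
    have := hpow (z r)
    field_simp
  rw [Finset.prod_congr rfl h5, Finset.prod_div_distrib, h4]
  have h8 : oneSubInvPow (z s) x = -(1 - x ^ z s) / x ^ z s := by
    rw [oneSubInvPow]
    have := hpow (z s)
    field_simp
    ring
  -- The product of all 1 - v_r was placed in the prefactor: the factors with r ≠ s were used above,
  -- and the one with r = s is used here together with (1 - x)/(-log x).
  have h9 : (1 - x) / (-Real.log x) * (1 - oneSubInvPow (z s) x) *
      (z s * Real.log x / oneSubInvPow (z s) x) = z s * ((1 - x) / (1 - x ^ z s)) := by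
    have := hpow (z s)
    rw [show 1 - oneSubInvPow (z s) x = (x ^ z s)⁻¹ by rw [oneSubInvPow, sub_sub_cancel], h8]
    field_simp
  rw [← h9]
  ring

end Limit

/-! ## Corners and the limit -/

section Corners

variable {μ : YoungDiagram}

lemma prod_cells {M : Type*} [CommMonoid M] (lam : YoungDiagram) {N : ℕ}
    (hN : lam.colLen 0 ≤ N) (f : ℕ × ℕ → M) :
    ∏ c ∈ lam.cells, f c = ∏ i ∈ Finset.range N, ∏ j ∈ Finset.range (lam.rowLen i), f (i, j) := by
  rw [Finset.prod_sigma']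
  symm
  refine Finset.prod_bij' (fun x _ => (x.1, x.2)) (fun c _ => ⟨c.1, c.2⟩) ?_ ?_ ?_ ?_ ?_
  · rintro ⟨i, j⟩ h
    simp only [Finset.mem_sigma, Finset.mem_range] at h
    exact YoungDiagram.mem_iff_lt_rowLen.2 h.2
  · rintro ⟨i, j⟩ h
    simp only [Finset.mem_sigma, Finset.mem_range]
    have h1 : (i, j) ∈ lam := h
    exact ⟨(YoungDiagram.mem_iff_lt_colLen.1 (lam.up_left_mem le_rfl (Nat.zero_le j) h1)).trans_le
      hN, YoungDiagram.mem_iff_lt_rowLen.1 h1⟩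
  all_goals simp

lemma Corner.rowLen_eq (c : Corner μ) : μ.rowLen c.1.1 = c.1.2 + 1 := by
  obtain ⟨⟨i, j⟩, hc, h1, h2⟩ := c
  rw [YoungDiagram.mem_iff_lt_rowLen] at hc h2
  dsimp only at *
  omega

/-- Of two cells in one column, the one with smaller row index is not removable. Columns thus
separate corners even after t is set to 1. -/
lemma Corner.eq_of_snd_eq {c d : Corner μ} (h : c.1.2 = d.1.2) : c = d := by
  obtain ⟨⟨i, j⟩, hc, h1, h2⟩ := c
  obtain ⟨⟨i', j'⟩, hd, h1', h2'⟩ := d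
  dsimp only at *
  subst h
  have : i = i' := by
    rcases lt_trichotomy i i' with h | h | h
    · exact absurd (μ.up_left_mem h le_rfl hd) h1
    · exact h
    · exact absurd (μ.up_left_mem h le_rfl hc) h1'
  subst this
  rfl

lemma mem_predecessor {c : Corner μ} {x : ℕ × ℕ} : x ∈ predecessor c ↔ x ≠ c.1 ∧ x ∈ μ :=
  Finset.mem_erase

lemma card_predecessor (c : Corner μ) : (predecessor c).card + 1 = μ.card :=
  Finset.card_erase_add_one c.2.1

lemma rowLen_predecessor (c : Corner μ) (i : ℕ) :
    (predecessor c).rowLen i = if i = c.1.1 then c.1.2 else μ.rowLen i := by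
  have key : ∀ j, j < (predecessor c).rowLen i ↔ j < if i = c.1.1 then c.1.2 else μ.rowLen i := by
    intro j
    rw [← YoungDiagram.mem_iff_lt_rowLen, mem_predecessor, YoungDiagram.mem_iff_lt_rowLen]
    split_ifs with h
    · subst h
      rw [c.rowLen_eq, Ne, Prod.ext_iff]
      simp only [true_and]
      omega
    · rw [Ne, Prod.ext_iff]
      simp [h]
  exact le_antisymm (Nat.le_of_not_lt fun h => lt_irrefl _ ((key _).1 h))
    (Nat.le_of_not_lt fun h => lt_irrefl _ ((key _).2 h))

lemma colLen_predecessor_le (c : Corner μ) : (predecessor c).colLen 0 ≤ μ.colLen 0 := by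
  by_contra! h
  have h1 := YoungDiagram.mem_iff_lt_colLen.2 h
  exact lt_irrefl _ (YoungDiagram.mem_iff_lt_colLen.1 (mem_predecessor.1 h1).2)

lemma T_predecessor {K : Type*} [Field K] (q t : K) (c : Corner μ) :
    t ^ c.1.1 * q ^ c.1.2 * T q t (predecessor c) = T q t μ :=
  Finset.mul_prod_erase μ.cells (fun c => t ^ c.1 * q ^ c.2) c.2.1

lemma T_ne_zero {K : Type*} [Field K] {q t : K} (hq : q ≠ 0) (ht : t ≠ 0) (lam : YoungDiagram) :
    T q t lam ≠ 0 :=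
  Finset.prod_ne_zero_iff.2 fun _ _ => mul_ne_zero (pow_ne_zero _ ht) (pow_ne_zero _ hq)

/-- The weight of the removed cell times T of the predecessor is T of μ, so ratios are inverted. -/
lemma T_predecessor_div {K : Type*} [Field K] {q t : K} (hq : q ≠ 0) (ht : t ≠ 0)
    (c d : Corner μ) : T q t (predecessor c) / T q t (predecessor d) =
      (t ^ d.1.1 * q ^ d.1.2) / (t ^ c.1.1 * q ^ c.1.2) := by
  rw [div_eq_div_iff (T_ne_zero hq ht _)
    (mul_ne_zero (pow_ne_zero _ ht) (pow_ne_zero _ hq)), T_predecessor, mul_comm,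
    T_predecessor]

/-! ### Quantum factorials of the rows and the value at t = 1. -/

/-- `[m]_x! / m!`. -/
def factorialRatio {K : Type*} [Field K] (x : K) (m : ℕ) : K :=
  (∏ j ∈ Finset.range m, (1 - x ^ (j + 1)) / (1 - x)) * (m.factorial : K)⁻¹

lemma factorialRatio_succ {K : Type*} [Field K] (x : K) (m : ℕ) :
    factorialRatio x (m + 1) =
      factorialRatio x m * ((1 - x ^ (m + 1)) / (1 - x) * ((m + 1 : ℕ) : K)⁻¹) := by
  rw [factorialRatio, factorialRatio, Finset.prod_range_succ, Nat.factorial_succ, Nat.cast_mul,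
    mul_inv]
  ring

lemma prod_arm_eq {K : Type*} [Field K] (x : K) (lam : YoungDiagram) {N : ℕ}
    (hN : lam.colLen 0 ≤ N) :
    (∏ c ∈ lam.cells, (1 - x ^ (arm lam c + 1)) / (1 - x)) *
        ∏ i ∈ Finset.range (lam.colLen 0), ((lam.rowLen i).factorial : K)⁻¹ =
      ∏ i ∈ Finset.range N, factorialRatio x (lam.rowLen i) := by
  have h1 : ∏ i ∈ Finset.range (lam.colLen 0), ((lam.rowLen i).factorial : K)⁻¹ =
      ∏ i ∈ Finset.range N, ((lam.rowLen i).factorial : K)⁻¹ := by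
    refine Finset.prod_subset (Finset.range_subset_range.2 hN) fun i _ hi => ?_
    rw [rowLen_eq_zero (by simpa using hi)]
    simp
  rw [h1, prod_cells lam hN, ← Finset.prod_mul_distrib]
  refine Finset.prod_congr rfl fun i _ => ?_
  -- Along a row the arms are the column indices in reverse order.
  rw [factorialRatio, ← Finset.prod_range_reflect]
  congr 1
  refine Finset.prod_congr rfl fun j hj => ?_
  have : arm lam (i, lam.rowLen i - 1 - j) = j := by
    have := Finset.mem_range.1 hj
    simp only [arm]
    omega
  rw [this]

/-- Only the row of the corner changes: its length drops by 1, which removes one factor of the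
quantum factorial. -/
lemma prod_factorialRatio_predecessor {x : ℝ} (hx : 0 < x) (hx1 : x ≠ 1) (c : Corner μ) :
    ∏ i ∈ Finset.range (μ.colLen 0), factorialRatio x ((predecessor c).rowLen i) =
      (∏ i ∈ Finset.range (μ.colLen 0), factorialRatio x (μ.rowLen i)) *
        (((c.1.2 + 1 : ℕ) : ℝ) * ((1 - x) / (1 - x ^ (c.1.2 + 1)))) := by
  have hc : c.1.1 ∈ Finset.range (μ.colLen 0) := by
    rw [Finset.mem_range, ← YoungDiagram.mem_iff_lt_colLen]
    exact μ.up_left_mem le_rfl (Nat.zero_le _) c.2.1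
  have h0 : 1 - x ≠ 0 := sub_ne_zero.2 hx1.symm
  have h1 : 1 - x ^ (c.1.2 + 1) ≠ 0 := by
    rw [sub_ne_zero, ne_comm, Ne, pow_eq_one_iff_of_pos hx hx1]
    omega
  rw [← Finset.mul_prod_erase _ _ hc, ← Finset.mul_prod_erase _ (fun i =>
    factorialRatio x (μ.rowLen i)) hc, rowLen_predecessor, if_pos rfl, c.rowLen_eq,
    factorialRatio_succ]
  have h2 : ∏ i ∈ (Finset.range (μ.colLen 0)).erase c.1.1,
      factorialRatio x ((predecessor c).rowLen i) =
      ∏ i ∈ (Finset.range (μ.colLen 0)).erase c.1.1, factorialRatio x (μ.rowLen i) := by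
    refine Finset.prod_congr rfl fun i hi => ?_
    rw [rowLen_predecessor, if_neg (Finset.mem_erase.1 hi).1]
  have h3 : ((c.1.2 + 1 : ℕ) : ℝ) ≠ 0 := Nat.cast_ne_zero.2 (Nat.succ_ne_zero _)
  rw [h2]
  field_simp

lemma tendsto_factorialRatio (m : ℕ) :
    Filter.Tendsto (fun x : ℝ => factorialRatio x m) (𝓝[≠] 1) (𝓝 1) := by
  have h : ∀ k : ℕ, Filter.Tendsto (fun x : ℝ => (1 - x ^ k) / (1 - x)) (𝓝[≠] 1) (𝓝 k) := by
    intro k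
    have h1 := (hasDerivAt_pow k (1 : ℝ)).tendsto_slope
    rw [one_pow, mul_one] at h1
    refine h1.congr fun x => ?_
    rw [slope_def_field, one_pow, ← neg_sub (x ^ k), ← neg_sub x, neg_div_neg_eq]
  have h2 := (tendsto_finsetProd (Finset.range m) fun j _ => h (j + 1)).mul_const
    (m.factorial : ℝ)⁻¹
  rw [← Nat.cast_prod, Finset.prod_range_add_one_eq_factorial,
    mul_inv_cancel₀ (Nat.cast_ne_zero.2 (Nat.factorial_ne_zero m))] at h2
  exact h2

/-- The value of `F_{⊇S}` at `t = 1`. -/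
def limitSum {K : Type*} [Field K] (n : ℕ) (S : Finset (Corner μ)) (x : K) : K :=
  ∑ s ∈ S, (∏ r ∈ S.erase s, (1 - x ^ (r.1.2 + 1) / x ^ (s.1.2 + 1))⁻¹) *
    (n.factorial * ∏ i ∈ Finset.range (μ.colLen 0), factorialRatio x ((predecessor s).rowLen i))

lemma tendsto_limitSum (n : ℕ) {S : Finset (Corner μ)} (hS : S.Nonempty) :
    Filter.Tendsto (fun x : ℝ => limitSum n S x) (𝓝[≠] 1) (𝓝 (n.factorial / S.card)) := by
  have h1 := tendsto_divided (z := fun s : Corner μ => s.1.2 + 1) hS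
    (fun s _ r _ h => Corner.eq_of_snd_eq (Nat.succ_injective h)) fun s _ => Nat.succ_pos _
  have h2 := tendsto_finsetProd (Finset.range (μ.colLen 0)) fun i _ =>
    tendsto_factorialRatio (μ.rowLen i)
  have h3 := (h2.const_mul (n.factorial : ℝ)).mul h1
  rw [Finset.prod_const_one, mul_one, mul_one_div] at h3
  refine h3.congr' ?_
  have hxpos : ∀ᶠ x in 𝓝[≠] (1 : ℝ), 0 < x :=
    nhdsWithin_le_nhds (lt_mem_nhds one_pos)
  filter_upwards [hxpos, self_mem_nhdsWithin] with x hx0 hx1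
  rw [limitSum, Finset.mul_sum]
  refine Finset.sum_congr rfl fun s _ => ?_
  rw [prod_factorialRatio_predecessor hx0 hx1]
  ring

-- From rational functions in q to real values.

universe u

variable {F L : Type u} [Field F] [Field L] {f : F →+* L} {a : L}

lemma HasValue.factorialRatio [CharZero L] {x : RatFunc F} {b : L} (hx : HasValue f a x b)
    (hb : b ≠ 1) (m : ℕ) : HasValue f a (factorialRatio x m) (SciFi.factorialRatio b m) :=
  (HasValue.prod fun j _ => (HasValue.one.sub (hx.pow (j + 1))).div (HasValue.one.sub hx)
    (sub_ne_zero.2 hb.symm)).mul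
      ((HasValue.natCast _).inv (Nat.cast_ne_zero.2 (Nat.factorial_ne_zero m)))

/-- Distinct corners have distinct columns, so injectivity of m ↦ b^m keeps every denominator away
from 0. -/
lemma HasValue.limitSum [CharZero L] {x : RatFunc F} {b : L} (hx : HasValue f a x b)
    (hb0 : b ≠ 0) (hb : Function.Injective fun m : ℕ => b ^ m) (n : ℕ) (S : Finset (Corner μ)) :
    HasValue f a (limitSum n S x) (SciFi.limitSum n S b) := by
  have hb1 : b ≠ 1 := fun h => zero_ne_one (hb (by simp [h]) : 0 = 1)
  refine HasValue.sum fun s _ => HasValue.mul (HasValue.prod fun r hr => HasValue.inv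
    (HasValue.one.sub ((hx.pow _).div (hx.pow _) (pow_ne_zero _ hb0))) ?_)
    ((HasValue.natCast _).mul (HasValue.prod fun i _ => hx.factorialRatio hb1 _))
  rw [sub_ne_zero, ne_comm, Ne, div_eq_one_iff_eq (pow_ne_zero _ hb0)]
  exact fun h => (Finset.mem_erase.1 hr).1 (Corner.eq_of_snd_eq (Nat.succ_injective (hb h)))

lemma X_pow_injective (F : Type*) [Field F] [CharZero F] :
    Function.Injective fun m : ℕ => (RatFunc.X : RatFunc F) ^ m := by
  intro m k h
  have h1 : (RatFunc.X : RatFunc F) ^ m = RatFunc.X ^ k := h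
  have h2 := (HasValue.var (f := RingHom.id F) (a := 2)).pow m
  have h3 := (HasValue.var (f := RingHom.id F) (a := 2)).pow k
  rw [h1] at h2
  have h4 : (2 : F) ^ m = 2 ^ k := h2.2.symm.trans h3.2
  exact Nat.pow_right_injective le_rfl (by exact_mod_cast h4)

lemma hasValueOne_hilbertF {n : ℕ} (hμ : μ.card = n + 1) (S : Finset (Corner μ)) :
    HasValueOne (hilbertF ℚ n S) (limitSum n S (RatFunc.X : RatFunc ℚ)) := by
  have hinj := X_pow_injective ℚ
  have hX : (RatFunc.X : RatFunc ℚ) ≠ 0 := RatFunc.X_ne_zero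
  have hq : ∀ k : ℕ, 0 < k → (RatFunc.X : RatFunc ℚ) ^ k ≠ 1 := fun k hk h =>
    hk.ne' (hinj (by simpa using h))
  have hqq : HasValueOne (qq ℚ) (RatFunc.X : RatFunc ℚ) := HasValue.const (f := RingHom.id _) _
  have htt : HasValueOne (tt ℚ) (1 : RatFunc ℚ) := HasValue.var
  refine HasValue.sum fun s _ => HasValue.mul (HasValue.prod fun r hr => HasValue.inv
    (HasValue.one.sub ?_) ?_) ?_
  · rw [T_predecessor_div (by simpa [qq] using hX) RatFunc.X_ne_zero]
    have := ((htt.pow r.1.1).mul (hqq.pow r.1.2)).div ((htt.pow s.1.1).mul (hqq.pow s.1.2))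
      (by simp [hX])
    -- Both exponents are raised by one, because `limitSum` counts columns from 1.
    rwa [one_pow, one_mul, one_pow, one_mul, ← mul_div_mul_right _ _ hX, ← pow_succ,
      ← pow_succ] at this
  · rw [sub_ne_zero, ne_comm, Ne, div_eq_one_iff_eq (pow_ne_zero _ hX)]
    exact fun h => (Finset.mem_erase.1 hr).1 (Corner.eq_of_snd_eq (Nat.succ_injective (hinj h)))
  · have h1 := card_predecessor s
    have h2 := hasValueOne_modifiedH hq (n := n) (predecessor s) (by omega)
    rwa [prod_arm_eq _ _ (colLen_predecessor_le s)] at h2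

/-- `F_{⊇S}(q, t)` is regular at `t = 1`, and its value there tends to `n! / k` as `q → 1`. -/
theorem tendsto_hilbertF {n : ℕ} (hμ : μ.card = n + 1) {S : Finset (Corner μ)}
    (hS : S.Nonempty) :
    Polynomial.eval 1 (RatFunc.denom (hilbertF ℚ n S)) ≠ 0 ∧
      Filter.Tendsto
        (fun x : ℝ => RatFunc.eval (algebraMap ℚ ℝ) x
          (RatFunc.eval (RingHom.id (RatFunc ℚ)) 1 (hilbertF ℚ n S)))
        (𝓝[≠] 1) (𝓝 ((n.factorial : ℝ) / S.card)) := by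
  obtain ⟨h1, h2⟩ := hasValueOne_hilbertF hμ S
  refine ⟨h1, (tendsto_limitSum n hS).congr' ?_⟩
  have hxpos : ∀ᶠ x in 𝓝[≠] (1 : ℝ), 0 < x :=
    nhdsWithin_le_nhds (lt_mem_nhds one_pos)
  filter_upwards [hxpos, self_mem_nhdsWithin] with x hx0 hx1
  rw [h2]
  exact ((HasValue.var (f := algebraMap ℚ ℝ) (a := x)).limitSum hx0.ne'
    (pow_right_injective₀ hx0 hx1) n S).2.symm

end Corners

/-! ## Characters of bigraded modules -/

section Characters

variable {𝕜 : Type*} [Field 𝕜] {n : ℕ}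

/-- The bidegrees of the variables. -/
abbrev biweight (n : ℕ) : Fin n ⊕ Fin n → ℕ × ℕ := Sum.elim (fun _ => (1, 0)) fun _ => (0, 1)

/-- The bihomogeneous component of bidegree `d`. -/
abbrev bicomp (𝕜 : Type*) [Field 𝕜] (n : ℕ) (d : ℕ × ℕ) : Poly 𝕜 n →ₗ[𝕜] Poly 𝕜 n :=
  weightedHomogeneousComponent (biweight n) d

lemma mem_bihom {d : ℕ × ℕ} {f : Poly 𝕜 n} :
    f ∈ bihom 𝕜 n d ↔ ∀ c, coeff c f ≠ 0 → Finsupp.weight (biweight n) c = d :=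
  ⟨fun h _ hc => h hc, fun h _ hc => h _ hc⟩

lemma bicomp_of_mem {d : ℕ × ℕ} {f : Poly 𝕜 n} (hf : f ∈ bihom 𝕜 n d) (e : ℕ × ℕ) :
    bicomp 𝕜 n e f = if e = d then f else 0 :=
  weightedHomogeneousComponent_of_mem hf

lemma bicomp_mem (d : ℕ × ℕ) (f : Poly 𝕜 n) : bicomp 𝕜 n d f ∈ bihom 𝕜 n d :=
  weightedHomogeneousComponent_mem _ _ _

lemma weight_fst_add_snd (c : Fin n ⊕ Fin n →₀ ℕ) :
    (Finsupp.weight (biweight n) c).1 + (Finsupp.weight (biweight n) c).2 = c.degree := by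
  induction c using Finsupp.induction_linear with
  | zero => simp
  | add c d hc hd => rw [map_add, map_add, ← hc, ← hd, Prod.fst_add, Prod.snd_add]; omega
  | single v m => cases v <;> simp [Finsupp.weight_single]

/-- Submodules spanned by bihomogeneous elements. -/
def IsGraded (W : Submodule 𝕜 (Poly 𝕜 n)) : Prop := ∀ f ∈ W, ∀ d, bicomp 𝕜 n d f ∈ W

lemma isGraded_span {B : Set (Poly 𝕜 n)} (hB : ∀ b ∈ B, ∃ d, b ∈ bihom 𝕜 n d) :
    IsGraded (Submodule.span 𝕜 B) := by
  intro f hf e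
  have : Submodule.span 𝕜 B ≤ (Submodule.span 𝕜 B).comap (bicomp 𝕜 n e) := by
    refine Submodule.span_le.2 fun b hb => ?_
    obtain ⟨d, hd⟩ := hB b hb
    rw [SetLike.mem_coe, Submodule.mem_comap, bicomp_of_mem hd]
    split_ifs
    · exact Submodule.subset_span hb
    · exact zero_mem _
  exact this hf

/-- Bigraded submodules of bounded degree with an action of the symmetric group. -/
structure IsTame (N : ℕ) (W : Submodule 𝕜 (Poly 𝕜 n)) : Prop where
  invariant : IsInvariant W
  graded : IsGraded W
  bounded : W ≤ restrictTotalDegree _ 𝕜 N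

lemma IsTame.finite {N : ℕ} {W : Submodule 𝕜 (Poly 𝕜 n)} (h : IsTame N W) :
    Module.Finite 𝕜 W :=
  Module.Finite.of_injective (Submodule.inclusion h.bounded) (Submodule.inclusion_injective _)

lemma IsTame.finite_inf {N : ℕ} {W : Submodule 𝕜 (Poly 𝕜 n)} (h : IsTame N W)
    (V : Submodule 𝕜 (Poly 𝕜 n)) : Module.Finite 𝕜 (W ⊓ V : Submodule 𝕜 (Poly 𝕜 n)) :=
  have := h.finite
  Module.Finite.of_injective (Submodule.inclusion inf_le_left) (Submodule.inclusion_injective _)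

lemma isTame_sup {N : ℕ} {U W : Submodule 𝕜 (Poly 𝕜 n)} (hU : IsTame N U) (hW : IsTame N W) :
    IsTame N (U ⊔ W) where
  invariant σ f hf := by
    obtain ⟨u, hu, w, hw, rfl⟩ := Submodule.mem_sup.1 hf
    rw [map_add]
    exact Submodule.add_mem_sup (hU.invariant σ u hu) (hW.invariant σ w hw)
  graded f hf d := by
    obtain ⟨u, hu, w, hw, rfl⟩ := Submodule.mem_sup.1 hf
    rw [map_add]
    exact Submodule.add_mem_sup (hU.graded u hu d) (hW.graded w hw d)
  bounded := sup_le hU.bounded hW.bounded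

lemma weight_mapDomain (σ : Equiv.Perm (Fin n)) (c : Fin n ⊕ Fin n →₀ ℕ) :
    Finsupp.weight (biweight n) (c.mapDomain (Sum.map σ σ)) = Finsupp.weight (biweight n) c := by
  induction c using Finsupp.induction_linear with
  | zero => simp
  | add c d hc hd => rw [Finsupp.mapDomain_add, map_add, map_add, hc, hd]
  | single v m => cases v <;> simp [Finsupp.weight_single]

lemma act_mem_bihom (σ : Equiv.Perm (Fin n)) {d : ℕ × ℕ} {f : Poly 𝕜 n}
    (hf : f ∈ bihom 𝕜 n d) : act σ f ∈ bihom 𝕜 n d := by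
  refine mem_bihom.2 fun c hc => ?_
  obtain ⟨a, rfl, ha⟩ := coeff_rename_ne_zero _ _ _ hc
  rw [weight_mapDomain, mem_bihom.1 hf a ha]

lemma inf_bihom_act {U : Submodule 𝕜 (Poly 𝕜 n)} (hU : IsInvariant U) (d : ℕ × ℕ)
    (σ : Equiv.Perm (Fin n)) : ∀ f ∈ U ⊓ bihom 𝕜 n d, act σ f ∈ U ⊓ bihom 𝕜 n d :=
  fun f hf => ⟨hU σ f hf.1, act_mem_bihom σ hf.2⟩

lemma inf_bihom_eq_bot {N : ℕ} {W : Submodule 𝕜 (Poly 𝕜 n)}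
    (hW : W ≤ restrictTotalDegree _ 𝕜 N) {d : ℕ × ℕ} (hd : N < d.1 + d.2) :
    W ⊓ bihom 𝕜 n d = ⊥ := by
  refine (Submodule.eq_bot_iff _).2 fun f hf => ?_
  by_contra h0
  obtain ⟨c, hc⟩ := MvPolynomial.ne_zero_iff.1 h0
  have h1 := mem_bihom.1 hf.2 c hc
  have h2 := weight_fst_add_snd c
  have h3 := (mem_restrictTotalDegree _ _ _).1 (hW hf.1)
  have h4 : c.degree ≤ totalDegree f := le_totalDegree (mem_support_iff.2 hc)
  rw [h1] at h2
  omega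

variable {σ : Equiv.Perm (Fin n)}

/-- The scalar r allows for equivariance up to a factor: 1 for isomorphisms, the sign of σ for the
flip. -/
lemma character_congr {V W : Submodule 𝕜 (Poly 𝕜 n)} (e : V ≃ₗ[𝕜] W) (r : 𝕜)
    (hV : ∀ f ∈ V, act σ f ∈ V)
    (h : ∀ f : V, act σ (e f : Poly 𝕜 n) = r • (e ⟨act σ f, hV f f.2⟩ : Poly 𝕜 n)) :
    character W σ = r * character V σ := by
  have hW : ∀ f ∈ W, act σ f ∈ W := fun f hf => by
    have := h (e.symm ⟨f, hf⟩)
    rw [LinearEquiv.apply_symm_apply] at this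
    rw [this]
    exact W.smul_mem _ (Subtype.mem _)
  rw [character, character, dif_pos hV, dif_pos hW, ← LinearMap.trace_conj' _ e, ← smul_eq_mul,
    ← map_smul]
  congr 1
  ext f
  have := h (e.symm f)
  rw [LinearEquiv.apply_symm_apply] at this
  exact congrArg _ this

lemma character_bot : character (⊥ : Submodule 𝕜 (Poly 𝕜 n)) σ = 0 := by
  rw [character, dif_pos fun f hf => by rw [(Submodule.mem_bot 𝕜).1 hf, map_zero]; exact zero_mem _]
  rw [Subsingleton.elim ((act σ).restrict _) 0, map_zero]

/-- For disjoint subspaces the sum is equivariantly their product, on which traces add. -/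
lemma character_sup {U W : Submodule 𝕜 (Poly 𝕜 n)} [Module.Finite 𝕜 U] [Module.Finite 𝕜 W]
    (hU : ∀ f ∈ U, act σ f ∈ U) (hW : ∀ f ∈ W, act σ f ∈ W) (hd : Disjoint U W) :
    character (U ⊔ W) σ = character U σ + character W σ := by
  have hUW : ∀ f ∈ U ⊔ W, act σ f ∈ U ⊔ W := fun f hf => by
    obtain ⟨u, hu, w, hw, rfl⟩ := Submodule.mem_sup.1 hf
    rw [map_add]
    exact Submodule.add_mem_sup (hU u hu) (hW w hw)
  let e₀ := (Submodule.inclusion (le_sup_left : U ≤ U ⊔ W)).coprod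
    (Submodule.inclusion (le_sup_right : W ≤ U ⊔ W))
  have he₀ : Function.Bijective e₀ := by
    constructor
    · rw [← LinearMap.ker_eq_bot, LinearMap.ker_eq_bot']
      rintro ⟨u, w⟩ h
      have h1 : (u : Poly 𝕜 n) + w = 0 := congrArg Subtype.val h
      have h2 : (u : Poly 𝕜 n) = 0 := Submodule.disjoint_def.1 hd u u.2
        (by rw [eq_neg_of_add_eq_zero_left h1]; exact neg_mem w.2)
      rw [h2, zero_add] at h1
      exact Prod.ext (Subtype.ext h2) (Subtype.ext h1)
    · rintro ⟨f, hf⟩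
      obtain ⟨u, hu, w, hw, rfl⟩ := Submodule.mem_sup.1 hf
      exact ⟨(⟨u, hu⟩, ⟨w, hw⟩), rfl⟩
  let e := LinearEquiv.ofBijective e₀ he₀
  rw [character, character, character, dif_pos hU, dif_pos hW, dif_pos hUW,
    ← LinearMap.trace_prodMap', ← LinearMap.trace_conj' _ e]
  congr 1
  refine LinearMap.ext fun x => ?_
  obtain ⟨⟨u, w⟩, rfl⟩ := e.surjective x
  rw [LinearEquiv.conj_apply_apply, LinearEquiv.symm_apply_apply]
  exact Subtype.ext (map_add (act σ) (u : Poly 𝕜 n) w)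

lemma bigradedCharacter_eq_sum {N : ℕ} {W : Submodule 𝕜 (Poly 𝕜 n)}
    (hW : W ≤ restrictTotalDegree _ 𝕜 N) :
    bigradedCharacter W σ = ∑ d ∈ Finset.Iic (N, N), tt 𝕜 ^ d.1 * qq 𝕜 ^ d.2 *
      RatFunc.C (RatFunc.C (character (W ⊓ bihom 𝕜 n d) σ)) := by
  refine finsum_eq_sum_of_support_subset _ fun d hd => ?_
  rw [Finset.coe_Iic, Set.mem_Iic]
  by_contra h
  refine hd ?_
  have : N < d.1 + d.2 := by
    rw [Prod.le_def] at h
    simp only [not_and_or, not_le] at h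
    omega
  simp [inf_bihom_eq_bot hW this, character_bot]

lemma sup_inf_bihom {U W : Submodule 𝕜 (Poly 𝕜 n)} (hU : IsGraded U) (hW : IsGraded W)
    (d : ℕ × ℕ) : (U ⊔ W) ⊓ bihom 𝕜 n d = U ⊓ bihom 𝕜 n d ⊔ W ⊓ bihom 𝕜 n d := by
  refine le_antisymm ?_ (le_inf (sup_le_sup inf_le_left inf_le_left)
    (sup_le inf_le_right inf_le_right))
  rintro f ⟨hf, hfd⟩
  obtain ⟨u, hu, w, hw, rfl⟩ := Submodule.mem_sup.1 hf
  have h := bicomp_of_mem hfd d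
  rw [if_pos rfl, map_add] at h
  rw [← h]
  exact Submodule.add_mem_sup ⟨hU u hu d, bicomp_mem d u⟩ ⟨hW w hw d, bicomp_mem d w⟩

lemma bigradedCharacter_sup {N : ℕ} {U W : Submodule 𝕜 (Poly 𝕜 n)} (hU : IsTame N U)
    (hW : IsTame N W) (hd : Disjoint U W) :
    bigradedCharacter (U ⊔ W) σ = bigradedCharacter U σ + bigradedCharacter W σ := by
  rw [bigradedCharacter_eq_sum (isTame_sup hU hW).bounded, bigradedCharacter_eq_sum hU.bounded,
    bigradedCharacter_eq_sum hW.bounded, ← Finset.sum_add_distrib]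
  refine Finset.sum_congr rfl fun d _ => ?_
  have := hU.finite_inf (bihom 𝕜 n d)
  have := hW.finite_inf (bihom 𝕜 n d)
  rw [sup_inf_bihom hU.graded hW.graded, character_sup (inf_bihom_act hU.invariant d σ)
    (inf_bihom_act hW.invariant d σ) (hd.mono inf_le_left inf_le_left), map_add, map_add, mul_add]

lemma bigradedCharacter_congr {V W : Submodule 𝕜 (Poly 𝕜 n)} (hV : IsInvariant V)
    (h : BigradedIso V W) : bigradedCharacter V σ = bigradedCharacter W σ := by
  obtain ⟨e, he, hd⟩ := h
  refine finsum_congr fun d => ?_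
  congr 3
  let e' : (V ⊓ bihom 𝕜 n d : Submodule 𝕜 (Poly 𝕜 n)) ≃ₗ[𝕜]
      (W ⊓ bihom 𝕜 n d : Submodule 𝕜 (Poly 𝕜 n)) :=
    { toFun := fun f => ⟨e ⟨f, f.2.1⟩, (e ⟨f, f.2.1⟩).2, (hd d _).1 f.2.2⟩
      invFun := fun f => ⟨e.symm ⟨f, f.2.1⟩, (e.symm ⟨f, f.2.1⟩).2,
        (hd d _).2 (by rw [LinearEquiv.apply_symm_apply]; exact f.2.2)⟩
      map_add' := fun f g => Subtype.ext (congrArg Subtype.val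
        (map_add e ⟨f, f.2.1⟩ ⟨g, g.2.1⟩) : _)
      map_smul' := fun r f => Subtype.ext (congrArg Subtype.val (map_smul e r ⟨f, f.2.1⟩) : _)
      left_inv := fun f => Subtype.ext (congrArg Subtype.val (e.symm_apply_apply ⟨f, f.2.1⟩) : _)
      right_inv := fun f => Subtype.ext (congrArg Subtype.val (e.apply_symm_apply ⟨f, f.2.1⟩) : _) }
  have := character_congr (σ := σ) e' 1 (inf_bihom_act hV d σ) fun f => by
    rw [one_smul]
    exact (he σ ⟨f, f.2.1⟩ ⟨act σ f, hV σ f f.2.1⟩ rfl).symm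
  rw [this, one_mul]

end Characters

/-! ## Differential operators and the flip -/

section Flip

variable {𝕜 : Type*} [Field 𝕜] {n : ℕ}

/-- The product of the factorials of the exponents. -/
def multiFactorial (c : Fin n ⊕ Fin n →₀ ℕ) : ℕ := ∏ v, (c v).factorial

/-- Coefficients multiplied by the factorials of their exponents are merely shifted by
differentiation. -/
lemma multiFactorial_mul_coeff_iterate (k : Fin n ⊕ Fin n) (m : ℕ) (f : Poly 𝕜 n)
    (c : Fin n ⊕ Fin n →₀ ℕ) :
    (multiFactorial c : 𝕜) * coeff c ((pderiv k)^[m] f) =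
      (multiFactorial (c + Finsupp.single k m) : 𝕜) * coeff (c + Finsupp.single k m) f := by
  rw [multiFactorial, multiFactorial, ← Finset.mul_prod_erase _ _ (Finset.mem_univ k),
    ← Finset.mul_prod_erase _ (fun v => ((c + Finsupp.single k m) v).factorial)
      (Finset.mem_univ k)]
  have h1 : ∏ v ∈ Finset.univ.erase k, ((c + Finsupp.single k m) v).factorial =
      ∏ v ∈ Finset.univ.erase k, (c v).factorial := by
    refine Finset.prod_congr rfl fun v hv => ?_
    rw [Finsupp.add_apply, Finsupp.single_eq_of_ne (Finset.mem_erase.1 hv).1, add_zero]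
  have h3 : (c + Finsupp.single k m) k = c k + m := by simp
  rw [h1, h3]
  push_cast
  have h2 := coeff_iterate_pderiv k m f c
  linear_combination (∏ v ∈ Finset.univ.erase k, ((c v).factorial : 𝕜)) * h2

lemma multiFactorial_mul_coeff (a : Fin n ⊕ Fin n →₀ ℕ) (f : Poly 𝕜 n)
    (c : Fin n ⊕ Fin n →₀ ℕ) :
    (multiFactorial c : 𝕜) * coeff c (partialD a f) =
      (multiFactorial (c + a) : 𝕜) * coeff (c + a) f := by
  have key : ∀ (l : List (Fin n)) (c : Fin n ⊕ Fin n →₀ ℕ),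
      (multiFactorial c : 𝕜) * coeff c (l.foldr (fun i g =>
        (pderiv (Sum.inl i))^[a (Sum.inl i)] ((pderiv (Sum.inr i))^[a (Sum.inr i)] g)) f) =
      (multiFactorial (c + (l.map fun i => Finsupp.single (Sum.inl i) (a (Sum.inl i)) +
        Finsupp.single (Sum.inr i) (a (Sum.inr i))).sum) : 𝕜) *
        coeff (c + (l.map fun i => Finsupp.single (Sum.inl i) (a (Sum.inl i)) +
        Finsupp.single (Sum.inr i) (a (Sum.inr i))).sum) f := by
    intro l
    induction l with
    | nil => simp
    | cons i l ih =>
      intro c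
      rw [List.foldr_cons, multiFactorial_mul_coeff_iterate, multiFactorial_mul_coeff_iterate, ih,
        List.map_cons, List.sum_cons, ← add_assoc c, ← add_assoc c]
  have h := key (List.finRange n) c
  rw [← Fin.sum_univ_def, Finset.sum_add_distrib, ← Fintype.sum_sum_type
    (fun v => Finsupp.single v (a v)), Finsupp.univ_sum_single] at h
  exact h

variable [CharZero 𝕜]

lemma multiFactorial_ne_zero (c : Fin n ⊕ Fin n →₀ ℕ) : (multiFactorial c : 𝕜) ≠ 0 :=
  Nat.cast_ne_zero.2 (Finset.prod_ne_zero_iff.2 fun _ _ => Nat.factorial_ne_zero _)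

/-- In characteristic zero the shift rule determines the derivative. Identities for ∂^a can thus be
checked on coefficients, without unfolding the iteration. -/
lemma eq_partialD {a : Fin n ⊕ Fin n →₀ ℕ} {f g : Poly 𝕜 n}
    (h : ∀ c, (multiFactorial c : 𝕜) * coeff c g =
      (multiFactorial (c + a) : 𝕜) * coeff (c + a) f) : g = partialD a f := by
  ext c
  refine mul_left_cancel₀ (multiFactorial_ne_zero c) ?_
  rw [h, multiFactorial_mul_coeff]

lemma coeff_partialD_ne_zero {a c : Fin n ⊕ Fin n →₀ ℕ} {f : Poly 𝕜 n}
    (h : coeff c (partialD a f) ≠ 0) : coeff (c + a) f ≠ 0 := by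
  intro h0
  have := multiFactorial_mul_coeff a f c
  rw [h0, mul_zero] at this
  exact mul_ne_zero (multiFactorial_ne_zero c) h this

lemma totalDegree_partialD_le (a : Fin n ⊕ Fin n →₀ ℕ) (f : Poly 𝕜 n) :
    totalDegree (partialD a f) ≤ totalDegree f := by
  refine Finset.sup_le fun c hc => ?_
  have h1 : (c + a).degree ≤ totalDegree f :=
    le_totalDegree (mem_support_iff.2 (coeff_partialD_ne_zero (mem_support_iff.1 hc)))
  rw [map_add] at h1
  exact (Nat.le_add_right _ _).trans h1

lemma partialD_smul (a : Fin n ⊕ Fin n →₀ ℕ) (r : 𝕜) (f : Poly 𝕜 n) :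
    partialD a (r • f) = r • partialD a f := by
  refine (eq_partialD fun c => ?_).symm
  rw [coeff_smul, coeff_smul, smul_eq_mul, smul_eq_mul, mul_left_comm, multiFactorial_mul_coeff,
    mul_left_comm]

omit [CharZero 𝕜] in
lemma multiFactorial_mapDomain (σ : Equiv.Perm (Fin n)) (c : Fin n ⊕ Fin n →₀ ℕ) :
    multiFactorial (c.mapDomain (Sum.map σ σ)) = multiFactorial c := by
  have hinj : Function.Injective (Sum.map σ σ) := Sum.map_injective.2 ⟨σ.injective, σ.injective⟩
  rw [multiFactorial, ← Equiv.prod_comp (Equiv.sumCongr σ σ)]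
  refine Finset.prod_congr rfl fun v _ => ?_
  exact congrArg _ (Finsupp.mapDomain_apply hinj c v)

lemma act_partialD (σ : Equiv.Perm (Fin n)) (a : Fin n ⊕ Fin n →₀ ℕ) (f : Poly 𝕜 n) :
    act σ (partialD a f) = partialD (a.mapDomain (Sum.map σ σ)) (act σ f) := by
  have hinj : Function.Injective (Sum.map σ σ) := Sum.map_injective.2 ⟨σ.injective, σ.injective⟩
  refine eq_partialD fun c => ?_
  obtain ⟨c, rfl⟩ : ∃ c', c = Finsupp.mapDomain (Sum.map σ σ) c' := by
    refine ⟨c.mapDomain (Sum.map σ.symm σ.symm), ?_⟩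
    rw [← Finsupp.mapDomain_comp, Sum.map_comp_map]
    simp
  rw [← Finsupp.mapDomain_add, multiFactorial_mapDomain, multiFactorial_mapDomain]
  have h1 : ∀ (c : Fin n ⊕ Fin n →₀ ℕ) (g : Poly 𝕜 n),
      coeff (c.mapDomain (Sum.map σ σ)) (act σ g) = coeff c g := fun c g =>
    coeff_rename_mapDomain _ hinj g c
  rw [h1, h1, multiFactorial_mul_coeff]

omit [CharZero 𝕜] in
lemma applyD_eq_sum (P f : Poly 𝕜 n) {s : Finset (Fin n ⊕ Fin n →₀ ℕ)} (hs : P.support ⊆ s) :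
    applyD P f = ∑ a ∈ s, coeff a P • partialD a f := by
  refine Finset.sum_subset hs fun a _ ha => ?_
  rw [notMem_support_iff.1 ha, zero_smul]

/-- `P ↦ P(∂) f`. -/
def applyHom (f : Poly 𝕜 n) : Poly 𝕜 n →ₗ[𝕜] Poly 𝕜 n where
  toFun P := applyD P f
  map_add' P Q := by
    classical
    rw [applyD_eq_sum (P + Q) f support_add, applyD_eq_sum P f Finset.subset_union_left,
      applyD_eq_sum Q f Finset.subset_union_right, ← Finset.sum_add_distrib]
    exact Finset.sum_congr rfl fun a _ => by rw [coeff_add, add_smul]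
  map_smul' r P := by
    rw [applyD_eq_sum (r • P) f support_smul, applyD, RingHom.id_apply, Finset.smul_sum]
    exact Finset.sum_congr rfl fun a _ => by rw [coeff_smul, smul_assoc]

omit [CharZero 𝕜] in
lemma applyHom_monomial (f : Poly 𝕜 n) (a : Fin n ⊕ Fin n →₀ ℕ) (r : 𝕜) :
    applyHom f (monomial a r) = r • partialD a f := by
  change applyD (monomial a r) f = _
  rw [applyD_eq_sum _ f support_monomial_subset, Finset.sum_singleton, coeff_monomial, if_pos rfl]

omit [CharZero 𝕜] in
lemma flip_eq_map (D : Poly 𝕜 n) (U : Submodule 𝕜 (Poly 𝕜 n)) : flip D U = U.map (applyHom D) := by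
  have : {g | ∃ P ∈ U, g = applyD P D} = (U.map (applyHom D) : Set (Poly 𝕜 n)) := by
    ext g
    exact ⟨fun ⟨P, hP, h⟩ => ⟨P, hP, h.symm⟩, fun ⟨P, hP, h⟩ => ⟨P, hP, h.symm⟩⟩
  rw [flip, this, Submodule.span_eq]

lemma act_applyHom (σ : Equiv.Perm (Fin n)) (P f : Poly 𝕜 n) :
    act σ (applyHom f P) = applyHom (act σ f) (act σ P) := by
  induction P using MvPolynomial.induction_on' with
  | monomial a r =>
    have h1 : act σ (monomial a r : Poly 𝕜 n) = monomial (a.mapDomain (Sum.map σ σ)) r :=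
      rename_monomial _ _ _
    rw [h1, applyHom_monomial, applyHom_monomial, map_smul, act_partialD]
  | add P Q hP hQ => simp only [map_add, hP, hQ]

lemma applyHom_smul (r : 𝕜) (f P : Poly 𝕜 n) : applyHom (r • f) P = r • applyHom f P := by
  change applyD P (r • f) = r • applyD P f
  rw [applyD, applyD, Finset.smul_sum]
  exact Finset.sum_congr rfl fun a _ => by rw [partialD_smul, smul_comm]

/-- A monomial operator of bidegree e lowers the bidegree D of f by e, so the component of bidegree
d comes from e = D - d. -/
lemma bicomp_applyHom {D : ℕ × ℕ} {f : Poly 𝕜 n} (hf : f ∈ bihom 𝕜 n D) (d : ℕ × ℕ)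
    (P : Poly 𝕜 n) : bicomp 𝕜 n d (applyHom f P) =
      if d ≤ D then applyHom f (bicomp 𝕜 n (D - d) P) else 0 := by
  induction P using MvPolynomial.induction_on' with
  | monomial a r =>
    have h1 : (monomial a r : Poly 𝕜 n) ∈ bihom 𝕜 n (Finsupp.weight (biweight n) a) :=
      isWeightedHomogeneous_monomial _ _ _ rfl
    rw [bicomp_of_mem h1, applyHom_monomial]
    ext c
    rw [coeff_weightedHomogeneousComponent, coeff_smul]
    by_cases h0 : coeff c (partialD a f) = 0
    · rw [h0, smul_zero, ite_self]
      split_ifs <;> simp [applyHom_monomial, h0]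
    · have h2 := mem_bihom.1 hf _ (coeff_partialD_ne_zero h0)
      rw [map_add] at h2
      by_cases hd : d ≤ D
      · rw [if_pos hd]
        by_cases hc : Finsupp.weight (biweight n) c = d
        · rw [if_pos hc, if_pos, applyHom_monomial, coeff_smul]
          rw [← h2, hc, add_tsub_cancel_left]
        · rw [if_neg hc, if_neg, map_zero, coeff_zero]
          intro h
          rw [← h, ← add_tsub_cancel_of_le hd] at h2
          rw [add_tsub_cancel_of_le hd] at h2
          refine hc (add_right_cancel (b := D - d) ?_)
          rw [h2, add_tsub_cancel_of_le hd]
      · rw [if_neg hd, coeff_zero, if_neg]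
        rintro rfl
        exact hd (h2 ▸ le_self_add)
  | add P Q hP hQ =>
    simp only [map_add, hP, hQ]
    split_ifs <;> simp

/-! ### Characters under the flip. -/

/-- The bigraded character with `q`, `t` inverted. -/
def dualCharacter (W : Submodule 𝕜 (Poly 𝕜 n)) (σ : Equiv.Perm (Fin n)) : Coef 𝕜 :=
  ∑ᶠ d : ℕ × ℕ, (tt 𝕜)⁻¹ ^ d.1 * (qq 𝕜)⁻¹ ^ d.2 *
    RatFunc.C (RatFunc.C (character (W ⊓ bihom 𝕜 n d) σ))

omit [CharZero 𝕜] in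
lemma qq_ne_zero : qq 𝕜 ≠ 0 := by simp [qq, RatFunc.X_ne_zero]

omit [CharZero 𝕜] in
lemma tt_ne_zero : tt 𝕜 ≠ 0 := RatFunc.X_ne_zero

/-- The flip with respect to an alternating bihomogeneous polynomial reverses the degrees and twists
by the sign. -/
theorem bigradedCharacter_flip {U : Submodule 𝕜 (Poly 𝕜 n)} (hU : IsInvariant U)
    (hgr : IsGraded U) {D : ℕ × ℕ} {f : Poly 𝕜 n} (hf : f ∈ bihom 𝕜 n D)
    {σ : Equiv.Perm (Fin n)} (hσ : act σ f = ((Equiv.Perm.sign σ : ℤ) : 𝕜) • f)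
    (hinj : ∀ P ∈ U, applyHom f P = 0 → P = 0) :
    bigradedCharacter (flip f U) σ =
      RatFunc.C (RatFunc.C ((Equiv.Perm.sign σ : ℤ) : 𝕜)) * (tt 𝕜 ^ D.1 * qq 𝕜 ^ D.2) *
        dualCharacter U σ := by
  -- An operator whose bidegree is not at most D kills f, so injectivity excludes such elements of
  -- U.
  have hgt : ∀ e : ℕ × ℕ, ¬ e ≤ D → U ⊓ bihom 𝕜 n e = ⊥ := by
    intro e he
    refine (Submodule.eq_bot_iff _).2 fun P hP => hinj P hP.1 ?_
    by_contra h0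
    obtain ⟨c, hc⟩ := MvPolynomial.ne_zero_iff.1 h0
    have h1 := bicomp_applyHom hf (Finsupp.weight (biweight n) c) P
    have h2 := congrArg (coeff c) h1
    rw [coeff_weightedHomogeneousComponent, if_pos rfl, bicomp_of_mem hP.2] at h2
    refine hc (h2.trans ?_)
    split_ifs with h3 h4
    · exact absurd (h4 ▸ tsub_le_self) he
    · simp
    · simp
  have hgt' : ∀ d : ℕ × ℕ, ¬ d ≤ D → flip f U ⊓ bihom 𝕜 n d = ⊥ := by
    intro d hd
    refine (Submodule.eq_bot_iff _).2 fun g hg => ?_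
    obtain ⟨hg1, hg2⟩ := hg
    rw [SetLike.mem_coe, flip_eq_map] at hg1
    obtain ⟨P, hP, rfl⟩ := hg1
    have h1 := bicomp_applyHom hf d P
    rwa [if_neg hd, bicomp_of_mem hg2, if_pos rfl] at h1
  -- The flip carries the component of U of bidegree D - d onto the component of the image of
  -- bidegree d; the sign comes from f being alternating.
  have hle : ∀ d : ℕ × ℕ, d ≤ D → character (flip f U ⊓ bihom 𝕜 n d) σ =
      ((Equiv.Perm.sign σ : ℤ) : 𝕜) * character (U ⊓ bihom 𝕜 n (D - d)) σ := by
    intro d hd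
    set U' := U ⊓ bihom 𝕜 n (D - d) with hU'
    have hr : flip f U ⊓ bihom 𝕜 n d = LinearMap.range ((applyHom f).domRestrict U') := by
      rw [LinearMap.range_domRestrict]
      refine le_antisymm ?_ ?_
      · rintro g ⟨hg1, hg2⟩
        rw [SetLike.mem_coe, flip_eq_map] at hg1
        obtain ⟨P, hP, rfl⟩ := hg1
        have h1 := bicomp_applyHom hf d P
        rw [if_pos hd, bicomp_of_mem hg2, if_pos rfl] at h1
        exact ⟨_, ⟨hgr P hP _, bicomp_mem _ _⟩, h1.symm⟩
      · rintro _ ⟨P, hP, rfl⟩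
        refine ⟨?_, ?_⟩
        · rw [SetLike.mem_coe, flip_eq_map]
          exact ⟨P, hP.1, rfl⟩
        · have h1 := bicomp_applyHom hf d P
          rw [if_pos hd, bicomp_of_mem hP.2, if_pos rfl] at h1
          rw [SetLike.mem_coe, ← h1]
          exact bicomp_mem _ _
    have hinj' : Function.Injective ((applyHom f).domRestrict U') := by
      rw [← LinearMap.ker_eq_bot, LinearMap.ker_eq_bot']
      exact fun P hP => Subtype.ext (hinj P P.2.1 hP)
    have hV := inf_bihom_act hU (D - d) σ
    rw [hr]
    refine character_congr (LinearEquiv.ofInjective _ hinj') _ hV fun P => ?_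
    change act σ (applyHom f P) = _ • applyHom f (act σ P)
    rw [act_applyHom, hσ, applyHom_smul]
  have h1 : bigradedCharacter (flip f U) σ = ∑ d ∈ Finset.Iic D, tt 𝕜 ^ d.1 * qq 𝕜 ^ d.2 *
      RatFunc.C (RatFunc.C (character (flip f U ⊓ bihom 𝕜 n d) σ)) := by
    refine finsum_eq_sum_of_support_subset _ fun d hd => ?_
    rw [Finset.coe_Iic, Set.mem_Iic]
    by_contra h
    exact hd (by simp [hgt' d h, character_bot])
  have h2 : dualCharacter U σ = ∑ d ∈ Finset.Iic D, (tt 𝕜)⁻¹ ^ d.1 * (qq 𝕜)⁻¹ ^ d.2 *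
      RatFunc.C (RatFunc.C (character (U ⊓ bihom 𝕜 n d) σ)) := by
    refine finsum_eq_sum_of_support_subset _ fun d hd => ?_
    rw [Finset.coe_Iic, Set.mem_Iic]
    by_contra h
    exact hd (by simp [hgt d h, character_bot])
  rw [h1, h2, Finset.mul_sum]
  refine Finset.sum_bij' (fun d _ => D - d) (fun d _ => D - d) (by simp) (by simp) ?_ ?_ ?_
  · intro d hd
    exact tsub_tsub_cancel_of_le (Finset.mem_Iic.1 hd)
  · intro d hd
    exact tsub_tsub_cancel_of_le (Finset.mem_Iic.1 hd)
  · intro d hd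
    have hd := Finset.mem_Iic.1 hd
    rw [hle d hd, map_mul, map_mul]
    have e1 : tt 𝕜 ^ d.1 = tt 𝕜 ^ D.1 * (tt 𝕜)⁻¹ ^ (D - d).1 := by
      rw [Prod.fst_sub, inv_pow, eq_mul_inv_iff_mul_eq₀ (pow_ne_zero _ tt_ne_zero), ← pow_add,
        add_tsub_cancel_of_le hd.1]
    have e2 : qq 𝕜 ^ d.2 = qq 𝕜 ^ D.2 * (qq 𝕜)⁻¹ ^ (D - d).2 := by
      rw [Prod.snd_sub, inv_pow, eq_mul_inv_iff_mul_eq₀ (pow_ne_zero _ qq_ne_zero), ← pow_add,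
        add_tsub_cancel_of_le hd.2]
    rw [e1, e2]
    ring

end Flip

/-! ## The Garsia–Haiman determinants -/

section Delta

variable {𝕜 : Type*} [Field 𝕜] {n : ℕ}

lemma prod_map_biexponents {M : Type*} [CommMonoid M] (ν : YoungDiagram) (f : ℕ × ℕ → M) :
    ((biexponents ν).map f).prod = ∏ c ∈ ν.cells, f c := by
  rw [prod_cells ν le_rfl, biexponents, List.map_flatMap, List.flatMap, List.prod_flatten,
    List.map_map]
  simp only [List.map_map, Function.comp_def]
  rfl

lemma length_biexponents (ν : YoungDiagram) : (biexponents ν).length = ν.card := by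
  have h := prod_map_biexponents ν fun _ => Multiplicative.ofAdd 1
  rw [List.map_const', List.prod_replicate, Finset.prod_const] at h
  simpa [← ofAdd_nsmul] using h

lemma prod_getD_biexponents {M : Type*} [CommMonoid M] {ν : YoungDiagram} (hν : ν.card = n)
    (f : ℕ × ℕ → M) :
    ∏ j : Fin n, f ((biexponents ν).getD j (0, 0)) = ∏ c ∈ ν.cells, f c := by
  rw [← prod_map_biexponents, ← List.prod_ofFn]
  congr 1
  have hl := (length_biexponents ν).trans hν
  refine List.ext_getElem (by simp [hl]) fun i h1 h2 => ?_
  rw [List.length_map] at h2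
  simp [h2]

/-- The bidegree of `Δ_ν`. -/
def topDegree (n : ℕ) (ν : YoungDiagram) : ℕ × ℕ :=
  ∑ j : Fin n, (biexponents ν).getD j (0, 0)

lemma T_eq_topDegree {K : Type*} [Field K] (q t : K) {ν : YoungDiagram} (hν : ν.card = n) :
    T q t ν = t ^ (topDegree n ν).1 * q ^ (topDegree n ν).2 := by
  rw [T, ← prod_getD_biexponents hν fun c => t ^ c.1 * q ^ c.2, Finset.prod_mul_distrib,
    Finset.prod_pow_eq_pow_sum, Finset.prod_pow_eq_pow_sum, topDegree, Prod.fst_sum, Prod.snd_sum]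

lemma garsiaHaimanDelta_mem (ν : YoungDiagram) :
    garsiaHaimanDelta 𝕜 n ν ∈ bihom 𝕜 n (topDegree n ν) := by
  rw [garsiaHaimanDelta, Matrix.det_apply]
  refine sum_mem fun σ _ => ?_
  rw [Units.smul_def]
  refine zsmul_mem (IsWeightedHomogeneous.prod _ _ _ fun i _ => ?_) _
  have h1 := (isWeightedHomogeneous_X 𝕜 (biweight n) (Sum.inl (σ i))).pow
    ((biexponents ν).getD i (0, 0)).1
  have h2 := (isWeightedHomogeneous_X 𝕜 (biweight n) (Sum.inr (σ i))).pow
    ((biexponents ν).getD i (0, 0)).2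
  have h3 := h1.mul h2
  convert! h3 using 1
  simp

/-- Permuting the indices of the variables permutes the rows of the determinant. -/
lemma act_garsiaHaimanDelta (σ : Equiv.Perm (Fin n)) (ν : YoungDiagram) :
    act σ (garsiaHaimanDelta 𝕜 n ν) =
      ((Equiv.Perm.sign σ : ℤ) : 𝕜) • garsiaHaimanDelta 𝕜 n ν := by
  have h := Matrix.det_permute σ (Matrix.of fun i j : Fin n =>
    (X (Sum.inl i) : Poly 𝕜 n) ^ ((biexponents ν).getD j (0, 0)).1 *
      X (Sum.inr i) ^ ((biexponents ν).getD j (0, 0)).2)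
  rw [Algebra.smul_def, map_intCast]
  refine Eq.trans ?_ h
  change rename (R := 𝕜) (Sum.map σ σ) _ = _
  rw [garsiaHaimanDelta, AlgHom.map_det]
  congr 1
  ext1 i j
  simp

variable [CharZero 𝕜]

lemma garsiaHaimanM_le (ν : YoungDiagram) :
    garsiaHaimanM 𝕜 n ν ≤
      restrictTotalDegree _ 𝕜 (totalDegree (garsiaHaimanDelta 𝕜 n ν)) := by
  refine Submodule.span_le.2 ?_
  rintro _ ⟨a, rfl⟩
  exact (mem_restrictTotalDegree _ _ _).2 (totalDegree_partialD_le _ _)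

end Delta

/-! ## The combinatorics of the intersections -/

section Words

variable {ι K : Type*} [DecidableEq ι] [Fintype ι] [Field K]

omit [Fintype ι] in
lemma exchange_mem {S A : Finset ι} {i j : ι} (hij : i ≠ j)
    (hA : S.erase i ⊆ A ∧ i ∉ A) :
    S.erase j ⊆ insert i (A.erase j) ∧ j ∉ insert i (A.erase j) := by
  refine ⟨fun w hw => ?_, by grind⟩
  have := @hA.1 w
  simp only [Finset.mem_erase, Finset.mem_insert] at this hw ⊢
  tauto

omit [Fintype ι] in
lemma exchange_exchange {S A : Finset ι} {i j : ι} (hj : j ∈ S) (hij : i ≠ j)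
    (hA : S.erase i ⊆ A ∧ i ∉ A) : insert j ((insert i (A.erase j)).erase i) = A := by
  have h1 : j ∈ A := hA.1 (Finset.mem_erase.2 ⟨hij.symm, hj⟩)
  have h2 := hA.2
  ext w
  simp only [Finset.mem_erase, Finset.mem_insert]
  by_cases hw : w = i
  · subst hw; tauto
  · by_cases hw' : w = j
    · subst hw'; tauto
    · tauto

/-- If `T_i χ(A) = T_j χ(A ∪ {i} ∖ {j})`, then the sum of `χ(A)` over the sets containing `S` is an
alternating combination of the sums over the sets containing a point of `S`. -/
theorem sum_superset_eq {T : ι → K} (hT0 : ∀ i, T i ≠ 0) (hT : Function.Injective T)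
    {χ : Finset ι → K}
    (hχ : ∀ A i j, i ∉ A → j ∈ A → T i * χ A = T j * χ (insert i (A.erase j)))
    {S : Finset ι} (hS : S.Nonempty) :
    ∑ A with S ⊆ A, χ A =
      ∑ s ∈ S, (∏ r ∈ S.erase s, (1 - T s / T r)⁻¹) * ∑ A with s ∈ A, χ A := by
  induction hk : S.card using Nat.strong_induction_on generalizing S with
  | _ k ih =>
    subst hk
    rcases (Nat.one_le_iff_ne_zero.2 hS.card_pos.ne').eq_or_lt with h1 | h1
    · obtain ⟨s, rfl⟩ := Finset.card_eq_one.1 h1.symm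
      simp
    · obtain ⟨i, hi, j, hj, hij⟩ := Finset.one_lt_card.1 h1
      have hsub : ∀ x ∈ S, ∀ y ∈ S, x ≠ y → ∑ A with S.erase x ⊆ A, χ A =
          ∑ s ∈ S.erase x, (∏ r ∈ (S.erase x).erase s, (1 - T s / T r)⁻¹) *
            ∑ A with s ∈ A, χ A := fun x hx y hy hxy =>
        ih _ (Finset.card_erase_lt_of_mem hx) ⟨y, Finset.mem_erase.2 ⟨hxy.symm, hy⟩⟩ rfl
      -- Dropping x from S removes exactly the factor of r = x from each remaining coefficient.
      have hw : ∀ x ∈ S, ∀ s ∈ S.erase x, (1 - T s / T x) * ∏ r ∈ S.erase s, (1 - T s / T r)⁻¹ =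
          ∏ r ∈ (S.erase x).erase s, (1 - T s / T r)⁻¹ := by
        intro x hx s hs
        have hxs : x ∈ S.erase s := Finset.mem_erase.2 ⟨(Finset.mem_erase.1 hs).1.symm, hx⟩
        have hne : 1 - T s / T x ≠ 0 := by
          rw [sub_ne_zero, ne_comm, Ne, div_eq_one_iff_eq (hT0 x)]
          exact fun h => (Finset.mem_erase.1 hs).1 (hT h)
        rw [← Finset.mul_prod_erase _ _ hxs, mul_inv_cancel_left₀ hne, Finset.erase_right_comm]
      -- The summand s = x, absent from the induction hypothesis, may be included because T_x - T_x
      -- = 0.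
      have hsum : ∀ x ∈ S, ∀ y ∈ S, x ≠ y → T x * ∑ A with S.erase x ⊆ A, χ A =
          ∑ s ∈ S, (T x - T s) * ((∏ r ∈ S.erase s, (1 - T s / T r)⁻¹) *
            ∑ A with s ∈ A, χ A) := by
        intro x hx y hy hxy
        rw [hsub x hx y hy hxy, ← Finset.add_sum_erase _ _ hx, sub_self, zero_mul, zero_add,
          Finset.mul_sum]
        refine Finset.sum_congr rfl fun s hs => ?_
        rw [← hw x hx s hs]
        have := hT0 x
        field_simp
      have hsplit : ∀ x ∈ S, ∑ A with S.erase x ⊆ A, χ A =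
          ∑ A with S ⊆ A, χ A + ∑ A with S.erase x ⊆ A ∧ x ∉ A, χ A := by
        intro x hx
        rw [← Finset.sum_filter_add_sum_filter_not (Finset.univ.filter fun A => S.erase x ⊆ A)
          (fun A => x ∈ A), Finset.filter_filter, Finset.filter_filter]
        congr 1
        refine Finset.sum_congr (Finset.filter_congr fun A _ => ?_) fun _ _ => rfl
        refine ⟨fun h => ?_, fun h => ⟨(Finset.erase_subset _ _).trans h, h hx⟩⟩
        rw [← Finset.insert_erase hx]
        exact Finset.insert_subset h.2 h.1
      -- Exchanging i and j is a bijection between the leftover sets, those containing S except i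
      -- and those containing S except j.
      have hex : T i * ∑ A with S.erase i ⊆ A ∧ i ∉ A, χ A =
          T j * ∑ A with S.erase j ⊆ A ∧ j ∉ A, χ A := by
        rw [Finset.mul_sum, Finset.mul_sum]
        refine Finset.sum_bij' (fun A _ => insert i (A.erase j)) (fun A _ => insert j (A.erase i))
          (fun A hA => ?_) (fun A hA => ?_) (fun A hA => ?_) (fun A hA => ?_) fun A hA => ?_ <;>
          simp only [Finset.mem_filter_univ] at hA ⊢
        · exact exchange_mem hij hA
        · exact exchange_mem hij.symm hA
        · exact exchange_exchange hj hij hA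
        · exact exchange_exchange hi hij.symm hA
        · exact hχ A i j hA.2 (hA.1 (Finset.mem_erase.2 ⟨hij.symm, hj⟩))
      have h2 := hsum i hi j hj hij
      have h3 := hsum j hj i hi hij.symm
      rw [hsplit i hi] at h2
      rw [hsplit j hj] at h3
      have hne : T i - T j ≠ 0 := sub_ne_zero.2 fun h => hij (hT h)
      refine mul_left_cancel₀ hne ?_
      -- Eliminating the leftover sums gives (T_i - T_j) Σ_S = T_i Σ_{S∖i} - T_j Σ_{S∖j}; in the
      -- difference the factors T_i - T_s and T_j - T_s combine to T_i - T_j.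
      have h4 : (T i - T j) * ∑ A with S ⊆ A, χ A = ∑ s ∈ S, (T i - T s) *
          ((∏ r ∈ S.erase s, (1 - T s / T r)⁻¹) * ∑ A with s ∈ A, χ A) -
          ∑ s ∈ S, (T j - T s) *
          ((∏ r ∈ S.erase s, (1 - T s / T r)⁻¹) * ∑ A with s ∈ A, χ A) := by
        rw [← h2, ← h3]
        linear_combination -hex
      rw [h4, ← Finset.sum_sub_distrib, Finset.mul_sum]
      exact Finset.sum_congr rfl fun s _ => by ring

end Words

/-! ## The Hilbert series -/

section Hilbert

variable {𝕜 : Type*} [Field 𝕜] {n : ℕ}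

lemma partsOf_single_one (n : ℕ) : partsOf (Finsupp.single 1 n) = Multiset.replicate n 1 := by
  rw [partsOf, Finsupp.toMultiset_single, Multiset.map_nsmul, Multiset.map_singleton,
    Multiset.nsmul_singleton]
  rfl

lemma content_partition_eq_single_iff (σ : Equiv.Perm (Fin n)) :
    content σ.partition.parts = Finsupp.single 1 n ↔ σ = 1 := by
  constructor
  · intro h
    have h1 := partsOf_content (s := σ.partition.parts) fun _ => σ.partition.parts_pos
    rw [h, partsOf_single_one] at h1
    rw [← Equiv.Perm.cycleType_eq_zero]
    refine Multiset.eq_zero_of_forall_notMem fun m hm => ?_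
    have h2 : m ∈ σ.partition.parts := by
      rw [Equiv.Perm.parts_partition]
      exact Multiset.mem_add.2 (Or.inl hm)
    rw [← h1] at h2
    have h3 := Equiv.Perm.two_le_of_mem_cycleType hm
    rw [Multiset.eq_of_mem_replicate h2] at h3
    omega
  · rintro rfl
    rw [Equiv.Perm.parts_partition]
    simp only [Equiv.Perm.cycleType_one, Equiv.Perm.support_one, Finset.card_empty, zero_add,
      Nat.sub_zero, Fintype.card_fin]
    rw [← partsOf_single_one, content_partsOf]

lemma character_one (W : Submodule 𝕜 (Poly 𝕜 n)) [Module.Finite 𝕜 W] :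
    character W 1 = Module.finrank 𝕜 W := by
  have h1 : ∀ f : Poly 𝕜 n, act 1 f = f := fun f => by
    change rename (Sum.map id id) f = f
    rw [Sum.map_id_id, rename_id_apply]
  have h : ∀ f ∈ W, act 1 f ∈ W := fun f hf => by rwa [h1]
  rw [character, dif_pos h, ← LinearMap.trace_id]
  congr 1
  exact LinearMap.ext fun f => Subtype.ext (h1 f)

/-- The Hilbert series is read off from the Frobenius characteristic. -/
theorem hilbertSeries_eq [CharZero 𝕜] {N : ℕ} {W : Submodule 𝕜 (Poly 𝕜 n)}
    (hW : W ≤ restrictTotalDegree _ 𝕜 N) :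
    hilbertSeries W = constantCoeff ((pderiv (1 : ℕ+))^[n] (frobenius W)) := by
  have : Module.Finite 𝕜 W :=
    Module.Finite.of_injective (Submodule.inclusion hW) (Submodule.inclusion_injective _)
  -- Only the identity has cycle type 1^n, and the factorial from differentiating p_1^n cancels the
  -- averaging factor.
  rw [constantCoeff_iterate_pderiv, frobenius, coeff_C_mul, coeff_sum,
    mul_inv_cancel_left₀ (Nat.cast_ne_zero.2 (Nat.factorial_ne_zero n)), Finset.sum_eq_single 1]
  · rw [powerSum_eq, coeff_C_mul, coeff_monomial,
      if_pos ((content_partition_eq_single_iff _).2 rfl), mul_one]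
    refine finsum_congr fun d => ?_
    have : Module.Finite 𝕜 (W ⊓ bihom 𝕜 n d : Submodule 𝕜 (Poly 𝕜 n)) :=
      Module.Finite.of_injective (Submodule.inclusion inf_le_left)
        (Submodule.inclusion_injective _)
    rw [character_one, map_natCast, map_natCast]
  · intro σ _ hσ
    rw [powerSum_eq, coeff_C_mul, coeff_monomial,
      if_neg (mt (content_partition_eq_single_iff σ).1 hσ), mul_zero]
  · exact fun h => absurd (Finset.mem_univ _) h

end Hilbert

/-! ## Spans of subsets of a linearly independent set -/

section Spans

variable {𝕜 V : Type*} [Field 𝕜] [AddCommGroup V] [Module 𝕜 V] {B : Set V}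

lemma disjoint_span_of_linearIndependent (hB : LinearIndependent 𝕜 (Subtype.val : B → V))
    {C D : Set V} (hC : C ⊆ B) (hD : D ⊆ B) (hCD : Disjoint C D) :
    Disjoint (Submodule.span 𝕜 C) (Submodule.span 𝕜 D) := by
  have h := hB.disjoint_span_image (s := Subtype.val ⁻¹' C) (t := Subtype.val ⁻¹' D)
    (hCD.preimage _)
  rwa [Subtype.image_preimage_coe, Subtype.image_preimage_coe, Set.inter_eq_right.2 hC,
    Set.inter_eq_right.2 hD] at h

/-- Expansions in B are unique, so a vector lying in every span has its support in every C s. -/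
lemma iInf_span_eq (hB : LinearIndependent 𝕜 (Subtype.val : B → V)) {ι : Type*} {S : Finset ι}
    (hS : S.Nonempty) {C : ι → Set V} (hC : ∀ s, C s ⊆ B) :
    ⨅ s ∈ S, Submodule.span 𝕜 (C s) = Submodule.span 𝕜 {b ∈ B | ∀ s ∈ S, b ∈ C s} := by
  refine le_antisymm (fun f hf => ?_)
    (le_iInf₂ fun s hs => Submodule.span_mono fun b hb => hb.2 s hs)
  have himg : ∀ D : Set V, D ⊆ B → D = (Subtype.val : B → V) '' (Subtype.val ⁻¹' D) := fun D hD => by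
    rw [Subtype.image_preimage_coe, Set.inter_eq_right.2 hD]
  have h1 : ∀ s ∈ S, ∃ l ∈ Finsupp.supported 𝕜 𝕜 ((Subtype.val : B → V) ⁻¹' C s),
      Finsupp.linearCombination 𝕜 (Subtype.val : B → V) l = f := by
    intro s hs
    rw [← Finsupp.mem_span_image_iff_linearCombination, ← himg _ (hC s)]
    exact iInf₂_le (f := fun s (_ : s ∈ S) => Submodule.span 𝕜 (C s)) s hs hf
  obtain ⟨s₀, hs₀⟩ := hS
  obtain ⟨l, -, hl⟩ := h1 s₀ hs₀
  rw [himg {b ∈ B | ∀ s ∈ S, b ∈ C s} fun b hb => hb.1,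
    Finsupp.mem_span_image_iff_linearCombination]
  refine ⟨l, fun b hb => ⟨b.2, fun s hs => ?_⟩, hl⟩
  obtain ⟨l', hl', h⟩ := h1 s hs
  rw [hB.finsuppLinearCombination_injective (hl.trans h.symm)] at hb
  exact hl' hb

end Spans

/-! ## Intersections under the Science Fiction property -/

section Intersections

variable {𝕜 : Type*} [Field 𝕜] {n : ℕ} {μ : YoungDiagram}

instance : Finite (Corner μ) :=
  Finite.of_injective (fun c : Corner μ => (⟨c.1, c.2.1⟩ : {x // x ∈ μ.cells})) fun _ _ h =>
    Subtype.ext (congrArg (fun x : {x // x ∈ μ.cells} => (x : ℕ × ℕ)) h)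

/-- Equal values would give equal weights of the removed cells; at t = 1 these are powers of q that
determine the columns. -/
lemma T_predecessor_injective [CharZero 𝕜] :
    Function.Injective fun c : Corner μ => T (qq 𝕜) (tt 𝕜) (predecessor c) := by
  intro c d h
  have h : T (qq 𝕜) (tt 𝕜) (predecessor c) = T (qq 𝕜) (tt 𝕜) (predecessor d) := h
  have h1 := (T_predecessor (qq 𝕜) (tt 𝕜) c).trans (T_predecessor (qq 𝕜) (tt 𝕜) d).symm
  rw [h] at h1
  have h2 := mul_right_cancel₀ (T_ne_zero qq_ne_zero tt_ne_zero _) h1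
  have hv : ∀ x : Corner μ, HasValueOne (tt 𝕜 ^ x.1.1 * qq 𝕜 ^ x.1.2)
      ((1 : RatFunc 𝕜) ^ x.1.1 * RatFunc.X ^ x.1.2) := fun x =>
    (HasValue.var.pow _).mul ((HasValue.const (f := RingHom.id _) _).pow _)
  have h3 := hv c
  rw [h2] at h3
  have h4 := h3.2.symm.trans (hv d).2
  rw [one_pow, one_pow, one_mul, one_mul] at h4
  exact Corner.eq_of_snd_eq (X_pow_injective 𝕜 h4)

/-- The word of a set of corners. -/
def wordOf (A : Finset (Corner μ)) : Corner μ → Bool := fun i => decide (i ∈ A)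

lemma complementExcept_wordOf [Fintype (Corner μ)] {A : Finset (Corner μ)} {i : Corner μ}
    (hi : i ∈ A) : complementExcept i (wordOf A) = wordOf (insert i Aᶜ) := by
  ext j
  by_cases h : j = i <;> simp [complementExcept, wordOf, h, hi]

lemma mem_cellOf_wordOf {B : Set (Poly 𝕜 n)} {Bi : Corner μ → Set (Poly 𝕜 n)}
    {A : Finset (Corner μ)} {b : Poly 𝕜 n} :
    b ∈ cellOf B Bi (wordOf A) ↔ b ∈ B ∧ ∀ i, b ∈ Bi i ↔ i ∈ A := by
  simp only [cellOf, wordOf, decide_eq_true_eq]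
  rfl

/-- The common part of some of the sets `B_i` is a union of the cells `B^ε`. -/
lemma iUnion_cellOf [Fintype (Corner μ)] (B : Set (Poly 𝕜 n)) (Bi : Corner μ → Set (Poly 𝕜 n))
    (S : Finset (Corner μ)) :
    ⋃ A ∈ Finset.univ.filter (S ⊆ ·), cellOf B Bi (wordOf A) = {b ∈ B | ∀ s ∈ S, b ∈ Bi s} := by
  classical
  ext b
  simp only [Set.mem_iUnion, Finset.mem_filter_univ, mem_cellOf_wordOf, exists_prop]
  constructor
  · rintro ⟨A, hA, hb, h⟩
    exact ⟨hb, fun s hs => (h s).2 (hA hs)⟩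
  · rintro ⟨hb, h⟩
    refine ⟨Finset.univ.filter fun i => b ∈ Bi i, fun s hs => ?_, hb, fun i => ?_⟩
    · simpa using h s hs
    · simp

lemma disjoint_cellOf {B : Set (Poly 𝕜 n)} {Bi : Corner μ → Set (Poly 𝕜 n)}
    {A A' : Finset (Corner μ)} (h : A ≠ A') :
    Disjoint (cellOf B Bi (wordOf A)) (cellOf B Bi (wordOf A')) := by
  rw [Set.disjoint_left]
  intro b hb hb'
  rw [mem_cellOf_wordOf] at hb hb'
  exact h (Finset.ext fun i => (hb.2 i).symm.trans (hb'.2 i))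

variable [CharZero 𝕜]

lemma isInvariant_flip (ν : YoungDiagram) {U : Submodule 𝕜 (Poly 𝕜 n)} (hU : IsInvariant U) :
    IsInvariant (flip (garsiaHaimanDelta 𝕜 n ν) U) := by
  intro σ g hg
  rw [flip_eq_map] at hg ⊢
  obtain ⟨P, hP, rfl⟩ := hg
  rw [act_applyHom, act_garsiaHaimanDelta, applyHom_smul]
  exact Submodule.smul_mem _ _ ⟨_, hU σ P hP, rfl⟩

omit [CharZero 𝕜] in
/-- Isomorphisms `flip U ≅ U'` and `flip U' ≅ U` force the flip to be injective on `U`. -/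
lemma applyHom_injOn_of_iso {f : Poly 𝕜 n} {U U' : Submodule 𝕜 (Poly 𝕜 n)} [Module.Finite 𝕜 U]
    [Module.Finite 𝕜 U'] (h : BigradedIso (flip f U) U') (h' : BigradedIso (flip f U') U) :
    ∀ P ∈ U, applyHom f P = 0 → P = 0 := by
  obtain ⟨e, -⟩ := h
  obtain ⟨e', -⟩ := h'
  have h1 := e.finrank_eq
  have h2 := e'.finrank_eq
  rw [flip_eq_map] at h1 h2
  have h3 := Submodule.finrank_map_le (applyHom f) U'
  have h4 := LinearMap.finrank_range_add_finrank_ker ((applyHom f).domRestrict U)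
  rw [LinearMap.range_domRestrict] at h4
  -- The isomorphisms give dim U' = dim flip U ≤ dim U and dim U = dim flip U' ≤ dim U', so the flip
  -- has full rank on U.
  have h5 : Module.finrank 𝕜 (LinearMap.ker ((applyHom f).domRestrict U)) = 0 := by omega
  rw [Submodule.finrank_eq_zero, LinearMap.ker_eq_bot'] at h5
  exact fun P hP h0 => congrArg Subtype.val (h5 ⟨P, hP⟩ h0)

/-- Under the Science Fiction property, the bigraded character of an intersection of modules is an
alternating combination of those of the modules. -/
theorem bigradedCharacter_iInf (hμ : μ.card = n + 1) (hSF : ScienceFiction 𝕜 n μ)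
    {S : Finset (Corner μ)} (hS : S.Nonempty) (σ : Equiv.Perm (Fin n)) :
    bigradedCharacter (⨅ s ∈ S, garsiaHaimanM 𝕜 n (predecessor s)) σ =
      ∑ s ∈ S, weight 𝕜 S s * bigradedCharacter (garsiaHaimanM 𝕜 n (predecessor s)) σ := by
  classical
  have := Fintype.ofFinite (Corner μ)
  obtain ⟨B, Bi, hLI, hspan, hhom, hBi, hinv, hiso⟩ := hSF
  let N := Finset.univ.sup fun i : Corner μ => totalDegree (garsiaHaimanDelta 𝕜 n (predecessor i))
  have hN : ∀ C ⊆ B, Submodule.span 𝕜 C ≤ restrictTotalDegree _ 𝕜 N := by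
    intro C hC
    refine (Submodule.span_mono hC).trans (hspan.le.trans (iSup_le fun i f hf => ?_))
    rw [mem_restrictTotalDegree]
    exact ((mem_restrictTotalDegree _ _ _).1 (garsiaHaimanM_le _ hf)).trans
      (Finset.le_sup (f := fun i : Corner μ =>
        totalDegree (garsiaHaimanDelta 𝕜 n (predecessor i))) (Finset.mem_univ i))
  let cell : Finset (Corner μ) → Set (Poly 𝕜 n) := fun A => cellOf B Bi (wordOf A)
  have hcell : ∀ A, cell A ⊆ B := fun A b hb => hb.1
  have htame : ∀ A, IsTame N (Submodule.span 𝕜 (cell A)) := fun A =>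
    ⟨hinv _, isGraded_span fun b hb => hhom b (hcell A hb), hN _ (hcell A)⟩
  let χ : Finset (Corner μ) → Coef 𝕜 := fun A => bigradedCharacter (Submodule.span 𝕜 (cell A)) σ
  -- Distinct cells are disjoint subsets of a basis, so their spans are independent and the
  -- characters add.
  have hunion : ∀ 𝒜 : Finset (Finset (Corner μ)), IsTame N (Submodule.span 𝕜 (⋃ A ∈ 𝒜, cell A)) ∧
      bigradedCharacter (Submodule.span 𝕜 (⋃ A ∈ 𝒜, cell A)) σ = ∑ A ∈ 𝒜, χ A := by
    intro 𝒜
    induction 𝒜 using Finset.induction with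
    | empty =>
      simp only [Finset.notMem_empty, Set.iUnion_of_empty, Set.iUnion_empty,
        Submodule.span_empty, Finset.sum_empty]
      refine ⟨⟨fun σ f hf => ?_, fun f hf d => ?_, bot_le⟩, ?_⟩
      · rw [(Submodule.mem_bot 𝕜).1 hf, map_zero]
        exact zero_mem _
      · rw [(Submodule.mem_bot 𝕜).1 hf, map_zero]
        exact zero_mem _
      · rw [bigradedCharacter_eq_sum (N := N) bot_le]
        simp [character_bot]
    | insert A 𝒜 hA ih =>
      rw [Finset.set_biUnion_insert, Submodule.span_union, Finset.sum_insert hA, ← ih.2]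
      refine ⟨isTame_sup (htame A) ih.1, bigradedCharacter_sup (htame A) ih.1 ?_⟩
      refine disjoint_span_of_linearIndependent hLI (hcell A)
        (Set.iUnion₂_subset fun A' _ => hcell A') ?_
      rw [Set.disjoint_iUnion₂_right]
      exact fun A' hA' => disjoint_cellOf fun h => hA (h ▸ hA')
  -- Complementing all letters but the i-th is an involution, so the SF property supplies
  -- isomorphisms in both directions and the flip is injective.
  have hflip : ∀ (A : Finset (Corner μ)) i, i ∈ A → χ (insert i Aᶜ) =
      RatFunc.C (RatFunc.C ((Equiv.Perm.sign σ : ℤ) : 𝕜)) * T (qq 𝕜) (tt 𝕜) (predecessor i) *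
        dualCharacter (Submodule.span 𝕜 (cell A)) σ := by
    intro A i hi
    have h1 := hiso i (wordOf A) (by simpa [wordOf] using hi)
    have h2 := hiso i (wordOf (insert i Aᶜ)) (by simp [wordOf])
    have h3 : insert i (insert i Aᶜ)ᶜ = A := by
      ext j
      by_cases h : j = i <;> simp [h, hi]
    rw [complementExcept_wordOf hi] at h1
    rw [complementExcept_wordOf (Finset.mem_insert_self _ _), h3] at h2
    have := (htame A).finite
    have := (htame (insert i Aᶜ)).finite
    have hc := card_predecessor i
    rw [T_eq_topDegree _ _ (show (predecessor i).card = n by omega),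
      ← bigradedCharacter_flip (htame A).invariant (htame A).graded (garsiaHaimanDelta_mem _)
        (act_garsiaHaimanDelta σ _) (applyHom_injOn_of_iso h1 h2)]
    exact (bigradedCharacter_congr (isInvariant_flip _ (htame A).invariant) h1).symm
  -- The set {j} ∪ Aᶜ contains both i and j; flipping its cell by j gives χ(A), by i gives χ(A ∪ {i}
  -- ∖ {j}).
  have hχ : ∀ A i j, i ∉ A → j ∈ A → T (qq 𝕜) (tt 𝕜) (predecessor i) * χ A =
      T (qq 𝕜) (tt 𝕜) (predecessor j) * χ (insert i (A.erase j)) := by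
    intro A i j hi hj
    have h1 : insert j (insert j Aᶜ)ᶜ = A := by
      ext k
      by_cases h : k = j <;> simp [h, hj]
    have h2 : insert i (insert j Aᶜ)ᶜ = insert i (A.erase j) := by
      ext k
      simp
    have h3 := hflip (insert j Aᶜ) j (by simp)
    have h4 := hflip (insert j Aᶜ) i (by simp [hi])
    rw [h1] at h3
    rw [h2] at h4
    rw [h3, h4]
    ring
  have hinter : ∀ S : Finset (Corner μ), S.Nonempty →
      bigradedCharacter (⨅ s ∈ S, garsiaHaimanM 𝕜 n (predecessor s)) σ = ∑ A with S ⊆ A, χ A := by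
    intro S hS
    rw [← (hunion _).2, iUnion_cellOf, ← iInf_span_eq hLI hS fun s => (hBi s).1]
    simp only [(hBi _).2]
  rw [hinter S hS, sum_superset_eq (T := fun i => T (qq 𝕜) (tt 𝕜) (predecessor i))
    (fun i => T_ne_zero qq_ne_zero tt_ne_zero _) T_predecessor_injective hχ hS]
  refine Finset.sum_congr rfl fun s _ => ?_
  -- The sum of χ over the sets containing s is the character of a single module, the intersection
  -- over {s}.
  have h := hinter {s} (Finset.singleton_nonempty s)
  simp only [Finset.mem_singleton, iInf_iInf_eq_left, Finset.singleton_subset_iff] at h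
  rw [h]
  rfl

theorem frobenius_iInf (hμ : μ.card = n + 1) (hSF : ScienceFiction 𝕜 n μ)
    {S : Finset (Corner μ)} (hS : S.Nonempty) :
    frobenius (⨅ s ∈ S, garsiaHaimanM 𝕜 n (predecessor s)) =
      ∑ s ∈ S, C (weight 𝕜 S s) * frobenius (garsiaHaimanM 𝕜 n (predecessor s)) := by
  simp only [frobenius, bigradedCharacter_iInf hμ hSF hS, map_sum, Finset.sum_mul, Finset.mul_sum,
    map_mul]
  rw [Finset.sum_comm]
  exact Finset.sum_congr rfl fun s _ => Finset.sum_congr rfl fun σ _ => by ring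

/-- The Frobenius characteristic and the Hilbert series of an intersection of modules. -/
theorem frobenius_hilbertSeries_iInf (hμ : μ.card = n + 1) (hSF : ScienceFiction 𝕜 n μ)
    {S : Finset (Corner μ)} (hS : S.Nonempty)
    (hF : ∀ s ∈ S, frobenius (garsiaHaimanM 𝕜 n (predecessor s)) =
      modifiedH (qq 𝕜) (tt 𝕜) (predecessor s)) :
    frobenius (⨅ s ∈ S, garsiaHaimanM 𝕜 n (predecessor s)) =
        ∑ s ∈ S, C (weight 𝕜 S s) * modifiedH (qq 𝕜) (tt 𝕜) (predecessor s) ∧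
      hilbertSeries (⨅ s ∈ S, garsiaHaimanM 𝕜 n (predecessor s)) = hilbertF 𝕜 n S := by
  have h : frobenius (⨅ s ∈ S, garsiaHaimanM 𝕜 n (predecessor s)) =
      ∑ s ∈ S, C (weight 𝕜 S s) * modifiedH (qq 𝕜) (tt 𝕜) (predecessor s) := by
    rw [frobenius_iInf hμ hSF hS]
    exact Finset.sum_congr rfl fun s hs => by rw [hF s hs]
  refine ⟨h, ?_⟩
  obtain ⟨s, hs⟩ := hS
  rw [hilbertSeries_eq ((iInf₂_le s hs).trans (garsiaHaimanM_le _)), h, hilbertF,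
    constantCoeff_iterate_pderiv, coeff_sum, Finset.mul_sum]
  refine Finset.sum_congr rfl fun s _ => ?_
  rw [coeff_C_mul, constantCoeff_iterate_pderiv]
  ring

end Intersections

end SciFi

end

open SciFi in
theorem proposition3p5 {𝕜 : Type*} [Field 𝕜] [CharZero 𝕜] (n : ℕ) (μ : YoungDiagram)
    (hμ : μ.card = n + 1) (S : Finset (Corner μ)) (hS : S.Nonempty) :
    -- the characteristic and the Hilbert series of the intersection
    (ScienceFiction 𝕜 n μ →
      (∀ s ∈ S, frobenius (garsiaHaimanM 𝕜 n (predecessor s)) =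
        modifiedH (qq 𝕜) (tt 𝕜) (predecessor s)) →
      frobenius (⨅ s ∈ S, garsiaHaimanM 𝕜 n (predecessor s)) =
          ∑ s ∈ S, MvPolynomial.C (weight 𝕜 S s) * modifiedH (qq 𝕜) (tt 𝕜) (predecessor s) ∧
        hilbertSeries (⨅ s ∈ S, garsiaHaimanM 𝕜 n (predecessor s)) = hilbertF 𝕜 n S) ∧
    -- the limit, without any hypothesis: `F(q, t)` is regular at `t = 1`, and `F(q, 1) → n! / k`
    (Polynomial.eval 1 (RatFunc.denom (hilbertF ℚ n S)) ≠ 0 ∧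
      Filter.Tendsto
        (fun x : ℝ => RatFunc.eval (algebraMap ℚ ℝ) x
          (RatFunc.eval (RingHom.id (RatFunc ℚ)) 1 (hilbertF ℚ n S)))
        (𝓝[≠] 1) (𝓝 ((n.factorial : ℝ) / S.card))) := by
  exact ⟨fun hSF hF => frobenius_hilbertSeries_iInf hμ hSF hS hF, tendsto_hilbertF hμ hS⟩
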